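/- Let $\alpha,\theta,\sigma>0$, $\gamma\in(0,1/4)$, $s^*:=2\gamma+\alpha/2-1/2$, and let $m\in\{0,1,2,\dots\}$ be such that $H:=s^*-m\in(0,1)$. Let $K_\gamma(x)=\dfrac{\Gamma(1/2-2\gamma)}{\sqrt{\pi}\,2^{4\gamma}\,\Gamma(2\gamma)}|x|^{4\gamma-1}$ be the Riesz kernel on $\mathbb{R}$, normalised so that its Fourier transform $\int_{\mathbb{R}} e^{-ix\xi}K_\gamma(x)\,dx$ is $|\xi|^{-4\gamma}$, and let $W$ be a centered Gaussian field indexed by $t\ge 0$ and bounded Borel sets $A\subset\mathbb{R}$, defined on a probability space $(\Omega,\mathscr F,\mathbb P)$, with $\mathbb{E}[W(t,A)W(s,B)]=(t\wedge s)\int_A\int_B K_\gamma(x-y)\,dy\,dx$. Let $G_\alpha(t,x)=\frac1{2\pi}\int_{\mathbb{R}}e^{ix\xi-t|\xi|^\alpha}\,d\xi$ be the fundamental solution of $\partial_tG=-(-\Delta)^{\alpha/2}G$ on $\mathbb R$, and let $$X_t(x)=\sigma\int_0^t\int_{\mathbb{R}}G_\alpha(\theta(t-s),x-z)\,W(ds,dz),\qquad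 t\ge0,\ x\in\mathbb{R},$$ (Wiener integral) be the mild solution of $\partial_tX_t=-\theta(-\Delta)^{\alpha/2}X_t+\sigma\dot W$ with $X_0=0$. Then the following hold. (i) The function $\xi\mapsto(1-\cos\xi)|\xi|^{2m-4\gamma-\alpha}$ is integrable on $\mathbb{R}$; put $$c_{\alpha,\gamma,m}:=\Big(\frac1{2\pi}\int_{\mathbb{R}}(1-\cos\xi)\,|\xi|^{2m-4\gamma-\alpha}\,d\xi\Big)^{1/2}.$$ (ii) $X$ has a version such that, for each $t>0$, the function $x\mapsto X_t(x)$ is almost surely $m$ times continuously differentiable. (iii) Let $X$ be any version and $t>0$ such that $x\mapsto X_t(x)$ is almost surely $m$ times continuously differentiable. Then there are a two-sided fractional Brownian motion $B^{H}$ with Hurst index $H=s^*-m$ and almost surely continuous paths (centered Gaussian with $\mathbb{E}[B^H_xB^H_y]=\frac12(|x|^{2H}+|y|^{2H}-|x-y|^{2H})$) and a process $R=(R(x))_{x\in\mathbb{R}}$, both on $(\Omega,\mathscr F,\mathbb P)$, such that the processes $$\big(\partial_x^mX_t(x)\big)_{x\in\mathbb{R}}\quad\text{and}\quad\Big(c_{\alpha,\gamma,m}\frac{\sigma}{\sqrt\theta}\,B^{H}_x+R(x)\Big)_{x\in\mathbb{R}}$$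 have the same distribution, $R\in C^\infty(\mathbb{R})$ almost surely, and for every $x\in\mathbb{R}$, almost surely, $$R(x)-R(0)=\sigma\int_t^\infty\int_{\mathbb{R}}\big((\partial_x^mG_\alpha)(\theta s,-z)-(\partial_x^mG_\alpha)(\theta s,x-z)\big)\,W(ds,dz).$$ -/

import Mathlib

open MeasureTheory ProbabilityTheory Filter Topology
open scoped NNReal ENNReal

noncomputable section

namespace RieszSPDE

/-- Bounded Borel subsets of the real line. -/
abbrev BddBorel : Type := {A : Set ℝ // MeasurableSet A ∧ Bornology.IsBounded A}

/-- The Riesz kernel `K_γ`, `0 < γ < 1/4`, on the real line. The constant is the one for which the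
Fourier transform `∫ exp (-i x ξ) K_γ(x) dx` is `|ξ| ^ (-4γ)`. -/
def rieszKernel (γ x : ℝ) : ℝ :=
  Real.Gamma (1 / 2 - 2 * γ) / (√Real.pi * 2 ^ (4 * γ) * Real.Gamma (2 * γ)) * |x| ^ (4 * γ - 1)

/-- The fundamental solution `G_α(t, ·)` of `∂ₜ G = -(-Δ)^(α/2) G` on the real line,
that is `(2π)⁻¹ ∫ exp (i x ξ - t |ξ|^α) dξ`, for `t > 0`. The integral is real by symmetry. -/
def heatKernel (α t x : ℝ) : ℝ :=
  ((2 * Real.pi : ℂ)⁻¹ *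
    ∫ ξ : ℝ, Complex.exp (Complex.I * (x : ℂ) * (ξ : ℂ) - ((t * |ξ| ^ α : ℝ) : ℂ))).re

section Noise

variable {Ω : Type*} [MeasurableSpace Ω]

/-- `W` is a centered Gaussian field `W(t, A)`, `t ≥ 0`, `A` bounded Borel, with covariance
`E[W(t, A) W(s, B)] = (t ∧ s) ∫_A ∫_B K_γ(x - y) dy dx`. -/
structure IsRieszNoise (P : Measure Ω) (γ : ℝ) (W : ℝ≥0 × BddBorel → Ω → ℝ) : Prop where
  gaussian : IsGaussianProcess W P
  centered : ∀ i, ∫ ω, W i ω ∂P = 0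
  covariance : ∀ (t s : ℝ≥0) (A B : BddBorel),
    ∫ ω, W (t, A) ω * W (s, B) ω ∂P
      = ((min t s : ℝ≥0) : ℝ) *
        ∫ x in (A : Set ℝ), ∫ y in (B : Set ℝ), rieszKernel γ (x - y)

/-- The elementary integrand `∑ᵢ aᵢ 1_{(0, tᵢ]}(s) 1_{Aᵢ}(z)` with coefficients `aᵢ` given by `c`. -/
def elemIntegrand (c : ℝ≥0 × BddBorel →₀ ℝ) (s z : ℝ) : ℝ :=
  c.sum fun i a =>
    a * (Set.Ioc (0 : ℝ) (i.1 : ℝ)).indicator (fun _ => 1) s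
      * (i.2 : Set ℝ).indicator (fun _ => 1) z

/-- The integral `∑ᵢ aᵢ W(tᵢ, Aᵢ)` of an elementary integrand. -/
def elemIntegral (W : ℝ≥0 × BddBorel → Ω → ℝ) (c : ℝ≥0 × BddBorel →₀ ℝ) (ω : Ω) : ℝ :=
  c.sum fun i a => a * W i ω

/-- The squared norm `∫₀^∞ ∫ ∫ |φ(s, y)| K_γ(y - z) |φ(s, z)| dz dy ds` of an integrand on
`(0, ∞) × ℝ`. It dominates the squared norm without absolute values, for which the integral of
elementary integrands is an isometry into `L²(P)`. -/
def energy (γ : ℝ) (φ : ℝ → ℝ → ℝ) : ℝ≥0∞ :=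
  ∫⁻ s in Set.Ioi (0 : ℝ), ∫⁻ y : ℝ, ∫⁻ z : ℝ,
    ENNReal.ofReal (|φ s y| * rieszKernel γ (y - z) * |φ s z|)

/-- `Y` is (a version of) the Wiener integral `∫₀^∞ ∫ φ(s, z) W(ds, dz)`: the `L²(P)`-limit of the
integrals of elementary integrands that approximate `φ` in the norm of integrands. -/
def IsWienerIntegral (P : Measure Ω) (γ : ℝ) (W : ℝ≥0 × BddBorel → Ω → ℝ)
    (φ : ℝ → ℝ → ℝ) (Y : Ω → ℝ) : Prop :=
  MemLp Y 2 P ∧ ∃ c : ℕ → (ℝ≥0 × BddBorel →₀ ℝ),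
    Tendsto (fun n => energy γ (fun s z => elemIntegrand (c n) s z - φ s z)) atTop (𝓝 0) ∧
    Tendsto (fun n => eLpNorm (fun ω => elemIntegral W (c n) ω - Y ω) 2 P) atTop (𝓝 0)

/-- The integrand `(s, z) ↦ σ G_α(θ (t - s), x - z)`, `0 < s < t`, of the mild solution. -/
def mildKernel (α θ σ t x : ℝ) (s z : ℝ) : ℝ :=
  (Set.Ioo (0 : ℝ) t).indicator (fun s => σ * heatKernel α (θ * (t - s)) (x - z)) s

/-- `X` is a mild solution on the whole line, with zero initial condition, of
`∂ₜ X = -θ (-Δ)^(α/2) X + σ Ẇ`, namely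
`X t x = σ ∫₀ᵗ ∫ G_α(θ (t - s), x - z) W(ds, dz)` a.s. for all `t ≥ 0` and all `x`. -/
def IsMildSolution (P : Measure Ω) (α γ θ σ : ℝ) (W : ℝ≥0 × BddBorel → Ω → ℝ)
    (X : ℝ → ℝ → Ω → ℝ) : Prop :=
  ∀ t : ℝ, 0 ≤ t → ∀ x : ℝ, IsWienerIntegral P γ W (mildKernel α θ σ t x) (X t x)

/-- The integrand of the remainder,
`σ ((∂ₓᵐ G_α)(θ s, -z) - (∂ₓᵐ G_α)(θ s, x - z))` for `s > t`. -/
def remainderKernel (α θ σ : ℝ) (m : ℕ) (t x : ℝ) (s z : ℝ) : ℝ :=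
  (Set.Ioi t).indicator
    (fun s => σ * (iteratedDeriv m (heatKernel α (θ * s)) (-z)
      - iteratedDeriv m (heatKernel α (θ * s)) (x - z))) s

/-- `B` is a two-sided fractional Brownian motion with Hurst index `H`: a centered Gaussian process
with the covariance of fBm and almost surely continuous paths. -/
structure IsFractionalBrownianMotion (P : Measure Ω) (H : ℝ) (B : ℝ → Ω → ℝ) : Prop where
  gaussian : IsGaussianProcess B P
  centered : ∀ x, ∫ ω, B x ω ∂P = 0
  covariance : ∀ x y, ∫ ω, B x ω * B y ω ∂P
    = (|x| ^ (2 * H) + |y| ^ (2 * H) - |x - y| ^ (2 * H)) / 2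
  continuous : ∀ᵐ ω ∂P, Continuous fun x => B x ω

end Noise

/-- The function `ξ ↦ (1 - cos ξ) |ξ|^(2m - 4γ - α)`. -/
def constIntegrand (α γ : ℝ) (m : ℕ) (ξ : ℝ) : ℝ :=
  (1 - Real.cos ξ) * |ξ| ^ (2 * (m : ℝ) - 4 * γ - α)

/-- The constant `c_{α,γ,m} ≥ 0`, with
`c_{α,γ,m}² = (2π)⁻¹ ∫ (1 - cos ξ) |ξ|^(2m - 4γ - α) dξ`. -/
def fbmConst (α γ : ℝ) (m : ℕ) : ℝ :=
  √((2 * Real.pi)⁻¹ * ∫ ξ : ℝ, constIntegrand α γ m ξ)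

/-- The optimal regularity `s* = 2γ + α/2 - 1/2`. -/
def optReg (α γ : ℝ) : ℝ := 2 * γ + α / 2 - 1 / 2

end RieszSPDE

end

/-!
The `m`-th derivative of the solution at time `t` is the Gaussian field
`x ↦ σ ∫₀ᵗ ∫ ∂ᵐG(θ (t - s), x - z) W(ds, dz)`. Its law does not change when `t - s` is replaced by
`s`, because the noise is stationary in time; call the field obtained in this way `U`. Adding to
`U(x) - U(0)` the increment `T(x) = σ ∫ₜ^∞ ∫ (∂ᵐG(θ s, x - z) - ∂ᵐG(θ s, -z)) W(ds, dz)`, driven by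
the later noise, gives a field driven by the noise of all times. In the frequency `ξ` the variance
of its increment from `x` to `y` has the density

  `σ² / (2π) |ξ|^(2m) |exp (iyξ) - exp (ixξ)|² |ξ|^(-4γ) ∫₀^∞ exp (-2θs|ξ|^α) ds
    = σ² / (2πθ) (1 - cos ((y - x) ξ)) |ξ|^(2m - 4γ - α)`,

and scaling out `|y - x|` gives `c² σ² / θ |y - x|^(2H)`: the sum is a multiple of a fractional
Brownian motion `B` (`spectralNorm_sub_eq`, `isFractionalBrownianMotion_of_isWienerIntegral`).
Hence `U = c σ / √θ B + R` with `R = U(0) - T`. The field `T` is smooth since the factor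
`exp (-2θt|ξ|^α)` makes all high moments of its spectral measure finite (`exists_smooth_remainder`).

Three tools carry this.

* The isometry. The Riesz kernel is a mixture of Gaussians, and every Gaussian is an overlap of two
  others, so that `K(y - z) = ∫ r(e, y) r(e, z) de` with `r = rieszRoot ≥ 0`. Integrating an
  integrand `φ` against `r` gives a function `integrandRoot γ φ` in an honest `L²` space, whose norm
  is that of the Wiener integral of `φ` (`IsWienerIntegral.eLpNorm_eq`). Its square is at most the
  energy of `φ`.
  Integrands of finite energy that are continuous on a time interval are limits of elementary ones
  (`isApproximable_of_continuousOn`), which gives existence of the integrals.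
* The spectral formula. For combinations of derivatives of the heat kernel, Plancherel's theorem
  applied to the Gaussians `r` turns the norm into an integral over frequencies
  (`lintegral_sq_sum_heatDeriv`, `eLpNorm_sq_sum_heatField`).
* Path regularity. Kolmogorov's continuity theorem (`exists_continuous_version`) applies to Gaussian
  fields whose increments have Hölder continuous variance. If the `k`-th field is differentiable in
  `L²(P)` with the `(k + 1)`-st field as derivative, with a rate, then integrating a continuous
  version of the latter gives a version of the former (`ae_sub_eq_integral`). Descending from the
  `m`-th field gives versions with `m` continuous derivatives (`exists_contDiff_version`).
-/

open MeasureTheory ProbabilityTheory Filter Topology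
open scoped NNReal ENNReal

noncomputable section

namespace RieszSPDE

/-! ### The Riesz kernel as a mixture of Gaussians -/

theorem lintegral_rpow_mul_exp_neg_mul {a c : ℝ} (ha : 0 < a) (hc : 0 < c) :
    ∫⁻ u in Set.Ioi (0 : ℝ), ENNReal.ofReal (u ^ (a - 1) * Real.exp (-(c * u)))
      = ENNReal.ofReal (Real.Gamma a * c ^ (-a)) := by
  rw [← ofReal_integral_eq_lintegral_ofReal]
  · rw [Real.integral_rpow_mul_exp_neg_mul_Ioi ha hc, mul_comm, one_div, Real.inv_rpow hc.le,
      Real.rpow_neg hc.le]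
  · have := integrableOn_rpow_mul_exp_neg_mul_rpow (p := 1) (s := a - 1) (b := c) (by linarith)
      one_pos hc
    simpa [IntegrableOn, Real.rpow_one, neg_mul] using this
  · filter_upwards [self_mem_ae_restrict measurableSet_Ioi] with u hu
    have : (0 : ℝ) < u := hu
    positivity

theorem lintegral_gaussian_overlap {u : ℝ} (hu : 0 < u) (y z : ℝ) :
    ∫⁻ w : ℝ, ENNReal.ofReal (Real.exp (-2 * u * (y - w) ^ 2)) *
        ENNReal.ofReal (Real.exp (-2 * u * (z - w) ^ 2))
      = ENNReal.ofReal (√(Real.pi / (4 * u)) * Real.exp (-(u * (y - z) ^ 2))) := by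
  have h1 : ∀ w : ℝ, ENNReal.ofReal (Real.exp (-2 * u * (y - w) ^ 2)) *
        ENNReal.ofReal (Real.exp (-2 * u * (z - w) ^ 2))
      = ENNReal.ofReal (Real.exp (-(4 * u) * (w - (y + z) / 2) ^ 2)) *
        ENNReal.ofReal (Real.exp (-(u * (y - z) ^ 2))) := by
    intro w
    rw [← ENNReal.ofReal_mul (by positivity), ← ENNReal.ofReal_mul (by positivity),
      ← Real.exp_add, ← Real.exp_add]
    congr 2
    ring
  simp_rw [h1]
  rw [lintegral_mul_const _ (by fun_prop),
    lintegral_sub_right_eq_self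
      (fun w : ℝ => ENNReal.ofReal (Real.exp (-(4 * u) * w ^ 2))) ((y + z) / 2),
    ← ofReal_integral_eq_lintegral_ofReal (integrable_exp_neg_mul_sq (by positivity))
      (ae_of_all _ fun _ => by positivity), integral_gaussian,
    ← ENNReal.ofReal_mul (by positivity)]

/-- The weight of the Gaussians of parameter `u` in the mixture for the Riesz kernel, normalised
for the square root `rieszRoot`. -/
def mixWeight (γ u : ℝ) : ℝ :=
  √((√Real.pi * 2 ^ (4 * γ) * Real.Gamma (2 * γ))⁻¹ * u ^ (1 / 2 - 2 * γ - 1) /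
    √(Real.pi / (4 * u)))

/-- A nonnegative square root of the Riesz kernel: the integral of
`rieszRoot γ e y * rieszRoot γ e z` over the parameters `e = (u, w)` is `rieszKernel γ (y - z)`. -/
def rieszRoot (γ : ℝ) (e : ℝ × ℝ) (y : ℝ) : ℝ :=
  mixWeight γ e.1 * Real.exp (-2 * e.1 * (y - e.2) ^ 2)

/-- The measure on the space of parameters `(u, w)`, `u > 0`, of `rieszRoot`. -/
def mixMeasure : Measure (ℝ × ℝ) := (volume.restrict (Set.Ioi (0 : ℝ))).prod volume

instance : SFinite mixMeasure := by unfold mixMeasure; infer_instance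

theorem mixWeight_nonneg (γ u : ℝ) : 0 ≤ mixWeight γ u := Real.sqrt_nonneg _

theorem rieszRoot_nonneg (γ : ℝ) (e : ℝ × ℝ) (y : ℝ) : 0 ≤ rieszRoot γ e y :=
  mul_nonneg (mixWeight_nonneg _ _) (Real.exp_nonneg _)

theorem measurable_mixWeight (γ : ℝ) : Measurable (mixWeight γ) := by
  unfold mixWeight; fun_prop

theorem measurable_rieszRoot (γ : ℝ) : Measurable (fun p : (ℝ × ℝ) × ℝ => rieszRoot γ p.1 p.2) := by
  unfold rieszRoot
  have := measurable_mixWeight γ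
  fun_prop

@[fun_prop]
theorem Measurable.rieszRoot {β : Type*} [MeasurableSpace β] (γ : ℝ) {f : β → ℝ × ℝ} {g : β → ℝ}
    (hf : Measurable f) (hg : Measurable g) : Measurable (fun x => rieszRoot γ (f x) (g x)) :=
  (measurable_rieszRoot γ).comp (hf.prodMk hg)

@[fun_prop]
theorem measurable_rieszKernel (γ : ℝ) : Measurable (rieszKernel γ) := by
  unfold rieszKernel; fun_prop

theorem rieszConst_pos {γ : ℝ} (hγ : 0 < γ) :
    0 < (√Real.pi * 2 ^ (4 * γ) * Real.Gamma (2 * γ))⁻¹ := by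
  have := Real.Gamma_pos_of_pos (show (0 : ℝ) < 2 * γ by linarith)
  have := Real.pi_pos
  positivity

theorem rieszKernel_nonneg {γ : ℝ} (hγ : 0 < γ) (hγ' : γ < 1 / 4) (x : ℝ) :
    0 ≤ rieszKernel γ x := by
  have := Real.Gamma_pos_of_pos (show (0 : ℝ) < 2 * γ by linarith)
  have := Real.Gamma_pos_of_pos (show (0 : ℝ) < 1 / 2 - 2 * γ by linarith)
  unfold rieszKernel
  positivity

theorem mixWeight_sq {γ : ℝ} (hγ : 0 < γ) {u : ℝ} (hu : 0 < u) :
    mixWeight γ u * mixWeight γ u * √(Real.pi / (4 * u)) =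
      (√Real.pi * 2 ^ (4 * γ) * Real.Gamma (2 * γ))⁻¹ * u ^ (1 / 2 - 2 * γ - 1) := by
  have h1 := rieszConst_pos hγ
  have h2 : 0 < √(Real.pi / (4 * u)) := by have := Real.pi_pos; positivity
  unfold mixWeight
  rw [Real.mul_self_sqrt (by positivity)]
  field_simp

/-- The mixture formula: the overlap of two Gaussians centered at `y` and `z` is a Gaussian in `y -
z`, and the weights turn the integral over `u` into a Gamma integral. On the diagonal it fails,
because `rieszKernel γ 0 = 0` while the left-hand side is infinite. -/
theorem lintegral_rieszRoot_mul {γ : ℝ} (hγ : 0 < γ) (hγ' : γ < 1 / 4) {y z : ℝ} (hyz : y ≠ z) :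
    ∫⁻ e, ENNReal.ofReal (rieszRoot γ e y) * ENNReal.ofReal (rieszRoot γ e z) ∂mixMeasure
      = ENNReal.ofReal (rieszKernel γ (y - z)) := by
  have hd : 0 < (y - z) ^ 2 := by have := sub_ne_zero.2 hyz; positivity
  have hC := rieszConst_pos hγ
  set C := (√Real.pi * 2 ^ (4 * γ) * Real.Gamma (2 * γ))⁻¹ with hCdef
  rw [mixMeasure, lintegral_prod _ (by fun_prop)]
  have h1 : ∀ u ∈ Set.Ioi (0 : ℝ),
      ∫⁻ w : ℝ, ENNReal.ofReal (rieszRoot γ (u, w) y) * ENNReal.ofReal (rieszRoot γ (u, w) z)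
        = ENNReal.ofReal C *
          ENNReal.ofReal (u ^ (1 / 2 - 2 * γ - 1) * Real.exp (-((y - z) ^ 2 * u))) := by
    intro u hu
    have hu : 0 < u := hu
    have h2 : ∀ w : ℝ,
        ENNReal.ofReal (rieszRoot γ (u, w) y) * ENNReal.ofReal (rieszRoot γ (u, w) z)
        = ENNReal.ofReal (mixWeight γ u * mixWeight γ u) *
          (ENNReal.ofReal (Real.exp (-2 * u * (y - w) ^ 2)) *
            ENNReal.ofReal (Real.exp (-2 * u * (z - w) ^ 2))) := by
      intro w
      have := mixWeight_nonneg γ u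
      unfold rieszRoot
      rw [ENNReal.ofReal_mul this, ENNReal.ofReal_mul this, ENNReal.ofReal_mul this]
      ring
    simp_rw [h2]
    have := mixWeight_nonneg γ u
    rw [lintegral_const_mul _ (by fun_prop), lintegral_gaussian_overlap hu,
      ← ENNReal.ofReal_mul (by positivity), ← mul_assoc, mixWeight_sq hγ hu,
      ← ENNReal.ofReal_mul hC.le]
    congr 1
    rw [mul_comm u]
    ring
  rw [setLIntegral_congr_fun measurableSet_Ioi h1, lintegral_const_mul _ (by fun_prop),
    lintegral_rpow_mul_exp_neg_mul (by linarith) hd, ← ENNReal.ofReal_mul hC.le]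
  congr 1
  unfold rieszKernel
  have h3 : ((y - z) ^ 2) ^ (-(1 / 2 - 2 * γ)) = |y - z| ^ (4 * γ - 1) := by
    rw [← sq_abs, ← Real.rpow_natCast, ← Real.rpow_mul (abs_nonneg _)]
    congr 1
    push_cast
    ring
  rw [h3, hCdef]
  ring

/-! ### The energy of a function of one variable -/

/-- The energy `∫ ∫ |f(y)| K_γ(y - z) |f(z)| dz dy` of a function on the real line. -/
def spatialEnergy (γ : ℝ) (f : ℝ → ℝ) : ℝ≥0∞ :=
  ∫⁻ y : ℝ, ∫⁻ z : ℝ, ENNReal.ofReal (|f y| * rieszKernel γ (y - z) * |f z|)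

/-- The integral of `|f|` against `rieszRoot`. The square of its `L²` norm is the energy of `f`. -/
def absRoot (γ : ℝ) (f : ℝ → ℝ) (e : ℝ × ℝ) : ℝ≥0∞ :=
  ∫⁻ y : ℝ, ‖f y‖ₑ * ENNReal.ofReal (rieszRoot γ e y)

theorem energy_eq_lintegral_spatialEnergy (γ : ℝ) (φ : ℝ → ℝ → ℝ) :
    energy γ φ = ∫⁻ s in Set.Ioi (0 : ℝ), spatialEnergy γ (φ s) := rfl

theorem measurable_absRoot_uncurry (γ : ℝ) {β : Type*} [MeasurableSpace β] {φ : β → ℝ → ℝ}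
    (hφ : Measurable (Function.uncurry φ)) :
    Measurable (fun p : β × (ℝ × ℝ) => absRoot γ (φ p.1) p.2) := by
  unfold absRoot
  refine Measurable.lintegral_prod_right (f := fun q : β × (ℝ × ℝ) => fun y : ℝ =>
    ‖φ q.1 y‖ₑ * ENNReal.ofReal (rieszRoot γ q.2 y)) ?_
  unfold Function.uncurry
  have : Measurable (fun q : (β × (ℝ × ℝ)) × ℝ => φ q.1.1 q.2) :=
    hφ.comp (by fun_prop : Measurable fun q : (β × (ℝ × ℝ)) × ℝ => (q.1.1, q.2))
  fun_prop

theorem measurable_absRoot (γ : ℝ) {f : ℝ → ℝ} (hf : Measurable f) : Measurable (absRoot γ f) := by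
  unfold absRoot
  refine Measurable.lintegral_prod_right (f := fun e : ℝ × ℝ => fun y : ℝ =>
    ‖f y‖ₑ * ENNReal.ofReal (rieszRoot γ e y)) ?_
  unfold Function.uncurry
  fun_prop

theorem lintegral_absRoot_mul {γ : ℝ} (hγ : 0 < γ) (hγ' : γ < 1 / 4) {f g : ℝ → ℝ}
    (hf : Measurable f) (hg : Measurable g) :
    ∫⁻ e, absRoot γ f e * absRoot γ g e ∂mixMeasure
      = ∫⁻ y : ℝ, ∫⁻ z : ℝ, ENNReal.ofReal (|f y| * rieszKernel γ (y - z) * |g z|) := by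
  have hg' := measurable_absRoot γ hg
  calc ∫⁻ e, absRoot γ f e * absRoot γ g e ∂mixMeasure
      = ∫⁻ e, (∫⁻ y : ℝ, ‖f y‖ₑ * ENNReal.ofReal (rieszRoot γ e y) * absRoot γ g e) ∂mixMeasure := by
        refine lintegral_congr fun e => ?_
        rw [lintegral_mul_const _ (by fun_prop)]
        rfl
    _ = ∫⁻ y : ℝ, ∫⁻ e, ‖f y‖ₑ * ENNReal.ofReal (rieszRoot γ e y) * absRoot γ g e ∂mixMeasure :=
        lintegral_lintegral_swap (by unfold Function.uncurry; fun_prop)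
    _ = ∫⁻ y : ℝ, ∫⁻ e, (∫⁻ z : ℝ, ‖f y‖ₑ * ENNReal.ofReal (rieszRoot γ e y) *
          (‖g z‖ₑ * ENNReal.ofReal (rieszRoot γ e z))) ∂mixMeasure := by
        refine lintegral_congr fun y => lintegral_congr fun e => ?_
        rw [lintegral_const_mul _ (by fun_prop)]
        rfl
    _ = ∫⁻ y : ℝ, ∫⁻ z : ℝ, ∫⁻ e, ‖f y‖ₑ * ENNReal.ofReal (rieszRoot γ e y) *
          (‖g z‖ₑ * ENNReal.ofReal (rieszRoot γ e z)) ∂mixMeasure := by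
        refine lintegral_congr fun y => lintegral_lintegral_swap ?_
        unfold Function.uncurry; fun_prop
    _ = ∫⁻ y : ℝ, ∫⁻ z : ℝ, ENNReal.ofReal (|f y| * rieszKernel γ (y - z) * |g z|) := by
        refine lintegral_congr fun y => lintegral_congr_ae ?_
        have : ∀ᵐ z : ℝ, z ≠ y := by simp [ae_iff, measure_singleton]
        filter_upwards [this] with z hz
        have h1 : ∀ e, ‖f y‖ₑ * ENNReal.ofReal (rieszRoot γ e y) *
            (‖g z‖ₑ * ENNReal.ofReal (rieszRoot γ e z)) = (‖f y‖ₑ * ‖g z‖ₑ) *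
            (ENNReal.ofReal (rieszRoot γ e y) * ENNReal.ofReal (rieszRoot γ e z)) := by
          intro e; ring
        simp_rw [h1]
        have := rieszKernel_nonneg hγ hγ' (y - z)
        rw [lintegral_const_mul _ (by fun_prop), lintegral_rieszRoot_mul hγ hγ' hz.symm,
          ENNReal.ofReal_mul (by positivity), ENNReal.ofReal_mul (by positivity),
          ← ofReal_norm, ← ofReal_norm, Real.norm_eq_abs, Real.norm_eq_abs]
        ring

theorem spatialEnergy_eq {γ : ℝ} (hγ : 0 < γ) (hγ' : γ < 1 / 4) {f : ℝ → ℝ} (hf : Measurable f) :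
    spatialEnergy γ f = ∫⁻ e, absRoot γ f e ^ 2 ∂mixMeasure := by
  simp_rw [sq]
  exact (lintegral_absRoot_mul hγ hγ' hf hf).symm

/-- The space `(0, ∞) × {(u, w) | u > 0}` on which integrands are represented. -/
def rootMeasure : Measure (ℝ × (ℝ × ℝ)) :=
  (volume.restrict (Set.Ioi (0 : ℝ))).prod mixMeasure

/-- In the representation by `rieszRoot`, the energy is the square of an `L²` norm. -/
theorem energy_eq {γ : ℝ} (hγ : 0 < γ) (hγ' : γ < 1 / 4) {φ : ℝ → ℝ → ℝ}
    (hφ : Measurable (Function.uncurry φ)) :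
    energy γ φ = ∫⁻ p, absRoot γ (φ p.1) p.2 ^ 2 ∂rootMeasure := by
  have h := measurable_absRoot_uncurry γ hφ
  rw [rootMeasure, lintegral_prod _ (h.pow_const 2).aemeasurable, energy_eq_lintegral_spatialEnergy]
  exact lintegral_congr fun s => spatialEnergy_eq hγ hγ' hφ.of_uncurry_left

theorem spatialEnergy_mono {γ : ℝ} (hγ : 0 < γ) (hγ' : γ < 1 / 4) {f g : ℝ → ℝ}
    (h : ∀ y, |f y| ≤ |g y|) : spatialEnergy γ f ≤ spatialEnergy γ g := by
  refine lintegral_mono fun y => lintegral_mono fun z => ENNReal.ofReal_le_ofReal ?_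
  have := rieszKernel_nonneg hγ hγ' (y - z)
  have := h y
  have := h z
  gcongr

theorem spatialEnergy_const_mul (γ : ℝ) (c : ℝ) (f : ℝ → ℝ) :
    spatialEnergy γ (fun y => c * f y) = ENNReal.ofReal (c ^ 2) * spatialEnergy γ f := by
  unfold spatialEnergy
  rw [← lintegral_const_mul' _ _ ENNReal.ofReal_ne_top]
  refine lintegral_congr fun y => ?_
  rw [← lintegral_const_mul' _ _ ENNReal.ofReal_ne_top]
  refine lintegral_congr fun z => ?_
  rw [← ENNReal.ofReal_mul (by positivity), abs_mul, abs_mul, ← sq_abs]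
  congr 1
  ring

theorem energy_mono {γ : ℝ} (hγ : 0 < γ) (hγ' : γ < 1 / 4) {φ ψ : ℝ → ℝ → ℝ}
    (h : ∀ s, 0 < s → ∀ y, |φ s y| ≤ |ψ s y|) : energy γ φ ≤ energy γ ψ := by
  rw [energy_eq_lintegral_spatialEnergy, energy_eq_lintegral_spatialEnergy]
  exact setLIntegral_mono' measurableSet_Ioi fun s hs => spatialEnergy_mono hγ hγ' (h s hs)

theorem energy_const_mul (γ : ℝ) (c : ℝ) (φ : ℝ → ℝ → ℝ) :
    energy γ (fun s y => c * φ s y) = ENNReal.ofReal (c ^ 2) * energy γ φ := by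
  rw [energy_eq_lintegral_spatialEnergy, energy_eq_lintegral_spatialEnergy,
    ← lintegral_const_mul' _ _ ENNReal.ofReal_ne_top]
  exact lintegral_congr fun s => spatialEnergy_const_mul γ c (φ s)

theorem add_sq_le_two_mul (a b : ℝ≥0∞) : (a + b) ^ 2 ≤ 2 * a ^ 2 + 2 * b ^ 2 := by
  rcases eq_or_ne a ∞ with rfl | ha
  · simp
  rcases eq_or_ne b ∞ with rfl | hb
  · simp
  lift a to ℝ≥0 using ha
  lift b to ℝ≥0 using hb
  norm_cast
  rw [← NNReal.coe_le_coe]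
  push_cast
  nlinarith [sq_nonneg ((a : ℝ) - b)]

theorem absRoot_add_le (γ : ℝ) {f : ℝ → ℝ} (g : ℝ → ℝ) (hf : Measurable f) (e : ℝ × ℝ) :
    absRoot γ (fun y => f y + g y) e ≤ absRoot γ f e + absRoot γ g e := by
  unfold absRoot
  rw [← lintegral_add_left (by fun_prop)]
  refine lintegral_mono fun y => ?_
  rw [← add_mul]
  gcongr
  exact enorm_add_le _ _

theorem energy_add_le {γ : ℝ} (hγ : 0 < γ) (hγ' : γ < 1 / 4) {φ ψ : ℝ → ℝ → ℝ}
    (hφ : Measurable (Function.uncurry φ)) (hψ : Measurable (Function.uncurry ψ)) :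
    energy γ (fun s y => φ s y + ψ s y) ≤ 2 * energy γ φ + 2 * energy γ ψ := by
  have h1 : Measurable (Function.uncurry fun s y => φ s y + ψ s y) := hφ.add hψ
  have h2 := measurable_absRoot_uncurry γ hφ
  have h3 := measurable_absRoot_uncurry γ hψ
  rw [energy_eq hγ hγ' hφ, energy_eq hγ hγ' hψ, energy_eq hγ hγ' h1,
    ← lintegral_const_mul _ (h2.pow_const 2), ← lintegral_const_mul _ (h3.pow_const 2),
    ← lintegral_add_left ((h2.pow_const 2).const_mul 2)]
  refine lintegral_mono fun p => (add_sq_le_two_mul _ _).trans' ?_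
  gcongr
  exact absRoot_add_le γ _ hφ.of_uncurry_left p.2

theorem energy_sub_le {γ : ℝ} (hγ : 0 < γ) (hγ' : γ < 1 / 4) {φ ψ : ℝ → ℝ → ℝ}
    (hφ : Measurable (Function.uncurry φ)) (hψ : Measurable (Function.uncurry ψ)) :
    energy γ (fun s y => φ s y - ψ s y) ≤ 2 * energy γ φ + 2 * energy γ ψ := by
  have h := energy_add_le hγ hγ' (ψ := fun s y => -ψ s y) hφ hψ.neg
  have h2 : energy γ (fun s y => -ψ s y) = energy γ ψ := by simp [energy]
  simpa only [h2, ← sub_eq_add_neg] using h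

/-- Functions of decay `1 / (1 + |y|)` have finite energy. With `p + q = 2` and
`4γ < q < 1`, the product of two such weights is at most
`(1 + |y|)^(-p) (1 + |z|)^(-q) + (1 + |y|)^(-q) (1 + |z|)^(-p)`, and the convolution of the Riesz
kernel with `(1 + |z|)^(-q)` is bounded. -/
theorem spatialEnergy_lt_top {γ : ℝ} (hγ : 0 < γ) (hγ' : γ < 1 / 4) {f : ℝ → ℝ} {C : ℝ}
    (hf : ∀ y, |f y| ≤ C * (1 + |y|)⁻¹) : spatialEnergy γ f < ∞ := by
  -- `q` is the midpoint of `(4γ, 1)`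
  set q : ℝ := 1 / 2 + 2 * γ with hq
  set p : ℝ := 3 / 2 - 2 * γ with hp
  set b : ℝ := 1 - 4 * γ with hb
  have hp1 : 1 < p := by linarith
  set κ : ℝ := Real.Gamma (1 / 2 - 2 * γ) / (√Real.pi * 2 ^ (4 * γ) * Real.Gamma (2 * γ)) with hκ
  have hκ0 : 0 < κ := by
    have := Real.Gamma_pos_of_pos (show (0 : ℝ) < 2 * γ by linarith)
    have := Real.Gamma_pos_of_pos (show (0 : ℝ) < 1 / 2 - 2 * γ by linarith)
    have := Real.pi_pos
    positivity
  have hK : ∀ w, rieszKernel γ w = κ * |w| ^ (-b) := by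
    intro w; unfold rieszKernel; rw [hb, neg_sub]
  let g : ℝ → ℝ := fun w => κ * ((Metric.ball (0 : ℝ) 1).indicator (fun w => |w| ^ (-b)) w
    + 2 ^ p * (1 + |w|) ^ (-p))
  have hgi : Integrable g := by
    refine Integrable.const_mul (Integrable.add ?_ (Integrable.const_mul ?_ _)) _
    · rw [integrable_indicator_iff measurableSet_ball]
      refine integrableOn_ball_of_norm_le_rpow (C := 1) (α := b) (by simp) (by simp; linarith) ?_ ?_
      · refine ae_of_all _ fun x => ?_
        rw [Real.norm_of_nonneg (by positivity), one_mul, Real.norm_eq_abs]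
      · exact Measurable.aestronglyMeasurable (by fun_prop)
    · simpa using integrable_one_add_norm (E := ℝ) (μ := volume) (r := p) (by simpa using hp1)
  have hg0 : ∀ w, 0 ≤ g w := by
    intro w
    have : 0 ≤ (Metric.ball (0 : ℝ) 1).indicator (fun w : ℝ => |w| ^ (-b)) w :=
      Set.indicator_nonneg (fun _ _ => by positivity) _
    positivity
  have hai : Integrable fun z : ℝ => (1 + |z|) ^ (-p) := by
    simpa using integrable_one_add_norm (E := ℝ) (μ := volume) (r := p) (by simpa using hp1)
  have hkey : ∀ w z : ℝ, rieszKernel γ w * (1 + |z|) ^ (-q) ≤ g w + κ * (1 + |z|) ^ (-p) := by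
    intro w z
    rw [hK]
    have hz : (1 : ℝ) ≤ 1 + |z| := by linarith [abs_nonneg z]
    by_cases hw : |w| < 1
    · have h1 : (Metric.ball (0 : ℝ) 1).indicator (fun w : ℝ => |w| ^ (-b)) w = |w| ^ (-b) :=
        Set.indicator_of_mem (by simpa using hw) _
      have h2 : (1 + |z|) ^ (-q) ≤ 1 := Real.rpow_le_one_of_one_le_of_nonpos hz (by linarith)
      simp only [g, h1]
      have h3 : κ * |w| ^ (-b) * (1 + |z|) ^ (-q) ≤ κ * |w| ^ (-b) :=
        mul_le_of_le_one_right (by positivity) h2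
      have : 0 ≤ κ * (2 ^ p * (1 + |w|) ^ (-p)) := by positivity
      have : 0 ≤ κ * (1 + |z|) ^ (-p) := by positivity
      linarith
    · push Not at hw
      have h1 : (Metric.ball (0 : ℝ) 1).indicator (fun w : ℝ => |w| ^ (-b)) w = 0 :=
        Set.indicator_of_notMem (by simpa using hw) _
      simp only [g, h1, zero_add]
      have hw0 : 0 < |w| := by linarith
      have h2 : |w| ^ (-p) ≤ 2 ^ p * (1 + |w|) ^ (-p) := by
        rw [Real.rpow_neg hw0.le, Real.rpow_neg (by positivity), ← div_eq_mul_inv,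
          ← Real.div_rpow (by positivity) (by positivity), ← Real.inv_rpow hw0.le]
        refine Real.rpow_le_rpow (by positivity) ?_ (by linarith)
        rw [inv_eq_one_div, div_le_div_iff₀ hw0 (by positivity)]
        linarith
      have h3 : |w| ^ (-b) * (1 + |z|) ^ (-q) ≤ |w| ^ (-p) + (1 + |z|) ^ (-p) := by
        have e : -p = -b + -q := by rw [hp, hb, hq]; ring
        have hz0 : 0 < 1 + |z| := by linarith
        rcases le_total |w| (1 + |z|) with h | h
        · have : (1 + |z|) ^ (-q) ≤ |w| ^ (-q) :=
            Real.rpow_le_rpow_of_nonpos hw0 h (by linarith)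
          have h5 : |w| ^ (-b) * (1 + |z|) ^ (-q) ≤ |w| ^ (-p) := by
            rw [e, Real.rpow_add hw0]; gcongr
          have : 0 ≤ (1 + |z|) ^ (-p) := by positivity
          linarith
        · have : |w| ^ (-b) ≤ (1 + |z|) ^ (-b) :=
            Real.rpow_le_rpow_of_nonpos hz0 h (by linarith)
          have h5 : |w| ^ (-b) * (1 + |z|) ^ (-q) ≤ (1 + |z|) ^ (-p) := by
            rw [e, Real.rpow_add hz0]; gcongr
          have : 0 ≤ |w| ^ (-p) := by positivity
          linarith
      rw [mul_assoc, ← mul_add]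
      gcongr
      linarith
  set M : ℝ≥0∞ := (∫⁻ w, ENNReal.ofReal (g w)) + ∫⁻ z, ENNReal.ofReal (κ * (1 + |z|) ^ (-p)) with hM
  have hM_top : M ≠ ∞ := by
    refine ENNReal.add_ne_top.2 ⟨?_, ?_⟩
    · exact (hgi.lintegral_lt_top).ne
    · exact (hai.const_mul κ).lintegral_lt_top.ne
  have hgm : Measurable fun w => ENNReal.ofReal (g w) := by
    have : Measurable ((Metric.ball (0 : ℝ) 1).indicator (fun w : ℝ => |w| ^ (-b))) :=
      Measurable.indicator (by fun_prop) measurableSet_ball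
    simp only [g]
    fun_prop
  have hconv : ∀ y : ℝ,
      ∫⁻ z, ENNReal.ofReal (rieszKernel γ (y - z) * (1 + |z|) ^ (-q)) ≤ M := by
    intro y
    calc _ ≤ ∫⁻ z, (ENNReal.ofReal (g (y - z)) + ENNReal.ofReal (κ * (1 + |z|) ^ (-p))) := by
          refine lintegral_mono fun z => ?_
          rw [← ENNReal.ofReal_add (hg0 _) (by positivity)]
          exact ENNReal.ofReal_le_ofReal (hkey _ _)
      _ = M := by
          rw [lintegral_add_right _ (by fun_prop),
            lintegral_sub_left_eq_self (fun w => ENNReal.ofReal (g w)) y]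
  have hprod : ∀ y z : ℝ, (1 + |y|)⁻¹ * (1 + |z|)⁻¹ ≤
      (1 + |y|) ^ (-p) * (1 + |z|) ^ (-q) + (1 + |z|) ^ (-p) * (1 + |y|) ^ (-q) := by
    intro y z
    have hy : 0 < 1 + |y| := by positivity
    have hz : 0 < 1 + |z| := by positivity
    have e : -p + -q = -1 + -1 := by rw [hp, hq]; ring
    refine abs_le_of_sq_le_sq' ?_ (by positivity) |>.2
    have h1 : ((1 + |y|)⁻¹ * (1 + |z|)⁻¹) ^ 2 =
        ((1 + |y|) ^ (-p) * (1 + |z|) ^ (-q)) * ((1 + |z|) ^ (-p) * (1 + |y|) ^ (-q)) := by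
      calc _ = ((1 + |y|) ^ (-1 : ℝ) * (1 + |y|) ^ (-1 : ℝ)) *
            ((1 + |z|) ^ (-1 : ℝ) * (1 + |z|) ^ (-1 : ℝ)) := by
            rw [Real.rpow_neg_one, Real.rpow_neg_one]; ring
        _ = _ := by
            rw [← Real.rpow_add hy, ← Real.rpow_add hz, ← e, Real.rpow_add hy, Real.rpow_add hz]
            ring
    rw [h1]
    have : 0 ≤ (1 + |y|) ^ (-p) * (1 + |z|) ^ (-q) := by positivity
    have : 0 ≤ (1 + |z|) ^ (-p) * (1 + |y|) ^ (-q) := by positivity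
    nlinarith
  have hhalf : ∫⁻ y : ℝ, ∫⁻ z : ℝ,
      ENNReal.ofReal ((1 + |y|) ^ (-p)) * ENNReal.ofReal (rieszKernel γ (y - z) * (1 + |z|) ^ (-q))
      ≤ (∫⁻ y : ℝ, ENNReal.ofReal ((1 + |y|) ^ (-p))) * M := by
    rw [← lintegral_mul_const _ (by fun_prop)]
    refine lintegral_mono fun y => ?_
    rw [lintegral_const_mul' _ _ ENNReal.ofReal_ne_top]
    gcongr
    exact hconv y
  have hmain : spatialEnergy γ (fun y => (1 + |y|)⁻¹) < ∞ := by
    calc spatialEnergy γ (fun y => (1 + |y|)⁻¹)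
        ≤ ∫⁻ y : ℝ, ∫⁻ z : ℝ, (ENNReal.ofReal ((1 + |y|) ^ (-p)) *
            ENNReal.ofReal (rieszKernel γ (y - z) * (1 + |z|) ^ (-q)) +
            ENNReal.ofReal ((1 + |z|) ^ (-p)) *
            ENNReal.ofReal (rieszKernel γ (z - y) * (1 + |y|) ^ (-q))) := by
          refine lintegral_mono fun y => lintegral_mono fun z => ?_
          have h1 := rieszKernel_nonneg hγ hγ' (y - z)
          have h2 : rieszKernel γ (z - y) = rieszKernel γ (y - z) := by
            rw [hK, hK, abs_sub_comm]
          rw [h2, ← ENNReal.ofReal_mul (by positivity), ← ENNReal.ofReal_mul (by positivity),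
            ← ENNReal.ofReal_add (by positivity) (by positivity)]
          refine ENNReal.ofReal_le_ofReal ?_
          rw [abs_of_nonneg (by positivity), abs_of_nonneg (by positivity)]
          have := mul_le_mul_of_nonneg_left (hprod y z) h1
          linarith
      _ = 2 * ∫⁻ y : ℝ, ∫⁻ z : ℝ, ENNReal.ofReal ((1 + |y|) ^ (-p)) *
            ENNReal.ofReal (rieszKernel γ (y - z) * (1 + |z|) ^ (-q)) := by
          have h1 : ∀ y : ℝ, ∫⁻ z : ℝ, (ENNReal.ofReal ((1 + |y|) ^ (-p)) *
              ENNReal.ofReal (rieszKernel γ (y - z) * (1 + |z|) ^ (-q)) +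
              ENNReal.ofReal ((1 + |z|) ^ (-p)) *
              ENNReal.ofReal (rieszKernel γ (z - y) * (1 + |y|) ^ (-q))) =
              (∫⁻ z : ℝ, ENNReal.ofReal ((1 + |y|) ^ (-p)) *
                ENNReal.ofReal (rieszKernel γ (y - z) * (1 + |z|) ^ (-q))) +
              ∫⁻ z : ℝ, ENNReal.ofReal ((1 + |z|) ^ (-p)) *
                ENNReal.ofReal (rieszKernel γ (z - y) * (1 + |y|) ^ (-q)) :=
            fun y => lintegral_add_left (by fun_prop) _
          rw [lintegral_congr h1, lintegral_add_left, two_mul]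
          · congr 1
            exact lintegral_lintegral_swap (by unfold Function.uncurry; fun_prop)
          · refine Measurable.lintegral_prod_right (f := fun y : ℝ => fun z : ℝ =>
              ENNReal.ofReal ((1 + |y|) ^ (-p)) *
              ENNReal.ofReal (rieszKernel γ (y - z) * (1 + |z|) ^ (-q))) ?_
            unfold Function.uncurry; fun_prop
      _ < ∞ := by
          refine ENNReal.mul_lt_top (by simp) (hhalf.trans_lt (ENNReal.mul_lt_top ?_ hM_top.lt_top))
          exact hai.lintegral_lt_top
  calc spatialEnergy γ f ≤ spatialEnergy γ (fun y => C * (1 + |y|)⁻¹) :=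
        spatialEnergy_mono hγ hγ' fun y => (hf y).trans (le_abs_self _)
    _ = ENNReal.ofReal (C ^ 2) * spatialEnergy γ (fun y => (1 + |y|)⁻¹) :=
        spatialEnergy_const_mul _ _ _
    _ < ∞ := ENNReal.mul_lt_top ENNReal.ofReal_lt_top hmain

/-! ### The isometric representation of integrands -/

theorem eLpNorm_two_sq {β E : Type*} [MeasurableSpace β] [NormedAddCommGroup E] (f : β → E)
    (μ : Measure β) : eLpNorm f 2 μ ^ 2 = ∫⁻ x, ‖f x‖ₑ ^ 2 ∂μ := by
  have := eLpNorm_nnreal_pow_eq_lintegral (f := f) (μ := μ) (p := 2) (by norm_num)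
  simpa using this

theorem eLpNorm_two_sq_eq_integral {β : Type*} [MeasurableSpace β] {f : β → ℝ}
    {μ : Measure β} (hf : MemLp f 2 μ) :
    eLpNorm f 2 μ ^ 2 = ENNReal.ofReal (∫ x, f x ^ 2 ∂μ) := by
  rw [eLpNorm_two_sq, ofReal_integral_eq_lintegral_ofReal hf.integrable_sq
    (ae_of_all _ fun _ => sq_nonneg _)]
  refine lintegral_congr fun x => ?_
  rw [Real.enorm_eq_ofReal_abs, ← ENNReal.ofReal_pow (abs_nonneg _), sq_abs]

/-- The norm is continuous along sequences converging in `L²`. -/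
theorem tendsto_eLpNorm_of_tendsto_sub {β : Type*} [MeasurableSpace β] {μ : Measure β}
    {f : ℕ → β → ℝ} {g : β → ℝ} (hf : ∀ n, MemLp (f n) 2 μ) (hg : MemLp g 2 μ)
    (h : Tendsto (fun n => eLpNorm (fun x => f n x - g x) 2 μ) atTop (𝓝 0)) :
    Tendsto (fun n => eLpNorm (f n) 2 μ) atTop (𝓝 (eLpNorm g 2 μ)) := by
  have h1 : ∀ n, eLpNorm (f n) 2 μ ≤ eLpNorm g 2 μ + eLpNorm (fun x => f n x - g x) 2 μ := by
    intro n
    have := eLpNorm_add_le hg.1 ((hf n).1.sub hg.1) (p := 2) (by norm_num)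
    refine le_trans (le_of_eq ?_) this
    congr 1; ext x; simp
  have h2 : ∀ n, eLpNorm g 2 μ - eLpNorm (fun x => f n x - g x) 2 μ ≤ eLpNorm (f n) 2 μ := by
    intro n
    rw [tsub_le_iff_right]
    have := eLpNorm_sub_le (hf n).1 ((hf n).1.sub hg.1) (p := 2) (by norm_num)
    refine le_trans (le_of_eq ?_) this
    congr 1; ext x; simp
  refine tendsto_of_tendsto_of_tendsto_of_le_of_le (g := fun n => eLpNorm g 2 μ -
    eLpNorm (fun x => f n x - g x) 2 μ) (h := fun n => eLpNorm g 2 μ +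
    eLpNorm (fun x => f n x - g x) 2 μ) ?_ ?_ h2 h1
  · have := ENNReal.Tendsto.sub (tendsto_const_nhds (x := eLpNorm g 2 μ)) h (Or.inl hg.2.ne)
    simpa using this
  · simpa using (tendsto_const_nhds (x := eLpNorm g 2 μ)).add h

/-- The integral of an integrand `φ` against the square root `rieszRoot` of the kernel, as a
function of `(s, e)`. The Wiener integral of `φ` has the same `L²` norm as this function. -/
def integrandRoot (γ : ℝ) (φ : ℝ → ℝ → ℝ) (p : ℝ × (ℝ × ℝ)) : ℝ :=
  ∫ y : ℝ, φ p.1 y * rieszRoot γ p.2 y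

theorem stronglyMeasurable_integrandRoot (γ : ℝ) {φ : ℝ → ℝ → ℝ}
    (hφ : Measurable (Function.uncurry φ)) : StronglyMeasurable (integrandRoot γ φ) := by
  refine StronglyMeasurable.integral_prod_right
    (f := fun (p : ℝ × (ℝ × ℝ)) (y : ℝ) => φ p.1 y * rieszRoot γ p.2 y) ?_
  have : Measurable (fun q : (ℝ × (ℝ × ℝ)) × ℝ => φ q.1.1 q.2) :=
    hφ.comp (by fun_prop : Measurable fun q : (ℝ × (ℝ × ℝ)) × ℝ => (q.1.1, q.2))
  refine Measurable.stronglyMeasurable ?_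
  unfold Function.uncurry
  fun_prop

theorem enorm_integrandRoot_le (γ : ℝ) (φ : ℝ → ℝ → ℝ) (p : ℝ × (ℝ × ℝ)) :
    ‖integrandRoot γ φ p‖ₑ ≤ absRoot γ (φ p.1) p.2 := by
  refine (enorm_integral_le_lintegral_enorm _).trans (le_of_eq ?_)
  refine lintegral_congr fun y => ?_
  rw [enorm_mul, Real.enorm_of_nonneg (rieszRoot_nonneg _ _ _)]

section

variable {γ : ℝ} (hγ : 0 < γ) (hγ' : γ < 1 / 4)

include hγ hγ'

theorem eLpNorm_integrandRoot_sq_le {φ : ℝ → ℝ → ℝ} (hφ : Measurable (Function.uncurry φ)) :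
    eLpNorm (integrandRoot γ φ) 2 rootMeasure ^ 2 ≤ energy γ φ := by
  rw [eLpNorm_two_sq, energy_eq hγ hγ' hφ]
  exact lintegral_mono fun p => pow_le_pow_left' (enorm_integrandRoot_le γ φ p) 2

theorem memLp_integrandRoot {φ : ℝ → ℝ → ℝ} (hφ : Measurable (Function.uncurry φ))
    (h : energy γ φ < ∞) : MemLp (integrandRoot γ φ) 2 rootMeasure := by
  refine ⟨(stronglyMeasurable_integrandRoot γ hφ).aestronglyMeasurable, ?_⟩
  have := (eLpNorm_integrandRoot_sq_le hγ hγ' hφ).trans_lt h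
  exact (ENNReal.pow_lt_top_iff.1 this).resolve_right (by norm_num)

theorem ae_absRoot_lt_top {φ : ℝ → ℝ → ℝ} (hφ : Measurable (Function.uncurry φ))
    (h : energy γ φ < ∞) : ∀ᵐ p ∂rootMeasure, absRoot γ (φ p.1) p.2 < ∞ := by
  rw [energy_eq hγ hγ' hφ] at h
  have := ae_lt_top ((measurable_absRoot_uncurry γ hφ).pow_const 2) h.ne
  filter_upwards [this] with p hp
  exact (ENNReal.pow_lt_top_iff.1 hp).resolve_right (by norm_num)

theorem ae_integrable_mul_rieszRoot {φ : ℝ → ℝ → ℝ} (hφ : Measurable (Function.uncurry φ))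
    (h : energy γ φ < ∞) :
    ∀ᵐ p ∂rootMeasure, Integrable fun y => φ p.1 y * rieszRoot γ p.2 y := by
  filter_upwards [ae_absRoot_lt_top hγ hγ' hφ h] with p hp
  have h1 : Measurable (φ p.1) := hφ.of_uncurry_left
  refine ⟨Measurable.aestronglyMeasurable (by fun_prop), ?_⟩
  refine lt_of_le_of_lt (lintegral_mono fun y => ?_) hp
  rw [enorm_mul, Real.enorm_of_nonneg (rieszRoot_nonneg _ _ _)]

theorem integrandRoot_add {φ ψ : ℝ → ℝ → ℝ} (hφ : Measurable (Function.uncurry φ))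
    (hψ : Measurable (Function.uncurry ψ)) (h : energy γ φ < ∞) (h' : energy γ ψ < ∞) :
    integrandRoot γ (fun s y => φ s y + ψ s y) =ᵐ[rootMeasure]
      fun p => integrandRoot γ φ p + integrandRoot γ ψ p := by
  filter_upwards [ae_integrable_mul_rieszRoot hγ hγ' hφ h,
    ae_integrable_mul_rieszRoot hγ hγ' hψ h'] with p h1 h2
  unfold integrandRoot
  rw [← integral_add h1 h2]
  simp_rw [add_mul]

omit hγ hγ' in
theorem integrandRoot_const_mul (c : ℝ) (φ : ℝ → ℝ → ℝ) (p : ℝ × (ℝ × ℝ)) :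
    integrandRoot γ (fun s y => c * φ s y) p = c * integrandRoot γ φ p := by
  unfold integrandRoot
  rw [← integral_const_mul]
  simp_rw [mul_assoc]

theorem integrandRoot_sub {φ ψ : ℝ → ℝ → ℝ} (hφ : Measurable (Function.uncurry φ))
    (hψ : Measurable (Function.uncurry ψ)) (h : energy γ φ < ∞) (h' : energy γ ψ < ∞) :
    integrandRoot γ (fun s y => φ s y - ψ s y) =ᵐ[rootMeasure]
      fun p => integrandRoot γ φ p - integrandRoot γ ψ p := by
  filter_upwards [ae_integrable_mul_rieszRoot hγ hγ' hφ h,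
    ae_integrable_mul_rieszRoot hγ hγ' hψ h'] with p h1 h2
  unfold integrandRoot
  rw [← integral_sub h1 h2]
  simp_rw [sub_mul]

theorem energy_add_lt_top {φ ψ : ℝ → ℝ → ℝ}
    (hφ : Measurable (Function.uncurry φ)) (hψ : Measurable (Function.uncurry ψ))
    (h : energy γ φ < ∞) (h' : energy γ ψ < ∞) :
    energy γ (fun s y => φ s y + ψ s y) < ∞ :=
  (energy_add_le hγ hγ' hφ hψ).trans_lt
    (ENNReal.add_lt_top.2 ⟨ENNReal.mul_lt_top (by simp) h, ENNReal.mul_lt_top (by simp) h'⟩)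

theorem energy_sub_lt_top {φ ψ : ℝ → ℝ → ℝ}
    (hφ : Measurable (Function.uncurry φ)) (hψ : Measurable (Function.uncurry ψ))
    (h : energy γ φ < ∞) (h' : energy γ ψ < ∞) :
    energy γ (fun s y => φ s y - ψ s y) < ∞ :=
  (energy_sub_le hγ hγ' hφ hψ).trans_lt
    (ENNReal.add_lt_top.2 ⟨ENNReal.mul_lt_top (by simp) h, ENNReal.mul_lt_top (by simp) h'⟩)

omit hγ hγ' in
theorem energy_const_mul_lt_top (c : ℝ) {φ : ℝ → ℝ → ℝ} (h : energy γ φ < ∞) :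
    energy γ (fun s y => c * φ s y) < ∞ := by
  rw [energy_const_mul]
  exact ENNReal.mul_lt_top ENNReal.ofReal_lt_top h

/-- Convergence in energy entails convergence of the representing functions. -/
theorem tendsto_eLpNorm_integrandRoot {φ : ℕ → ℝ → ℝ → ℝ} {ψ : ℝ → ℝ → ℝ}
    (hφ : ∀ n, Measurable (Function.uncurry (φ n))) (hψ : Measurable (Function.uncurry ψ))
    (hφ' : ∀ n, energy γ (φ n) < ∞) (hψ' : energy γ ψ < ∞)
    (h : Tendsto (fun n => energy γ fun s y => φ n s y - ψ s y) atTop (𝓝 0)) :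
    Tendsto (fun n => eLpNorm (integrandRoot γ (φ n)) 2 rootMeasure) atTop
      (𝓝 (eLpNorm (integrandRoot γ ψ) 2 rootMeasure)) := by
  refine tendsto_eLpNorm_of_tendsto_sub (fun n => memLp_integrandRoot hγ hγ' (hφ n) (hφ' n))
    (memLp_integrandRoot hγ hγ' hψ hψ') ?_
  have h1 : Tendsto (fun n => (eLpNorm (fun p => integrandRoot γ (φ n) p - integrandRoot γ ψ p) 2
      rootMeasure) ^ 2) atTop (𝓝 0) := by
    refine tendsto_of_tendsto_of_tendsto_of_le_of_le tendsto_const_nhds h (fun _ => bot_le)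
      fun n => ?_
    rw [← eLpNorm_congr_ae (integrandRoot_sub hγ hγ' (hφ n) hψ (hφ' n) hψ')]
    exact eLpNorm_integrandRoot_sq_le hγ hγ' ((hφ n).sub hψ)
  have h2 := (ENNReal.continuous_rpow_const (y := 1 / 2)).tendsto _ |>.comp h1
  have h3 : ∀ x : ℝ≥0∞, (x ^ 2) ^ (1 / 2 : ℝ) = x := fun x => by
    rw [← ENNReal.rpow_natCast, ← ENNReal.rpow_mul]; norm_num
  simpa only [Function.comp_def, h3, ENNReal.zero_rpow_of_pos (show (0 : ℝ) < 1 / 2 by norm_num)]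
    using h2

end

/-! ### Elementary integrands -/

/-- The integrand `1_{(0, t]}(s) 1_A(z)`. -/
def unitIntegrand (i : ℝ≥0 × BddBorel) (s z : ℝ) : ℝ :=
  (Set.Ioc (0 : ℝ) (i.1 : ℝ)).indicator (fun _ => 1) s * (i.2 : Set ℝ).indicator (fun _ => 1) z

theorem measurable_unitIntegrand (i : ℝ≥0 × BddBorel) :
    Measurable (Function.uncurry (unitIntegrand i)) := by
  unfold Function.uncurry unitIntegrand
  refine Measurable.mul ?_ ?_
  · exact (measurable_const.indicator measurableSet_Ioc).comp measurable_fst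
  · exact (measurable_const.indicator i.2.2.1).comp measurable_snd

theorem elemIntegrand_eq_sum (c : ℝ≥0 × BddBorel →₀ ℝ) (s z : ℝ) :
    elemIntegrand c s z = ∑ i ∈ c.support, c i * unitIntegrand i s z := by
  simp only [elemIntegrand, Finsupp.sum, unitIntegrand, mul_assoc]

theorem elemIntegrand_add (c d : ℝ≥0 × BddBorel →₀ ℝ) (s z : ℝ) :
    elemIntegrand (c + d) s z = elemIntegrand c s z + elemIntegrand d s z := by
  unfold elemIntegrand
  rw [Finsupp.sum_add_index']
  · intro i; simp
  · intro i a b; ring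

theorem elemIntegrand_smul (a : ℝ) (c : ℝ≥0 × BddBorel →₀ ℝ) (s z : ℝ) :
    elemIntegrand (a • c) s z = a * elemIntegrand c s z := by
  unfold elemIntegrand
  rw [Finsupp.sum_smul_index' (by intro i; simp), Finsupp.mul_sum]
  simp only [smul_eq_mul, mul_assoc]

theorem elemIntegrand_zero (s z : ℝ) : elemIntegrand 0 s z = 0 := by
  simp [elemIntegrand]

theorem elemIntegrand_sub (c d : ℝ≥0 × BddBorel →₀ ℝ) (s z : ℝ) :
    elemIntegrand (c - d) s z = elemIntegrand c s z - elemIntegrand d s z := by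
  have h : c - d = c + (-1 : ℝ) • d := by simp [sub_eq_add_neg]
  rw [h, elemIntegrand_add, elemIntegrand_smul]
  ring

theorem elemIntegrand_sum {ι : Type*} (I : Finset ι) (c : ι → ℝ≥0 × BddBorel →₀ ℝ) (s z : ℝ) :
    elemIntegrand (∑ i ∈ I, c i) s z = ∑ i ∈ I, elemIntegrand (c i) s z := by
  classical
  induction I using Finset.induction_on with
  | empty => simp [elemIntegrand_zero]
  | insert i I hi ih => rw [Finset.sum_insert hi, elemIntegrand_add, ih, Finset.sum_insert hi]

theorem elemIntegrand_single (i : ℝ≥0 × BddBorel) (a s z : ℝ) :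
    elemIntegrand (Finsupp.single i a) s z = a * unitIntegrand i s z := by
  unfold elemIntegrand
  rw [Finsupp.sum_single_index (by simp), unitIntegrand, mul_assoc]

theorem measurable_elemIntegrand (c : ℝ≥0 × BddBorel →₀ ℝ) :
    Measurable (Function.uncurry (elemIntegrand c)) := by
  have : Function.uncurry (elemIntegrand c)
      = fun p => ∑ i ∈ c.support, c i * Function.uncurry (unitIntegrand i) p := by
    ext p; exact elemIntegrand_eq_sum c p.1 p.2
  rw [this]
  exact Finset.measurable_sum _ fun i _ => (measurable_unitIntegrand i).const_mul _

/-- A function bounded by `C / (1 + |z|)` and vanishing outside a bounded set of times has finite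
energy. -/
theorem energy_lt_top_of_le {γ : ℝ} (hγ : 0 < γ) (hγ' : γ < 1 / 4) {φ : ℝ → ℝ → ℝ} {C T : ℝ}
    (h : ∀ s z, |φ s z| ≤ (Set.Iic T).indicator (fun _ => C * (1 + |z|)⁻¹) s) :
    energy γ φ < ∞ := by
  rw [energy_eq_lintegral_spatialEnergy]
  set M := spatialEnergy γ (fun z => C * (1 + |z|)⁻¹)
  have hM : M < ∞ := spatialEnergy_lt_top hγ hγ' (C := |C|) fun y => by
    rw [abs_mul, abs_of_nonneg (by positivity : (0 : ℝ) ≤ (1 + |y|)⁻¹)]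
  calc ∫⁻ s in Set.Ioi (0 : ℝ), spatialEnergy γ (φ s)
      ≤ ∫⁻ s in Set.Ioi (0 : ℝ), (Set.Iic T).indicator (fun _ => M) s := by
        refine lintegral_mono fun s => ?_
        by_cases hs : s ∈ Set.Iic T
        · rw [Set.indicator_of_mem hs]
          refine spatialEnergy_mono hγ hγ' fun y => ?_
          have := h s y
          rw [Set.indicator_of_mem hs] at this
          exact this.trans (le_abs_self _)
        · rw [Set.indicator_of_notMem hs]
          have h0 : φ s = fun _ => 0 := by
            ext y
            have := h s y
            rw [Set.indicator_of_notMem hs] at this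
            exact abs_nonpos_iff.1 this
          simp [h0, spatialEnergy]
    _ = M * volume (Set.Ioc 0 T) := by
        rw [lintegral_indicator measurableSet_Iic, lintegral_const,
          Measure.restrict_restrict measurableSet_Iic, Measure.restrict_apply_univ,
          Set.Iic_inter_Ioi]
    _ < ∞ := ENNReal.mul_lt_top hM (by simp)

theorem energy_unitIntegrand_lt_top {γ : ℝ} (hγ : 0 < γ) (hγ' : γ < 1 / 4)
    (i : ℝ≥0 × BddBorel) : energy γ (unitIntegrand i) < ∞ := by
  obtain ⟨R, hR⟩ := i.2.2.2.subset_closedBall 0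
  refine energy_lt_top_of_le hγ hγ' (C := 1 + |R|) (T := i.1) fun s z => ?_
  unfold unitIntegrand
  by_cases hs : s ∈ Set.Ioc (0 : ℝ) i.1
  · rw [Set.indicator_of_mem hs, one_mul, Set.indicator_of_mem (show s ∈ Set.Iic (i.1 : ℝ) from hs.2)]
    by_cases hz : z ∈ (i.2 : Set ℝ)
    · have : |z| ≤ R := by simpa using hR hz
      rw [Set.indicator_of_mem hz, abs_one, ← div_eq_mul_inv, le_div_iff₀ (by positivity)]
      linarith [le_abs_self R]
    · rw [Set.indicator_of_notMem hz, abs_zero]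
      positivity
  · rw [Set.indicator_of_notMem hs, zero_mul, abs_zero]
    exact Set.indicator_nonneg (fun _ _ => by positivity) _

section

variable {γ : ℝ} (hγ : 0 < γ) (hγ' : γ < 1 / 4)

include hγ hγ'

theorem sum_energy_lt_top {ι : Type*} (I : Finset ι) (a : ι → ℝ) (φ : ι → ℝ → ℝ → ℝ)
    (hφ : ∀ i, Measurable (Function.uncurry (φ i))) (h : ∀ i, energy γ (φ i) < ∞) :
    Measurable (Function.uncurry fun s z => ∑ i ∈ I, a i * φ i s z) ∧
    energy γ (fun s z => ∑ i ∈ I, a i * φ i s z) < ∞ ∧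
    integrandRoot γ (fun s z => ∑ i ∈ I, a i * φ i s z) =ᵐ[rootMeasure]
      fun p => ∑ i ∈ I, a i * integrandRoot γ (φ i) p := by
  classical
  induction I using Finset.induction_on with
  | empty =>
    refine ⟨measurable_const, ?_, ?_⟩
    · simp [energy]
    · exact ae_of_all _ fun p => by simp [integrandRoot]
  | insert i I hi ih =>
    obtain ⟨h1, h2, h3⟩ := ih
    simp_rw [Finset.sum_insert hi]
    have m1 : Measurable (Function.uncurry fun s z => a i * φ i s z) := (hφ i).const_mul _
    have e1 := energy_const_mul_lt_top (a i) (h i)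
    refine ⟨m1.add h1, energy_add_lt_top hγ hγ' m1 h1 e1 h2, ?_⟩
    filter_upwards [integrandRoot_add hγ hγ' m1 h1 e1 h2, h3] with p h4 h5
    rw [h4, h5, integrandRoot_const_mul]

theorem energy_elemIntegrand_lt_top (c : ℝ≥0 × BddBorel →₀ ℝ) :
    energy γ (elemIntegrand c) < ∞ := by
  have := (sum_energy_lt_top hγ hγ' c.support c unitIntegrand measurable_unitIntegrand
    (energy_unitIntegrand_lt_top hγ hγ')).2.1
  simpa only [← elemIntegrand_eq_sum] using this

omit hγ hγ' in
theorem integrandRoot_eq_toReal {φ : ℝ → ℝ → ℝ} (hφ : Measurable (Function.uncurry φ))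
    (h0 : ∀ s z, 0 ≤ φ s z) (p : ℝ × (ℝ × ℝ)) :
    integrandRoot γ φ p = (absRoot γ (φ p.1) p.2).toReal := by
  have h1 : Measurable (φ p.1) := hφ.of_uncurry_left
  unfold integrandRoot absRoot
  rw [integral_eq_lintegral_of_nonneg_ae (ae_of_all _ fun y => mul_nonneg (h0 _ _)
    (rieszRoot_nonneg _ _ _)) (Measurable.aestronglyMeasurable (by fun_prop))]
  congr 1
  refine lintegral_congr fun y => ?_
  rw [ENNReal.ofReal_mul (h0 _ _), Real.enorm_of_nonneg (h0 _ _)]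

/-- The inner product of two nonnegative integrands. -/
theorem integral_integrandRoot_mul {φ ψ : ℝ → ℝ → ℝ} (hφ : Measurable (Function.uncurry φ))
    (hψ : Measurable (Function.uncurry ψ)) (h0 : ∀ s z, 0 ≤ φ s z) (h0' : ∀ s z, 0 ≤ ψ s z)
    (h : energy γ φ < ∞) (h' : energy γ ψ < ∞) :
    ∫ p, integrandRoot γ φ p * integrandRoot γ ψ p ∂rootMeasure =
      (∫⁻ s in Set.Ioi (0 : ℝ), ∫⁻ y : ℝ, ∫⁻ z : ℝ,
        ENNReal.ofReal (|φ s y| * rieszKernel γ (y - z) * |ψ s z|)).toReal := by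
  have m1 := measurable_absRoot_uncurry γ hφ
  have m2 := measurable_absRoot_uncurry γ hψ
  have h1 : ∀ s, ∫⁻ y : ℝ, ∫⁻ z : ℝ, ENNReal.ofReal (|φ s y| * rieszKernel γ (y - z) * |ψ s z|)
      = ∫⁻ e, absRoot γ (φ s) e * absRoot γ (ψ s) e ∂mixMeasure := fun s =>
    (lintegral_absRoot_mul hγ hγ' hφ.of_uncurry_left hψ.of_uncurry_left).symm
  simp_rw [h1]
  rw [integral_eq_lintegral_of_nonneg_ae]
  · congr 1
    have h2 := lintegral_prod (μ := volume.restrict (Set.Ioi (0 : ℝ))) (ν := mixMeasure)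
      (fun p : ℝ × (ℝ × ℝ) => absRoot γ (φ p.1) p.2 * absRoot γ (ψ p.1) p.2)
      (m1.mul m2).aemeasurable
    rw [← h2]
    refine lintegral_congr_ae ?_
    filter_upwards [ae_absRoot_lt_top hγ hγ' hφ h, ae_absRoot_lt_top hγ hγ' hψ h'] with p h3 h4
    rw [integrandRoot_eq_toReal hφ h0, integrandRoot_eq_toReal hψ h0', ← ENNReal.toReal_mul,
      ENNReal.ofReal_toReal (ENNReal.mul_lt_top h3 h4).ne]
  · refine ae_of_all _ fun p => ?_
    simp only [Pi.zero_apply]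
    rw [integrandRoot_eq_toReal hφ h0, integrandRoot_eq_toReal hψ h0']
    positivity
  · exact ((stronglyMeasurable_integrandRoot γ hφ).mul
      (stronglyMeasurable_integrandRoot γ hψ)).aestronglyMeasurable

/-- The covariance of the noise is the inner product of the represented indicator functions. -/
theorem integral_integrandRoot_unit (i j : ℝ≥0 × BddBorel) :
    ∫ p, integrandRoot γ (unitIntegrand i) p * integrandRoot γ (unitIntegrand j) p ∂rootMeasure =
      ((min i.1 j.1 : ℝ≥0) : ℝ) *
        ∫ x in (i.2 : Set ℝ), ∫ y in (j.2 : Set ℝ), rieszKernel γ (x - y) := by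
  have hnn : ∀ i s z, 0 ≤ unitIntegrand i s z := fun i s z =>
    mul_nonneg (Set.indicator_nonneg (fun _ _ => zero_le_one) _)
      (Set.indicator_nonneg (fun _ _ => zero_le_one) _)
  rw [integral_integrandRoot_mul hγ hγ' (measurable_unitIntegrand i) (measurable_unitIntegrand j)
    (hnn i) (hnn j) (energy_unitIntegrand_lt_top hγ hγ' i) (energy_unitIntegrand_lt_top hγ hγ' j)]
  set L : ℝ≥0∞ := ∫⁻ x in (i.2 : Set ℝ), ∫⁻ y in (j.2 : Set ℝ),
    ENNReal.ofReal (rieszKernel γ (x - y)) with hL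
  have hstep : ∀ s : ℝ, ∫⁻ y : ℝ, ∫⁻ z : ℝ,
        ENNReal.ofReal (|unitIntegrand i s y| * rieszKernel γ (y - z) * |unitIntegrand j s z|) =
      (Set.Ioc (0 : ℝ) (min i.1 j.1 : ℝ≥0)).indicator (fun _ => L) s := by
    intro s
    by_cases hs : s ∈ Set.Ioc (0 : ℝ) (min i.1 j.1 : ℝ≥0)
    · have hs' : 0 < s ∧ s ≤ i.1 ∧ s ≤ j.1 := by
        obtain ⟨h1, h2⟩ := hs
        rw [NNReal.coe_min] at h2
        exact ⟨h1, h2.trans (min_le_left _ _), h2.trans (min_le_right _ _)⟩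
      rw [Set.indicator_of_mem hs, hL, ← lintegral_indicator i.2.2.1]
      refine lintegral_congr fun y => ?_
      simp only [unitIntegrand, Set.indicator_of_mem (show s ∈ Set.Ioc (0 : ℝ) i.1 from
        ⟨hs'.1, hs'.2.1⟩), Set.indicator_of_mem (show s ∈ Set.Ioc (0 : ℝ) j.1 from
        ⟨hs'.1, hs'.2.2⟩), one_mul]
      by_cases hy : y ∈ (i.2 : Set ℝ)
      · rw [Set.indicator_of_mem hy, Set.indicator_of_mem hy, ← lintegral_indicator j.2.2.1]
        refine lintegral_congr fun z => ?_
        by_cases hz : z ∈ (j.2 : Set ℝ)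
        · simp [hz]
        · simp [hz]
      · simp [hy]
    · rw [Set.indicator_of_notMem hs]
      have : ∀ y z, |unitIntegrand i s y| * rieszKernel γ (y - z) * |unitIntegrand j s z| = 0 := by
        intro y z
        by_cases h1 : s ∈ Set.Ioc (0 : ℝ) i.1
        · have h2 : s ∉ Set.Ioc (0 : ℝ) j.1 := fun h2 => hs
            ⟨h1.1, by rw [NNReal.coe_min]; exact le_min h1.2 h2.2⟩
          simp [unitIntegrand, Set.indicator_of_notMem h2]
        · simp [unitIntegrand, Set.indicator_of_notMem h1]
      simp [this]
  have hmin : ∫⁻ s in Set.Ioi (0 : ℝ), ∫⁻ y : ℝ, ∫⁻ z : ℝ,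
        ENNReal.ofReal (|unitIntegrand i s y| * rieszKernel γ (y - z) * |unitIntegrand j s z|) =
      L * ENNReal.ofReal ((min i.1 j.1 : ℝ≥0) : ℝ) := by
    simp_rw [hstep]
    rw [lintegral_indicator measurableSet_Ioc, lintegral_const,
          Measure.restrict_restrict measurableSet_Ioc, Measure.restrict_apply_univ,
          Set.inter_eq_left.2 Set.Ioc_subset_Ioi_self, Real.volume_Ioc, sub_zero]
  rw [hmin, ENNReal.toReal_mul, ENNReal.toReal_ofReal (by positivity), mul_comm]
  congr 1
  -- The double integral over a product of bounded sets is finite, by the case `t = 1`.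
  have hfin : L < ∞ := by
    have e1 : ∫⁻ y : ℝ, ∫⁻ z : ℝ, ENNReal.ofReal
        (|(i.2 : Set ℝ).indicator (fun _ => (1 : ℝ)) y| * rieszKernel γ (y - z) *
          |(j.2 : Set ℝ).indicator (fun _ => (1 : ℝ)) z|) = L := by
      rw [hL, ← lintegral_indicator i.2.2.1]
      refine lintegral_congr fun y => ?_
      by_cases hy : y ∈ (i.2 : Set ℝ)
      · rw [Set.indicator_of_mem hy, Set.indicator_of_mem hy, ← lintegral_indicator j.2.2.1]
        refine lintegral_congr fun z => ?_
        by_cases hz : z ∈ (j.2 : Set ℝ)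
        · simp [hz]
        · simp [hz]
      · simp [hy]
    rw [← e1]
    refine lt_of_le_of_lt ?_ (spatialEnergy_lt_top hγ hγ' (f := fun y =>
      ((i.2 : Set ℝ) ∪ j.2).indicator (fun _ => (1 : ℝ)) y) (C := 1 +
        |Classical.choose ((i.2.2.2.union j.2.2.2).subset_closedBall 0)|) ?_)
    · refine lintegral_mono fun y => lintegral_mono fun z => ENNReal.ofReal_le_ofReal ?_
      have := rieszKernel_nonneg hγ hγ' (y - z)
      have h1 : ∀ (A B : Set ℝ) (y : ℝ), A ⊆ B → |A.indicator (fun _ => (1 : ℝ)) y| ≤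
          |B.indicator (fun _ => (1 : ℝ)) y| := by
        intro A B y hAB
        by_cases hy : y ∈ A
        · rw [Set.indicator_of_mem hy, Set.indicator_of_mem (hAB hy)]
        · rw [Set.indicator_of_notMem hy, abs_zero]; positivity
      have h2 := h1 _ _ y (Set.subset_union_left (s := (i.2 : Set ℝ)) (t := j.2))
      have h3 := h1 _ _ z (Set.subset_union_right (s := (i.2 : Set ℝ)) (t := j.2))
      gcongr
    · have hR := Classical.choose_spec ((i.2.2.2.union j.2.2.2).subset_closedBall 0)
      generalize Classical.choose ((i.2.2.2.union j.2.2.2).subset_closedBall 0) = R at hR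
      intro y
      by_cases hy : y ∈ (i.2 : Set ℝ) ∪ j.2
      · have : |y| ≤ R := by simpa using hR hy
        rw [Set.indicator_of_mem hy, abs_one, ← div_eq_mul_inv, le_div_iff₀ (by positivity)]
        linarith [le_abs_self R]
      · rw [Set.indicator_of_notMem hy, abs_zero]; positivity
  have h1 : ∀ x : ℝ, ∫ y in (j.2 : Set ℝ), rieszKernel γ (x - y) =
      (∫⁻ y in (j.2 : Set ℝ), ENNReal.ofReal (rieszKernel γ (x - y))).toReal := fun x =>
    integral_eq_lintegral_of_nonneg_ae (ae_of_all _ fun y => rieszKernel_nonneg hγ hγ' _)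
      (Measurable.aestronglyMeasurable (by fun_prop))
  have hm : Measurable fun x : ℝ =>
      ∫⁻ y in (j.2 : Set ℝ), ENNReal.ofReal (rieszKernel γ (x - y)) :=
    Measurable.lintegral_prod_right (f := fun x y : ℝ => ENNReal.ofReal (rieszKernel γ (x - y)))
      (by unfold Function.uncurry; fun_prop)
  simp_rw [h1]
  rw [integral_toReal hm.aemeasurable (ae_lt_top hm hfin.ne)]

end

theorem memLp_of_isRieszNoise {Ω : Type*} [MeasurableSpace Ω] {P : Measure Ω} {γ : ℝ}
    {W : ℝ≥0 × BddBorel → Ω → ℝ} (hW : IsRieszNoise P γ W) (i : ℝ≥0 × BddBorel) :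
    MemLp (W i) 2 P := (hW.gaussian.hasGaussianLaw_eval i).memLp_two

/-! ### Wiener integrals -/

theorem measurable_uncurry_add {φ ψ : ℝ → ℝ → ℝ} (hφ : Measurable (Function.uncurry φ))
    (hψ : Measurable (Function.uncurry ψ)) :
    Measurable (Function.uncurry fun s z => φ s z + ψ s z) := hφ.add hψ

theorem measurable_uncurry_sub {φ ψ : ℝ → ℝ → ℝ} (hφ : Measurable (Function.uncurry φ))
    (hψ : Measurable (Function.uncurry ψ)) :
    Measurable (Function.uncurry fun s z => φ s z - ψ s z) := hφ.sub hψ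

theorem measurable_uncurry_const_mul (a : ℝ) {φ : ℝ → ℝ → ℝ}
    (hφ : Measurable (Function.uncurry φ)) :
    Measurable (Function.uncurry fun s z => a * φ s z) := hφ.const_mul a

section ElementaryAlgebra

variable {Ω : Type*}


theorem elemIntegral_add (W : ℝ≥0 × BddBorel → Ω → ℝ) (c d : ℝ≥0 × BddBorel →₀ ℝ) (ω : Ω) :
    elemIntegral W (c + d) ω = elemIntegral W c ω + elemIntegral W d ω := by
  unfold elemIntegral
  rw [Finsupp.sum_add_index']
  · intro i; simp
  · intro i a b; ring

theorem elemIntegral_smul (W : ℝ≥0 × BddBorel → Ω → ℝ) (a : ℝ) (c : ℝ≥0 × BddBorel →₀ ℝ) (ω : Ω) :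
    elemIntegral W (a • c) ω = a * elemIntegral W c ω := by
  unfold elemIntegral
  rw [Finsupp.sum_smul_index' (by intro i; simp), Finsupp.mul_sum]
  simp only [smul_eq_mul, mul_assoc]

theorem elemIntegral_sub (W : ℝ≥0 × BddBorel → Ω → ℝ) (c d : ℝ≥0 × BddBorel →₀ ℝ) (ω : Ω) :
    elemIntegral W (c - d) ω = elemIntegral W c ω - elemIntegral W d ω := by
  have h : c - d = c + (-1 : ℝ) • d := by simp [sub_eq_add_neg]
  rw [h, elemIntegral_add, elemIntegral_smul]
  ring

end ElementaryAlgebra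

section

variable {Ω : Type*} [MeasurableSpace Ω] {P : Measure Ω}
  {γ : ℝ} {W : ℝ≥0 × BddBorel → Ω → ℝ}

theorem memLp_elemIntegral (hW : IsRieszNoise P γ W) (c : ℝ≥0 × BddBorel →₀ ℝ) :
    MemLp (elemIntegral W c) 2 P :=
  memLp_finsetSum c.support fun i _ => (memLp_of_isRieszNoise hW i).const_mul (c i)

theorem integral_sum_mul_sum {β ι : Type*} [MeasurableSpace β] {μ : Measure β} {f : ι → β → ℝ}
    (hf : ∀ i, MemLp (f i) 2 μ) (I : Finset ι) (a : ι → ℝ) :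
    ∫ x, (∑ i ∈ I, a i * f i x) ^ 2 ∂μ =
      ∑ i ∈ I, ∑ j ∈ I, a i * a j * ∫ x, f i x * f j x ∂μ := by
  have h1 : ∀ x, (∑ i ∈ I, a i * f i x) ^ 2 = ∑ i ∈ I, ∑ j ∈ I, a i * a j * (f i x * f j x) := by
    intro x
    rw [sq, Finset.sum_mul_sum]
    exact Finset.sum_congr rfl fun i _ => Finset.sum_congr rfl fun j _ => by ring
  have h2 : ∀ i j, Integrable (fun x => a i * a j * (f i x * f j x)) μ := fun i j =>
    ((hf i).integrable_mul (hf j)).const_mul _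
  simp_rw [h1]
  rw [integral_finsetSum _ fun i _ => integrable_finsetSum _ fun j _ => h2 i j]
  refine Finset.sum_congr rfl fun i _ => ?_
  rw [integral_finsetSum _ fun j _ => h2 i j]
  exact Finset.sum_congr rfl fun j _ => integral_const_mul _ _

/-- The isometry of the integral on elementary integrands: both sides are the quadratic form of the
covariance of the noise. -/
theorem eLpNorm_elemIntegral (hγ : 0 < γ) (hγ' : γ < 1 / 4) (hW : IsRieszNoise P γ W)
    (c : ℝ≥0 × BddBorel →₀ ℝ) :
    eLpNorm (elemIntegral W c) 2 P = eLpNorm (integrandRoot γ (elemIntegrand c)) 2 rootMeasure := by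
  have h1 := sum_energy_lt_top hγ hγ' c.support c unitIntegrand measurable_unitIntegrand
    (energy_unitIntegrand_lt_top hγ hγ')
  have h2 : elemIntegrand c = fun s z => ∑ i ∈ c.support, c i * unitIntegrand i s z := by
    ext s z; exact elemIntegrand_eq_sum c s z
  have hU : ∀ i, MemLp (integrandRoot γ (unitIntegrand i)) 2 rootMeasure := fun i =>
    memLp_integrandRoot hγ hγ' (measurable_unitIntegrand i) (energy_unitIntegrand_lt_top hγ hγ' i)
  have h3 : eLpNorm (elemIntegral W c) 2 P ^ 2 =
      eLpNorm (integrandRoot γ (elemIntegrand c)) 2 rootMeasure ^ 2 := by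
    rw [h2, eLpNorm_congr_ae h1.2.2, eLpNorm_two_sq_eq_integral (memLp_elemIntegral hW c),
      eLpNorm_two_sq_eq_integral (memLp_finsetSum c.support fun i _ => (hU i).const_mul (c i)),
      integral_sum_mul_sum hU]
    congr 1
    have h4 : ∀ ω, elemIntegral W c ω = ∑ i ∈ c.support, c i * W i ω := fun ω => rfl
    simp_rw [h4]
    rw [integral_sum_mul_sum (memLp_of_isRieszNoise hW)]
    refine Finset.sum_congr rfl fun i _ => Finset.sum_congr rfl fun j _ => ?_
    rw [integral_integrandRoot_unit hγ hγ', ← hW.covariance]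
  exact (ENNReal.pow_right_strictMono (by norm_num : (2 : ℕ) ≠ 0)).injective h3

/-- Linear combinations of the jointly Gaussian variables `W i` are Gaussian. -/
theorem map_elemIntegral (hW : IsRieszNoise P γ W) (c : ℝ≥0 × BddBorel →₀ ℝ) :
    P.map (elemIntegral W c) = gaussianReal 0 (eLpNorm (elemIntegral W c) 2 P ^ 2).toNNReal := by
  have hg : HasGaussianLaw (elemIntegral W c) P :=
    (hW.gaussian.smul c).hasGaussianLaw_fun_sum (I := c.support)
  have h0 : ∫ ω, elemIntegral W c ω ∂P = 0 := by
    have : ∀ ω, elemIntegral W c ω = ∑ i ∈ c.support, c i * W i ω := fun ω => rfl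
    simp_rw [this]
    have := hW.gaussian.isProbabilityMeasure
    rw [integral_finsetSum _ fun i _ =>
      ((memLp_of_isRieszNoise hW i).integrable (by norm_num)).const_mul _]
    simp [integral_const_mul, hW.centered]
  rw [hg.map_eq_gaussianReal, h0, variance_of_integral_eq_zero hg.aemeasurable h0,
    eLpNorm_two_sq_eq_integral (memLp_elemIntegral hW c)]
  rfl

/-- Gaussian laws are stable under convergence in `L²`. -/
theorem map_eq_gaussianReal_of_tendsto [IsProbabilityMeasure P] {f : ℕ → Ω → ℝ} {g : Ω → ℝ}
    (hf : ∀ n, MemLp (f n) 2 P) (hg : MemLp g 2 P)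
    (hlaw : ∀ n, P.map (f n) = gaussianReal 0 (eLpNorm (f n) 2 P ^ 2).toNNReal)
    (h : Tendsto (fun n => eLpNorm (fun x => f n x - g x) 2 P) atTop (𝓝 0)) :
    P.map g = gaussianReal 0 (eLpNorm g 2 P ^ 2).toNNReal := by
  have hlim := tendsto_eLpNorm_of_tendsto_sub hf hg h
  have hlim2 : Tendsto (fun n => (((eLpNorm (f n) 2 P ^ 2).toNNReal : ℝ≥0) : ℝ)) atTop
      (𝓝 ((eLpNorm g 2 P ^ 2).toNNReal : ℝ≥0)) := by
    refine (NNReal.continuous_coe.tendsto _).comp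
      ((ENNReal.tendsto_toNNReal (ENNReal.pow_ne_top hg.2.ne)).comp ?_)
    exact ((ENNReal.continuous_pow 2).tendsto _).comp hlim
  have hm : TendstoInMeasure P f atTop g :=
    tendstoInMeasure_of_tendsto_eLpNorm (p := 2) (by norm_num) (fun n => (hf n).1) hg.1 h
  obtain ⟨ns, hns, hae⟩ := hm.exists_seq_tendsto_ae
  have : IsProbabilityMeasure (P.map g) := Measure.isProbabilityMeasure_map hg.1.aemeasurable
  refine Measure.ext_of_charFun (funext fun t => ?_)
  have hchar : ∀ u : Ω → ℝ, AEMeasurable u P →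
      charFun (P.map u) t = ∫ ω, Complex.exp (t * u ω * Complex.I) ∂P := by
    intro u hu
    rw [charFun_apply_real, integral_map hu (by fun_prop)]
  have h1 : Tendsto (fun n => charFun (P.map (f (ns n))) t) atTop (𝓝 (charFun (P.map g) t)) := by
    simp_rw [hchar _ (hf _).1.aemeasurable, hchar _ hg.1.aemeasurable]
    refine tendsto_integral_of_dominated_convergence (fun _ => 1) ?_ (integrable_const _) ?_ ?_
    · intro n
      have : Continuous fun x : ℝ => Complex.exp (t * x * Complex.I) := by fun_prop
      exact this.comp_aestronglyMeasurable (hf (ns n)).1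
    · intro n
      refine ae_of_all _ fun ω => le_of_eq ?_
      have : (t * f (ns n) ω * Complex.I : ℂ) = ((t * f (ns n) ω : ℝ) : ℂ) * Complex.I := by
        push_cast; ring
      rw [this, Complex.norm_exp_ofReal_mul_I]
    · filter_upwards [hae] with ω hω
      have : Continuous fun x : ℝ => Complex.exp (t * x * Complex.I) := by fun_prop
      exact (this.tendsto _).comp hω
  have h2 : Tendsto (fun n => charFun (P.map (f (ns n))) t) atTop
      (𝓝 (charFun (gaussianReal 0 (eLpNorm g 2 P ^ 2).toNNReal) t)) := by
    simp_rw [hlaw, charFun_gaussianReal]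
    refine (Complex.continuous_exp.tendsto _).comp ?_
    refine Tendsto.sub tendsto_const_nhds ?_
    refine Tendsto.div_const (Tendsto.mul_const _ ?_) _
    exact (Complex.continuous_ofReal.tendsto _).comp (hlim2.comp hns.tendsto_atTop)
  exact tendsto_nhds_unique h1 h2

namespace IsWienerIntegral

variable {φ ψ : ℝ → ℝ → ℝ} {Y Z : Ω → ℝ}

theorem congr (h : IsWienerIntegral P γ W φ Y) (hYZ : Y =ᵐ[P] Z) : IsWienerIntegral P γ W φ Z := by
  obtain ⟨h1, c, h2, h3⟩ := h
  refine ⟨h1.ae_eq hYZ, c, h2, ?_⟩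
  refine h3.congr fun n => eLpNorm_congr_ae ?_
  filter_upwards [hYZ] with ω hω
  rw [hω]

theorem zero : IsWienerIntegral P γ W (fun _ _ => 0) (fun _ : Ω => 0) := by
  refine ⟨MemLp.zero, fun _ => 0, ?_, ?_⟩
  · simp [energy, elemIntegrand_zero]
  · simp [elemIntegral]

variable (hγ : 0 < γ) (hγ' : γ < 1 / 4) (hW : IsRieszNoise P γ W)

include hγ hγ' hW

theorem add (hφ : Measurable (Function.uncurry φ)) (hψ : Measurable (Function.uncurry ψ))
    (h : IsWienerIntegral P γ W φ Y) (h' : IsWienerIntegral P γ W ψ Z) :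
    IsWienerIntegral P γ W (fun s z => φ s z + ψ s z) (fun ω => Y ω + Z ω) := by
  obtain ⟨h1, c, h2, h3⟩ := h
  obtain ⟨h1', c', h2', h3'⟩ := h'
  refine ⟨h1.add h1', fun n => c n + c' n, ?_, ?_⟩
  · refine tendsto_of_tendsto_of_tendsto_of_le_of_le tendsto_const_nhds
      (h := fun n => 2 * energy γ (fun s z => elemIntegrand (c n) s z - φ s z) +
        2 * energy γ (fun s z => elemIntegrand (c' n) s z - ψ s z)) ?_ (fun _ => bot_le) ?_
    · have := (ENNReal.Tendsto.const_mul h2 (Or.inr (by simp : (2 : ℝ≥0∞) ≠ ∞))).add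
        (ENNReal.Tendsto.const_mul h2' (Or.inr (by simp : (2 : ℝ≥0∞) ≠ ∞)))
      simpa using this
    · intro n
      refine le_trans (le_of_eq ?_) (energy_add_le hγ hγ'
        (measurable_uncurry_sub (measurable_elemIntegrand (c n)) hφ)
        (measurable_uncurry_sub (measurable_elemIntegrand (c' n)) hψ))
      refine congrArg (energy γ) (funext fun s => funext fun z => ?_)
      rw [elemIntegrand_add]; ring
  · refine tendsto_of_tendsto_of_tendsto_of_le_of_le tendsto_const_nhds
      (h := fun n => eLpNorm (fun ω => elemIntegral W (c n) ω - Y ω) 2 P +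
        eLpNorm (fun ω => elemIntegral W (c' n) ω - Z ω) 2 P) ?_ (fun _ => bot_le) ?_
    · simpa using h3.add h3'
    · intro n
      refine le_trans (le_of_eq ?_) (eLpNorm_add_le ((memLp_elemIntegral hW (c n)).1.sub h1.1)
        ((memLp_elemIntegral hW (c' n)).1.sub h1'.1) (by norm_num))
      refine congrArg (fun f : Ω → ℝ => eLpNorm f 2 P) (funext fun ω => ?_)
      simp only [elemIntegral_add, Pi.add_apply]
      ring

omit hγ hγ' hW in
theorem const_mul (a : ℝ) (h : IsWienerIntegral P γ W φ Y) :
    IsWienerIntegral P γ W (fun s z => a * φ s z) (fun ω => a * Y ω) := by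
  obtain ⟨h1, c, h2, h3⟩ := h
  refine ⟨h1.const_mul a, fun n => a • c n, ?_, ?_⟩
  · have := ENNReal.Tendsto.const_mul (a := ENNReal.ofReal (a ^ 2)) h2 (Or.inr (by simp))
    rw [mul_zero] at this
    refine this.congr fun n => ?_
    rw [← energy_const_mul]
    simp only [elemIntegrand_smul, mul_sub]
  · have := ENNReal.Tendsto.const_mul (a := ‖a‖ₑ) h3 (Or.inr (by simp))
    rw [mul_zero] at this
    refine this.congr fun n => ?_
    rw [← eLpNorm_const_smul]
    congr 1
    ext ω
    simp only [elemIntegral_smul, Pi.smul_apply, smul_eq_mul, mul_sub]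

theorem sub (hφ : Measurable (Function.uncurry φ)) (hψ : Measurable (Function.uncurry ψ))
    (h : IsWienerIntegral P γ W φ Y) (h' : IsWienerIntegral P γ W ψ Z) :
    IsWienerIntegral P γ W (fun s z => φ s z - ψ s z) (fun ω => Y ω - Z ω) := by
  have h2 := add hγ hγ' hW hφ (measurable_uncurry_const_mul (-1) hψ) h (h'.const_mul (-1))
  simpa only [neg_mul, one_mul, ← sub_eq_add_neg] using! h2

theorem sum {ι : Type*} (I : Finset ι) (a : ι → ℝ) {φ : ι → ℝ → ℝ → ℝ} {Y : ι → Ω → ℝ}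
    (hφ : ∀ i, Measurable (Function.uncurry (φ i))) (h : ∀ i, IsWienerIntegral P γ W (φ i) (Y i)) :
    IsWienerIntegral P γ W (fun s z => ∑ i ∈ I, a i * φ i s z) (fun ω => ∑ i ∈ I, a i * Y i ω) := by
  classical
  induction I using Finset.induction_on with
  | empty => simpa using zero
  | insert i I hi ih =>
    simp_rw [Finset.sum_insert hi]
    refine add hγ hγ' hW (measurable_uncurry_const_mul _ (hφ i)) ?_ ((h i).const_mul _) ih
    exact Finset.measurable_sum _ fun i _ => (hφ i).const_mul _

variable (hφ : Measurable (Function.uncurry φ)) (hE : energy γ φ < ∞)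

include hφ hE

/-- The isometry of the Wiener integral. -/
theorem eLpNorm_eq (h : IsWienerIntegral P γ W φ Y) :
    eLpNorm Y 2 P = eLpNorm (integrandRoot γ φ) 2 rootMeasure := by
  obtain ⟨h1, c, h2, h3⟩ := h
  have h4 := tendsto_eLpNorm_of_tendsto_sub (fun n => memLp_elemIntegral hW (c n)) h1 h3
  have h5 := tendsto_eLpNorm_integrandRoot hγ hγ' (fun n => measurable_elemIntegrand (c n)) hφ
    (fun n => energy_elemIntegrand_lt_top hγ hγ' (c n)) hE h2
  simp_rw [eLpNorm_elemIntegral hγ hγ' hW] at h4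
  exact tendsto_nhds_unique h4 h5

theorem eLpNorm_sq_le (h : IsWienerIntegral P γ W φ Y) : eLpNorm Y 2 P ^ 2 ≤ energy γ φ := by
  rw [h.eLpNorm_eq hγ hγ' hW hφ hE]
  exact eLpNorm_integrandRoot_sq_le hγ hγ' hφ

omit hγ hγ' hφ hE in
theorem map_eq (h : IsWienerIntegral P γ W φ Y) :
    P.map Y = gaussianReal 0 (eLpNorm Y 2 P ^ 2).toNNReal := by
  obtain ⟨h1, c, h2, h3⟩ := h
  have := hW.gaussian.isProbabilityMeasure
  exact map_eq_gaussianReal_of_tendsto (fun n => memLp_elemIntegral hW (c n)) h1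
    (fun n => map_elemIntegral hW (c n)) h3

omit hγ hγ' hφ hE in
theorem integral_eq_zero (h : IsWienerIntegral P γ W φ Y) : ∫ ω, Y ω ∂P = 0 := by
  have h1 := h.map_eq hW
  have h2 : ∫ x, x ∂(P.map Y) = ∫ ω, Y ω ∂P :=
    integral_map h.1.1.aemeasurable (by fun_prop)
  rw [← h2, h1]
  exact integral_id_gaussianReal

/-- The Wiener integral of an integrand is unique up to null sets. -/
theorem ae_eq (h : IsWienerIntegral P γ W φ Y) (h' : IsWienerIntegral P γ W φ Z) : Y =ᵐ[P] Z := by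
  have h1 := (h.sub hγ hγ' hW hφ hφ h').eLpNorm_sq_le hγ hγ' hW
    (measurable_uncurry_sub hφ hφ) (energy_sub_lt_top hγ hγ' hφ hφ hE hE)
  have h0 : energy γ (fun s z => φ s z - φ s z) = 0 := by simp [energy]
  rw [h0, nonpos_iff_eq_zero, sq_eq_zero_iff] at h1
  have h2 := (eLpNorm_eq_zero_iff (h.1.1.sub h'.1.1) (by norm_num)).1 h1
  filter_upwards [h2] with ω hω
  simpa [sub_eq_zero] using hω

end IsWienerIntegral

/-- An integrand is approximable if it is a limit of elementary integrands in energy. -/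
def IsApproximable (γ : ℝ) (φ : ℝ → ℝ → ℝ) : Prop :=
  ∀ ε : ℝ≥0∞, 0 < ε → ∃ c, energy γ (fun s z => elemIntegrand c s z - φ s z) ≤ ε

/-- The integrals of approximating elementary integrands form a Cauchy sequence in `L²(P)`. -/
theorem IsApproximable.exists_wienerIntegral (hγ : 0 < γ) (hγ' : γ < 1 / 4)
    (hW : IsRieszNoise P γ W) {φ : ℝ → ℝ → ℝ} (hφ : Measurable (Function.uncurry φ))
    (h : IsApproximable γ φ) : ∃ Y : Ω → ℝ, IsWienerIntegral P γ W φ Y := by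
  let B : ℕ → ℝ≥0∞ := fun n => 2⁻¹ ^ n
  have hB0 : ∀ n, 0 < B n := fun n => ENNReal.pow_pos (by simp) n
  have hBt : ∀ n, B n ≠ ∞ := fun n => ENNReal.pow_ne_top (by simp)
  choose c hc using fun n : ℕ => h ((B n / 2 / 2) ^ 2)
    (ENNReal.pow_pos (ENNReal.half_pos (ENNReal.half_pos (hB0 n).ne').ne') 2)
  have hanti : ∀ N n, N ≤ n → B n ≤ B N := fun N n hn =>
    pow_le_pow_right_of_le_one' (by simp) hn
  have hcau : ∀ N n m : ℕ, N ≤ n → N ≤ m →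
      eLpNorm (elemIntegral W (c n) - elemIntegral W (c m)) 2 P < B N := by
    intro N n m hn hm
    have h1 : elemIntegral W (c n) - elemIntegral W (c m) = elemIntegral W (c n - c m) := by
      ext ω; rw [elemIntegral_sub]; rfl
    have h2 : eLpNorm (elemIntegral W (c n - c m)) 2 P ^ 2 ≤ (B N / 2) ^ 2 := by
      rw [eLpNorm_elemIntegral hγ hγ' hW]
      refine (eLpNorm_integrandRoot_sq_le hγ hγ' (measurable_elemIntegrand _)).trans ?_
      have h3 := energy_sub_le hγ hγ' (measurable_uncurry_sub (measurable_elemIntegrand (c n)) hφ)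
        (measurable_uncurry_sub (measurable_elemIntegrand (c m)) hφ)
      have h4 : (fun s y => (elemIntegrand (c n) s y - φ s y) -
          (elemIntegrand (c m) s y - φ s y)) = elemIntegrand (c n - c m) := by
        ext s y
        rw [elemIntegrand_sub]
        ring
      have h5 : energy γ (elemIntegrand (c n - c m)) ≤
          2 * energy γ (fun s z => elemIntegrand (c n) s z - φ s z) +
          2 * energy γ (fun s z => elemIntegrand (c m) s z - φ s z) := by
        rw [← h4]; exact h3
      calc energy γ (elemIntegrand (c n - c m)) ≤ _ := h5
        _ ≤ 2 * (B n / 2 / 2) ^ 2 + 2 * (B m / 2 / 2) ^ 2 := by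
            gcongr
            · exact hc n
            · exact hc m
        _ ≤ 2 * (B N / 2 / 2) ^ 2 + 2 * (B N / 2 / 2) ^ 2 := by
            gcongr
            · exact hanti N n hn
            · exact hanti N m hm
        _ = (B N / 2) ^ 2 := by
            have : 2 * (B N / 2 / 2) = B N / 2 := ENNReal.mul_div_cancel (by simp) (by simp)
            generalize B N / 2 / 2 = D at this ⊢
            rw [← this]
            ring
    rw [h1]
    refine lt_of_le_of_lt ((ENNReal.pow_le_pow_left_iff (by norm_num)).1 h2) ?_
    exact ENNReal.half_lt_self (hB0 N).ne' (hBt N)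
  have hsum : ∑' n, B n ≠ ∞ := by
    rw [ENNReal.tsum_geometric]
    simp
  obtain ⟨Y, hY, hlim⟩ := Lp.cauchy_complete_eLpNorm (by norm_num)
    (fun n => memLp_elemIntegral hW (c n)) hsum hcau
  refine ⟨Y, hY, c, ?_, hlim⟩
  have hB : Tendsto B atTop (𝓝 0) :=
    ENNReal.tendsto_pow_atTop_nhds_zero_of_lt_one (by simp)
  refine tendsto_of_tendsto_of_tendsto_of_le_of_le tendsto_const_nhds hB (fun _ => bot_le)
    fun n => (hc n).trans ?_
  have h1 : B n / 2 / 2 ≤ B n := ENNReal.half_le_self.trans ENNReal.half_le_self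
  have h2 : B n ≤ 1 := pow_le_one' (by simp) n
  calc (B n / 2 / 2) ^ 2 ≤ B n ^ 2 := by gcongr
    _ = B n * B n := sq _
    _ ≤ B n * 1 := by gcongr
    _ = B n := mul_one _

/-- A family of Wiener integrals is a Gaussian process. -/
theorem isGaussianProcess_of_isWienerIntegral {T : Type*} (hγ : 0 < γ) (hγ' : γ < 1 / 4)
    (hW : IsRieszNoise P γ W) {φ : T → ℝ → ℝ → ℝ} {Y : T → Ω → ℝ}
    (hφ : ∀ x, Measurable (Function.uncurry (φ x)))
    (h : ∀ x, IsWienerIntegral P γ W (φ x) (Y x)) : IsGaussianProcess Y P := by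
  have := hW.gaussian.isProbabilityMeasure
  refine ⟨fun I => ⟨isGaussian_of_map_eq_gaussianReal fun L => ?_⟩⟩
  have hm : AEMeasurable (fun ω => I.restrict (Y · ω)) P :=
    aemeasurable_pi_lambda _ fun i => (h i).1.1.aemeasurable
  classical
  have hL : ∀ ω, L (I.restrict (Y · ω)) = ∑ i : I, L (Pi.single i 1) * Y i ω := by
    intro ω
    conv_lhs => rw [pi_eq_sum_univ' (I.restrict (Y · ω)), map_sum]
    refine Finset.sum_congr rfl fun i _ => ?_
    rw [map_smul, smul_eq_mul, mul_comm]
    rfl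
  have h2 := (IsWienerIntegral.sum hγ hγ' hW Finset.univ (fun i : I => L (Pi.single i 1))
    (fun i => hφ i) (fun i => h i)).map_eq hW
  refine ⟨0, (eLpNorm (fun ω => ∑ i : I, L (Pi.single i 1) * Y i ω) 2 P ^ 2).toNNReal, ?_⟩
  rw [AEMeasurable.map_map_of_aemeasurable (by fun_prop) hm, ← h2]
  congr 1
  ext ω
  exact hL ω

/-- Two families of Wiener integrals whose finite linear combinations have the same variances have
the same finite-dimensional distributions. -/
theorem map_restrict_eq_of_isWienerIntegral {T : Type*} (hγ : 0 < γ) (hγ' : γ < 1 / 4)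
    (hW : IsRieszNoise P γ W) {φ ψ : T → ℝ → ℝ → ℝ} {Y Z : T → Ω → ℝ}
    (hφ : ∀ x, Measurable (Function.uncurry (φ x))) (hψ : ∀ x, Measurable (Function.uncurry (ψ x)))
    (hEφ : ∀ x, energy γ (φ x) < ∞) (hEψ : ∀ x, energy γ (ψ x) < ∞)
    (h : ∀ x, IsWienerIntegral P γ W (φ x) (Y x)) (h' : ∀ x, IsWienerIntegral P γ W (ψ x) (Z x))
    (I : Finset T)
    (hN : ∀ a : I → ℝ,
      eLpNorm (integrandRoot γ (fun s z => ∑ i : I, a i * φ i s z)) 2 rootMeasure =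
      eLpNorm (integrandRoot γ (fun s z => ∑ i : I, a i * ψ i s z)) 2 rootMeasure) :
    P.map (fun ω => I.restrict (Y · ω)) = P.map (fun ω => I.restrict (Z · ω)) := by
  classical
  have := hW.gaussian.isProbabilityMeasure
  have hm : ∀ {Y : T → Ω → ℝ} {φ : T → ℝ → ℝ → ℝ}, (∀ x, IsWienerIntegral P γ W (φ x) (Y x)) →
      AEMeasurable (fun ω => I.restrict (Y · ω)) P := fun h =>
    aemeasurable_pi_lambda _ fun i => (h i).1.1.aemeasurable
  have := Measure.isFiniteMeasure_map P (fun ω => I.restrict (Y · ω))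
  have := Measure.isFiniteMeasure_map P (fun ω => I.restrict (Z · ω))
  refine Measure.ext_of_charFunDual (funext fun L => ?_)
  have hL : ∀ (Y : T → Ω → ℝ) ω, L (I.restrict (Y · ω)) = ∑ i : I, L (Pi.single i 1) * Y i ω := by
    intro Y ω
    conv_lhs => rw [pi_eq_sum_univ' (I.restrict (Y · ω)), map_sum]
    refine Finset.sum_congr rfl fun i _ => ?_
    rw [map_smul, smul_eq_mul, mul_comm]
    rfl
  have hmap : ∀ {Y : T → Ω → ℝ} {φ : T → ℝ → ℝ → ℝ},
      (∀ x, Measurable (Function.uncurry (φ x))) → (∀ x, energy γ (φ x) < ∞) →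
      (∀ x, IsWienerIntegral P γ W (φ x) (Y x)) →
      (P.map (fun ω => I.restrict (Y · ω))).map L = gaussianReal 0 (eLpNorm (integrandRoot γ
        (fun s z => ∑ i : I, L (Pi.single i 1) * φ i s z)) 2 rootMeasure ^ 2).toNNReal := by
    intro Y φ hφ hEφ h
    rw [AEMeasurable.map_map_of_aemeasurable (by fun_prop) (hm h)]
    have h1 := IsWienerIntegral.sum hγ hγ' hW Finset.univ (fun i : I => L (Pi.single i 1))
      (fun i => hφ i) (fun i => h i)
    have h3 := sum_energy_lt_top hγ hγ' Finset.univ (fun i : I => L (Pi.single i 1))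
      (fun i => φ i) (fun i => hφ i) (fun i => hEφ i)
    rw [← h1.eLpNorm_eq hγ hγ' hW h3.1 h3.2.1, ← h1.map_eq hW]
    congr 1
    ext ω
    exact hL Y ω
  rw [charFunDual_eq_charFun_map_one, charFunDual_eq_charFun_map_one, hmap hφ hEφ h,
    hmap hψ hEψ h', hN]

end

/-! ### Approximation of continuous integrands -/

/-- Each point of `(t 0, t N]` lies in exactly one of the intervals `(t i, t (i + 1)]`, so that a
sum of indicators of these intervals selects one coefficient. -/
theorem sum_indicator_Ioc {t : ℕ → ℝ} (ht : Monotone t) {N : ℕ} {x : ℝ}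
    (hx : x ∈ Set.Ioc (t 0) (t N)) :
    ∃ i < N, x ∈ Set.Ioc (t i) (t (i + 1)) ∧ ∀ v : ℕ → ℝ,
      ∑ j ∈ Finset.range N, (Set.Ioc (t j) (t (j + 1))).indicator (fun _ => 1) x * v j = v i := by
  have h1 : ∃ i < N, x ∈ Set.Ioc (t i) (t (i + 1)) := by
    induction N with
    | zero => simp at hx
    | succ N ih =>
      rcases le_or_gt x (t N) with h | h
      · obtain ⟨i, hi, hi'⟩ := ih ⟨hx.1, h⟩
        exact ⟨i, by omega, hi'⟩
      · exact ⟨N, by omega, h, hx.2⟩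
  obtain ⟨i, hi, hi'⟩ := h1
  refine ⟨i, hi, hi', fun v => ?_⟩
  rw [Finset.sum_eq_single i]
  · rw [Set.indicator_of_mem hi', one_mul]
  · intro j _ hji
    have : Disjoint (Set.Ioc (t i) (t (i + 1))) (Set.Ioc (t j) (t (j + 1))) :=
      ht.pairwise_disjoint_on_Ioc_succ hji.symm
    rw [Set.indicator_of_notMem (Set.disjoint_left.1 this hi'), zero_mul]
  · intro h; exact absurd (Finset.mem_range.2 hi) h

theorem notMem_Ioc_of_notMem {t : ℕ → ℝ} (ht : Monotone t) {N : ℕ} {x : ℝ}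
    (hx : x ∉ Set.Ioc (t 0) (t N)) {j : ℕ} (hj : j < N) : x ∉ Set.Ioc (t j) (t (j + 1)) :=
  fun h => hx ⟨(ht (Nat.zero_le j)).trans_lt h.1, h.2.trans (ht (by omega))⟩

/-- Uniform approximation of a continuous function on a rectangle by an elementary integrand which
vanishes outside the rectangle. -/
theorem exists_elemIntegrand_near {φ : ℝ → ℝ → ℝ} {a b r : ℝ} (ha : 0 ≤ a) (hab : a ≤ b)
    (hr : 0 ≤ r) (hφ : ContinuousOn (Function.uncurry φ) (Set.Icc a b ×ˢ Set.Icc (-r) r))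
    {η : ℝ} (hη : 0 < η) :
    ∃ c : ℝ≥0 × BddBorel →₀ ℝ, ∀ s z,
      (s ∈ Set.Ioc a b ∧ z ∈ Set.Ioc (-r) r → |elemIntegrand c s z - φ s z| ≤ η) ∧
      (¬ (s ∈ Set.Ioc a b ∧ z ∈ Set.Ioc (-r) r) → elemIntegrand c s z = 0) := by
  have huc := (isCompact_Icc.prod isCompact_Icc).uniformContinuousOn_of_continuous hφ
  rw [Metric.uniformContinuousOn_iff] at huc
  obtain ⟨δ, hδ, hδ'⟩ := huc η hη
  obtain ⟨N, hN⟩ := exists_nat_gt (max ((b - a) / δ) (2 * r / δ))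
  have hN0 : (0 : ℝ) < N :=
    lt_of_le_of_lt (le_max_of_le_left (div_nonneg (by linarith) hδ.le)) hN
  have hN1 : (b - a) / N < δ := by
    rw [div_lt_iff₀ hN0]
    have := (div_lt_iff₀ hδ).1 ((le_max_left _ _).trans_lt hN)
    linarith
  have hN2 : 2 * r / N < δ := by
    rw [div_lt_iff₀ hN0]
    have := (div_lt_iff₀ hδ).1 ((le_max_right _ _).trans_lt hN)
    linarith
  let t : ℕ → ℝ := fun i => a + i * ((b - a) / N)
  let w : ℕ → ℝ := fun j => -r + j * (2 * r / N)
  have hd1 : 0 ≤ (b - a) / N := div_nonneg (by linarith) hN0.le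
  have hd2 : 0 ≤ 2 * r / N := by positivity
  have ht : Monotone t := monotone_nat_of_le_succ fun i => by
    simp only [t]; push_cast; linarith
  have hw : Monotone w := monotone_nat_of_le_succ fun i => by
    simp only [w]; push_cast; linarith
  have ht0 : t 0 = a := by simp [t]
  have htN : t N = b := by simp only [t]; field_simp; ring
  have hw0 : w 0 = -r := by simp [w]
  have hwN : w N = r := by simp only [w]; field_simp; ring
  have htpos : ∀ i, 0 ≤ t i := fun i => ha.trans (ht0 ▸ ht (Nat.zero_le i))
  let T : ℕ → ℝ≥0 := fun i => ⟨t i, htpos i⟩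
  let A : ℕ → BddBorel := fun j =>
    ⟨Set.Ioc (w j) (w (j + 1)), measurableSet_Ioc, Metric.isBounded_Ioc _ _⟩
  let v : ℕ → ℕ → ℝ := fun i j => φ (t (i + 1)) (w (j + 1))
  let c : ℝ≥0 × BddBorel →₀ ℝ := ∑ i ∈ Finset.range N, ∑ j ∈ Finset.range N,
    (Finsupp.single (T (i + 1), A j) (v i j) - Finsupp.single (T i, A j) (v i j))
  have hc : ∀ s z, elemIntegrand c s z = ∑ i ∈ Finset.range N,
      (Set.Ioc (t i) (t (i + 1))).indicator (fun _ => 1) s *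
        ∑ j ∈ Finset.range N, (Set.Ioc (w j) (w (j + 1))).indicator (fun _ => 1) z * v i j := by
    intro s z
    simp only [c]
    rw [elemIntegrand_sum]
    refine Finset.sum_congr rfl fun i _ => ?_
    rw [elemIntegrand_sum, Finset.mul_sum]
    refine Finset.sum_congr rfl fun j _ => ?_
    rw [elemIntegrand_sub, elemIntegrand_single, elemIntegrand_single]
    have h1 : (Set.Ioc (t i) (t (i + 1))).indicator (fun _ => (1 : ℝ)) s =
        (Set.Ioc 0 (t (i + 1))).indicator (fun _ => (1 : ℝ)) s -
        (Set.Ioc 0 (t i)).indicator (fun _ => (1 : ℝ)) s := by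
      have h2 := ht (Nat.le_succ i)
      have h3 := htpos i
      simp only [Set.indicator_apply, Set.mem_Ioc]
      split_ifs <;> grind
    rw [h1]
    change v i j * ((Set.Ioc (0 : ℝ) (t (i + 1))).indicator (fun _ => 1) s *
      (Set.Ioc (w j) (w (j + 1))).indicator (fun _ => 1) z) - v i j *
      ((Set.Ioc (0 : ℝ) (t i)).indicator (fun _ => 1) s *
      (Set.Ioc (w j) (w (j + 1))).indicator (fun _ => 1) z) = _
    ring
  refine ⟨c, fun s z => ⟨?_, ?_⟩⟩
  · rintro ⟨hs, hz⟩
    obtain ⟨i, hi, hsi, hi'⟩ := sum_indicator_Ioc ht (N := N) (x := s) (by rwa [ht0, htN])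
    obtain ⟨j, hj, hzj, hj'⟩ := sum_indicator_Ioc hw (N := N) (x := z) (by rwa [hw0, hwN])
    rw [hc, hi', hj']
    have h1 : t (i + 1) ∈ Set.Icc a b := ⟨ht0 ▸ ht (Nat.zero_le _), htN ▸ ht hi⟩
    have h2 : w (j + 1) ∈ Set.Icc (-r) r := ⟨hw0 ▸ hw (Nat.zero_le _), hwN ▸ hw hj⟩
    have h3 : t (i + 1) = t i + (b - a) / N := by simp only [t]; push_cast; ring
    have h4 : w (j + 1) = w j + 2 * r / N := by simp only [w]; push_cast; ring
    have := hδ' (t (i + 1), w (j + 1)) ⟨h1, h2⟩ (s, z)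
      ⟨Set.Ioc_subset_Icc_self hs, Set.Ioc_subset_Icc_self hz⟩ ?_
    · exact this.le
    · rw [Prod.dist_eq, max_lt_iff, Real.dist_eq, Real.dist_eq, abs_lt, abs_lt]
      obtain ⟨h5, h6⟩ := hsi
      obtain ⟨h7, h8⟩ := hzj
      exact ⟨⟨by linarith, by linarith⟩, ⟨by linarith, by linarith⟩⟩
  · intro h
    rw [hc]
    refine Finset.sum_eq_zero fun i hi => ?_
    by_cases hs : s ∈ Set.Ioc a b
    · have hz : z ∉ Set.Ioc (-r) r := fun hz => h ⟨hs, hz⟩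
      rw [Finset.sum_eq_zero, mul_zero]
      intro j hj
      rw [Set.indicator_of_notMem (notMem_Ioc_of_notMem hw (N := N) (by rwa [hw0, hwN])
        (Finset.mem_range.1 hj)), zero_mul]
    · rw [Set.indicator_of_notMem (notMem_Ioc_of_notMem ht (N := N) (by rwa [ht0, htN])
        (Finset.mem_range.1 hi)), zero_mul]

theorem energy_eq_lintegral_prod (γ : ℝ) {φ : ℝ → ℝ → ℝ}
    (hφ : Measurable (Function.uncurry φ)) :
    energy γ φ = ∫⁻ q, ENNReal.ofReal
      (|φ q.1 q.2.1| * rieszKernel γ (q.2.1 - q.2.2) * |φ q.1 q.2.2|)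
      ∂((volume.restrict (Set.Ioi (0 : ℝ))).prod ((volume : Measure ℝ).prod volume)) := by
  have h1 : Measurable fun q : ℝ × (ℝ × ℝ) => φ q.1 q.2.1 :=
    hφ.comp (by fun_prop : Measurable fun q : ℝ × (ℝ × ℝ) => (q.1, q.2.1))
  have h2 : Measurable fun q : ℝ × (ℝ × ℝ) => φ q.1 q.2.2 :=
    hφ.comp (by fun_prop : Measurable fun q : ℝ × (ℝ × ℝ) => (q.1, q.2.2))
  rw [lintegral_prod _ (by fun_prop), energy]
  refine lintegral_congr fun s => ?_
  have h3 : Measurable (φ s) := hφ.of_uncurry_left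
  rw [lintegral_prod _ (by fun_prop)]

/-- Dominated convergence for the energy. -/
theorem tendsto_energy_zero {γ : ℝ} (hγ : 0 < γ) (hγ' : γ < 1 / 4) {φ : ℕ → ℝ → ℝ → ℝ}
    {ψ : ℝ → ℝ → ℝ} (hφ : ∀ n, Measurable (Function.uncurry (φ n)))
    (hψ : Measurable (Function.uncurry ψ)) (hE : energy γ ψ < ∞)
    (hle : ∀ n s z, |φ n s z| ≤ |ψ s z|)
    (hlim : ∀ s z, Tendsto (fun n => φ n s z) atTop (𝓝 0)) :
    Tendsto (fun n => energy γ (φ n)) atTop (𝓝 0) := by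
  simp_rw [fun n => energy_eq_lintegral_prod γ (hφ n)]
  rw [energy_eq_lintegral_prod γ hψ] at hE
  have h1 : ∀ {φ : ℝ → ℝ → ℝ}, Measurable (Function.uncurry φ) →
      Measurable fun q : ℝ × (ℝ × ℝ) => φ q.1 q.2.1 := fun hφ =>
    hφ.comp (by fun_prop : Measurable fun q : ℝ × (ℝ × ℝ) => (q.1, q.2.1))
  have h2 : ∀ {φ : ℝ → ℝ → ℝ}, Measurable (Function.uncurry φ) →
      Measurable fun q : ℝ × (ℝ × ℝ) => φ q.1 q.2.2 := fun hφ =>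
    hφ.comp (by fun_prop : Measurable fun q : ℝ × (ℝ × ℝ) => (q.1, q.2.2))
  have h0 : (0 : ℝ≥0∞) = ∫⁻ _ : ℝ × (ℝ × ℝ), 0
      ∂((volume.restrict (Set.Ioi (0 : ℝ))).prod ((volume : Measure ℝ).prod volume)) := by simp
  rw [h0]
  refine tendsto_lintegral_of_dominated_convergence _ (fun n => ?_) (fun n => ?_) hE.ne ?_
  · have := h1 (hφ n)
    have := h2 (hφ n)
    fun_prop
  · refine ae_of_all _ fun q => ENNReal.ofReal_le_ofReal ?_
    have := rieszKernel_nonneg hγ hγ' (q.2.1 - q.2.2)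
    have := hle n q.1 q.2.1
    have := hle n q.1 q.2.2
    gcongr
  · refine ae_of_all _ fun q => ?_
    have h3 := ((hlim q.1 q.2.1).abs.mul_const (rieszKernel γ (q.2.1 - q.2.2))).mul
      (hlim q.1 q.2.2).abs
    have h4 := (ENNReal.continuous_ofReal.tendsto _).comp h3
    simpa [Function.comp_def] using h4

/-- An integrand of finite energy which is continuous on `S × ℝ` and vanishes for times outside `S`
is approximable, if `S` is exhausted by compact intervals. -/
theorem isApproximable_of_continuousOn {γ : ℝ} (hγ : 0 < γ) (hγ' : γ < 1 / 4) {φ : ℝ → ℝ → ℝ}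
    {S : Set ℝ} {a b : ℕ → ℝ} (ha : ∀ n, 0 ≤ a n) (hab : ∀ n, a n ≤ b n)
    (hS : ∀ n, Set.Icc (a n) (b n) ⊆ S) (hex : ∀ s ∈ S, ∀ᶠ n in atTop, s ∈ Set.Ioc (a n) (b n))
    (hφ : Measurable (Function.uncurry φ)) (hE : energy γ φ < ∞)
    (hc : ContinuousOn (Function.uncurry φ) (S ×ˢ Set.univ)) (h0 : ∀ s ∉ S, ∀ z, φ s z = 0) :
    IsApproximable γ φ := by
  classical
  intro ε hε
  -- `φ` splits into its restriction to a large rectangle `Q n` and a part `ψ n` of small energy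
  let Q : ℕ → Set (ℝ × ℝ) := fun n => Set.Ioc (a n) (b n) ×ˢ Set.Ioc (-(n : ℝ)) n
  have hQ : ∀ n, MeasurableSet (Q n) := fun n => measurableSet_Ioc.prod measurableSet_Ioc
  let ψ : ℕ → ℝ → ℝ → ℝ := fun n s z => (Q n)ᶜ.indicator (Function.uncurry φ) (s, z)
  have hψm : ∀ n, Measurable (Function.uncurry (ψ n)) := fun n => by
    have : Function.uncurry (ψ n) = (Q n)ᶜ.indicator (Function.uncurry φ) := by
      ext p; rfl
    rw [this]
    exact hφ.indicator (hQ n).compl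
  have hψle : ∀ n s z, |ψ n s z| ≤ |φ s z| := by
    intro n s z
    simp only [ψ, Set.indicator_apply]
    split_ifs
    · exact le_rfl
    · simp
  have hlim : Tendsto (fun n => energy γ (ψ n)) atTop (𝓝 0) := by
    refine tendsto_energy_zero hγ hγ' hψm hφ hE hψle fun s z => ?_
    by_cases hs : s ∈ S
    · refine tendsto_const_nhds.congr' ?_
      obtain ⟨k, hk⟩ := exists_nat_gt |z|
      filter_upwards [hex s hs, eventually_ge_atTop k] with n hn hkn
      have h1 : |z| < n := hk.trans_le (by exact_mod_cast hkn)
      have h2 : (s, z) ∈ Q n := ⟨hn, (abs_lt.1 h1).1, (abs_lt.1 h1).2.le⟩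
      simp only [ψ]
      rw [Set.indicator_of_notMem (by simpa using h2)]
    · refine tendsto_const_nhds.congr fun n => ?_
      simp only [ψ, Set.indicator_apply]
      split_ifs
      · exact (h0 s hs z).symm
      · rfl
  have hε4 : 0 < ε / 2 / 2 := ENNReal.half_pos (ENNReal.half_pos hε.ne').ne'
  obtain ⟨n, hn⟩ := (hlim.eventually (ge_mem_nhds hε4)).exists
  let χ : ℝ → ℝ → ℝ := fun s z => (Q n).indicator (fun _ => 1) (s, z)
  have hχm : Measurable (Function.uncurry χ) := by
    have : Function.uncurry χ = (Q n).indicator (fun _ => 1) := by ext p; rfl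
    rw [this]
    exact measurable_const.indicator (hQ n)
  have hχE : energy γ χ < ∞ := by
    refine energy_lt_top_of_le hγ hγ' (C := 1 + n) (T := b n) fun s z => ?_
    simp only [χ, Set.indicator_apply]
    by_cases h : (s, z) ∈ Q n
    · have h1 : s ∈ Set.Iic (b n) := h.1.2
      have h2 : |z| ≤ n := abs_le.2 ⟨h.2.1.le, h.2.2⟩
      rw [if_pos h, if_pos h1, abs_one, ← div_eq_mul_inv, le_div_iff₀ (by positivity)]
      linarith
    · rw [if_neg h, abs_zero]
      split_ifs <;> positivity
  -- The mesh is so fine that the error on the rectangle is negligible against its energy.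
  obtain ⟨η, hη, hη'⟩ : ∃ η : ℝ, 0 < η ∧ ENNReal.ofReal (η ^ 2) * energy γ χ ≤ ε / 2 / 2 := by
    have h1 : Tendsto (fun η : ℝ => ENNReal.ofReal (η ^ 2) * energy γ χ) (𝓝[>] 0) (𝓝 0) := by
      have h2 : Tendsto (fun η : ℝ => ENNReal.ofReal (η ^ 2)) (𝓝[>] 0) (𝓝 0) := by
        have : Continuous fun η : ℝ => ENNReal.ofReal (η ^ 2) :=
          ENNReal.continuous_ofReal.comp (continuous_pow 2)
        have := (this.tendsto 0).mono_left (nhdsWithin_le_nhds (s := Set.Ioi 0))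
        simpa using this
      simpa using ENNReal.Tendsto.mul_const h2 (Or.inr hχE.ne)
    obtain ⟨η, h2, h3⟩ := ((h1.eventually (ge_mem_nhds hε4)).and self_mem_nhdsWithin).exists
    exact ⟨η, h3, h2⟩
  obtain ⟨c, hcc⟩ := exists_elemIntegrand_near (φ := φ) (r := n) (ha n) (hab n) (by positivity)
    (hc.mono (Set.prod_mono (hS n) (Set.subset_univ _))) hη
  refine ⟨c, ?_⟩
  calc energy γ (fun s z => elemIntegrand c s z - φ s z)
      ≤ energy γ (fun s z => η * χ s z + |ψ n s z|) := by
        refine energy_mono hγ hγ' fun s _ z => ?_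
        by_cases h : (s, z) ∈ Q n
        · have h1 := (hcc s z).1 h
          have h2 : χ s z = 1 := Set.indicator_of_mem h _
          refine h1.trans (le_trans ?_ (le_abs_self _))
          rw [h2, mul_one]
          linarith [abs_nonneg (ψ n s z)]
        · have h1 := (hcc s z).2 h
          have h2 : χ s z = 0 := Set.indicator_of_notMem h _
          have h3 : ψ n s z = φ s z := Set.indicator_of_mem h _
          rw [h1, h2, h3]
          simp
    _ ≤ 2 * energy γ (fun s z => η * χ s z) + 2 * energy γ (fun s z => |ψ n s z|) :=
        energy_add_le hγ hγ' (measurable_uncurry_const_mul η hχm) (hψm n).abs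
    _ = 2 * (ENNReal.ofReal (η ^ 2) * energy γ χ) + 2 * energy γ (ψ n) := by
        rw [energy_const_mul]
        simp only [energy, abs_abs]
    _ ≤ 2 * (ε / 2 / 2) + 2 * (ε / 2 / 2) := by gcongr
    _ = ε := by
        rw [ENNReal.mul_div_cancel (by simp) (by simp), ENNReal.add_halves]

/-! ### The derivatives of the heat kernel -/

/-- The half-line Fourier integral `∫₀^∞ exp (i x ξ) ξ^a exp (-t ξ^α) dξ`. The derivatives of the
heat kernel are real parts of such integrals. -/
def halfFourier (α t a x : ℝ) : ℂ :=
  ∫ ξ in Set.Ioi (0 : ℝ), Complex.exp (Complex.I * x * ξ) * ((ξ ^ a * Real.exp (-t * ξ ^ α) : ℝ) : ℂ)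

theorem norm_cexp_I_mul_mul (x ξ : ℝ) : ‖Complex.exp (Complex.I * x * ξ)‖ = 1 := by
  have : Complex.I * x * ξ = ((x * ξ : ℝ) : ℂ) * Complex.I := by push_cast; ring
  rw [this, Complex.norm_exp_ofReal_mul_I]

theorem integrableOn_halfFourier {α t a : ℝ} (hα : 0 < α) (ht : 0 < t) (ha : -1 < a) (x : ℝ) :
    IntegrableOn (fun ξ : ℝ => Complex.exp (Complex.I * x * ξ) *
      ((ξ ^ a * Real.exp (-t * ξ ^ α) : ℝ) : ℂ)) (Set.Ioi 0) := by
  have h1 := (integrableOn_rpow_mul_exp_neg_mul_rpow ha hα ht).ofReal (𝕜 := ℂ)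
  refine Integrable.bdd_mul h1 (c := 1) ?_ ?_
  · exact Continuous.aestronglyMeasurable (by fun_prop)
  · exact ae_of_all _ fun ξ => (norm_cexp_I_mul_mul x ξ).le

theorem norm_halfFourier_le (α t a x : ℝ) :
    ‖halfFourier α t a x‖ ≤ ∫ ξ in Set.Ioi (0 : ℝ), ξ ^ a * Real.exp (-t * ξ ^ α) := by
  refine (norm_integral_le_integral_norm _).trans (le_of_eq ?_)
  refine setIntegral_congr_fun measurableSet_Ioi fun ξ hξ => ?_
  have : (0 : ℝ) < ξ := hξ
  rw [norm_mul, norm_cexp_I_mul_mul, one_mul, Complex.norm_real, Real.norm_of_nonneg (by positivity)]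

/-- The integral over the line of a function with `f (-ξ) = conj (f ξ)`. -/
theorem integral_of_conj_symm {f : ℝ → ℂ} (hI : IntegrableOn f (Set.Ioi 0))
    (h : ∀ ξ ∈ Set.Ioi (0 : ℝ), f (-ξ) = (starRingEnd ℂ) (f ξ)) :
    Integrable f ∧ ∫ ξ, f ξ = ((2 * (∫ ξ in Set.Ioi (0 : ℝ), f ξ).re : ℝ) : ℂ) := by
  have e2 : ∫ ξ in Set.Iic (0 : ℝ), f ξ = (starRingEnd ℂ) (∫ ξ in Set.Ioi (0 : ℝ), f ξ) := by
    have h3 := integral_comp_neg_Ioi 0 f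
    rw [neg_zero] at h3
    rw [← h3, setIntegral_congr_fun measurableSet_Ioi h, integral_conj]
  have hI2 : IntegrableOn f (Set.Iic 0) := by
    have h4 : IntegrableOn (fun ξ => f (-ξ)) (Set.Ioi 0) := by
      refine IntegrableOn.congr_fun ?_ (fun ξ hξ => (h ξ hξ).symm) measurableSet_Ioi
      exact (Complex.conjLIE.toContinuousLinearEquiv.toContinuousLinearMap.integrable_comp hI)
    have h5 := (integrableOn_Iic_iff_integrableOn_Iio (μ := volume) (f := f) (b := 0)).2
    refine h5 ?_
    have h6 := (Measure.measurePreserving_neg (volume : Measure ℝ)).integrableOn_comp_preimage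
      (Homeomorph.neg ℝ).measurableEmbedding (f := f) (s := Set.Iio 0)
    have h7 : (fun ξ : ℝ => -ξ) ⁻¹' (Set.Iio 0) = Set.Ioi 0 := by ext; simp
    rw [← h6]
    change IntegrableOn _ ((fun ξ : ℝ => -ξ) ⁻¹' (Set.Iio 0))
    rw [h7]
    exact h4
  have hI : Integrable f := by
    have := hI.union hI2
    rwa [Set.union_comm, Set.Iic_union_Ioi, integrableOn_univ] at this
  refine ⟨hI, ?_⟩
  have h5 := integral_add_compl₀ measurableSet_Ioi.nullMeasurableSet (s := Set.Ioi (0 : ℝ)) hI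
  rw [Set.compl_Ioi, e2, Complex.add_conj] at h5
  exact h5.symm

theorem heatKernel_eq {α t : ℝ} (hα : 0 < α) (ht : 0 < t) (x : ℝ) :
    heatKernel α t x = Real.pi⁻¹ * (halfFourier α t 0 x).re := by
  set f : ℝ → ℂ := fun ξ => Complex.exp (Complex.I * (x : ℂ) * (ξ : ℂ) - ((t * |ξ| ^ α : ℝ) : ℂ))
    with hf
  have h1 : ∀ ξ ∈ Set.Ioi (0 : ℝ), f ξ = Complex.exp (Complex.I * x * ξ) *
      ((ξ ^ (0 : ℝ) * Real.exp (-t * ξ ^ α) : ℝ) : ℂ) := by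
    intro ξ hξ
    have hξ' : (0 : ℝ) < ξ := hξ
    simp only [hf]
    rw [abs_of_pos hξ', Real.rpow_zero, one_mul, Complex.ofReal_exp, ← Complex.exp_add]
    congr 1
    push_cast
    ring
  have h2 : ∀ ξ ∈ Set.Ioi (0 : ℝ), f (-ξ) = (starRingEnd ℂ) (f ξ) := by
    intro ξ hξ
    simp only [hf]
    rw [← Complex.exp_conj]
    congr 1
    simp only [abs_neg, map_sub, map_mul, Complex.conj_I, Complex.conj_ofReal]
    push_cast
    ring
  have hI1 : IntegrableOn f (Set.Ioi 0) :=
    (integrableOn_halfFourier hα ht (a := 0) (by norm_num) x).congr_fun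
      (fun ξ hξ => (h1 ξ hξ).symm) measurableSet_Ioi
  have e1 : ∫ ξ in Set.Ioi (0 : ℝ), f ξ = halfFourier α t 0 x :=
    setIntegral_congr_fun measurableSet_Ioi h1
  unfold heatKernel
  rw [(integral_of_conj_symm hI1 h2).2, e1]
  have : (2 * (Real.pi : ℂ))⁻¹ * ((2 * (halfFourier α t 0 x).re : ℝ) : ℂ) =
      ((Real.pi⁻¹ * (halfFourier α t 0 x).re : ℝ) : ℂ) := by
    push_cast
    have : (Real.pi : ℂ) ≠ 0 := by exact_mod_cast Real.pi_ne_zero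
    field_simp
  rw [this, Complex.ofReal_re]

theorem hasDerivAt_halfFourier {α t a : ℝ} (hα : 0 < α) (ht : 0 < t) (ha : -1 < a) (x : ℝ) :
    HasDerivAt (halfFourier α t a) (Complex.I * halfFourier α t (a + 1) x) x := by
  have h := hasDerivAt_integral_of_dominated_loc_of_deriv_le (𝕜 := ℝ)
    (μ := volume.restrict (Set.Ioi (0 : ℝ)))
    (F := fun (x : ℝ) (ξ : ℝ) => Complex.exp (Complex.I * x * ξ) *
      ((ξ ^ a * Real.exp (-t * ξ ^ α) : ℝ) : ℂ))
    (F' := fun (x : ℝ) (ξ : ℝ) => Complex.I * (Complex.exp (Complex.I * x * ξ) *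
      ((ξ ^ (a + 1) * Real.exp (-t * ξ ^ α) : ℝ) : ℂ)))
    (bound := fun ξ : ℝ => ξ ^ (a + 1) * Real.exp (-t * ξ ^ α))
    (x₀ := x) (s := Set.univ) univ_mem ?_ (integrableOn_halfFourier hα ht ha x) ?_ ?_
    (integrableOn_rpow_mul_exp_neg_mul_rpow (by linarith) hα ht) ?_
  · have h2 := h.2
    rw [integral_const_mul] at h2
    exact h2
  · exact Eventually.of_forall fun y => (integrableOn_halfFourier hα ht ha y).1
  · exact ((integrableOn_halfFourier hα ht (a := a + 1) (by linarith) x).const_mul Complex.I).1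
  · filter_upwards [self_mem_ae_restrict measurableSet_Ioi] with ξ hξ y _
    have : (0 : ℝ) < ξ := hξ
    rw [norm_mul, Complex.norm_I, one_mul, norm_mul, norm_cexp_I_mul_mul, one_mul,
      Complex.norm_real, Real.norm_of_nonneg (by positivity)]
  · filter_upwards [self_mem_ae_restrict measurableSet_Ioi] with ξ hξ y _
    have hξ' : (0 : ℝ) < ξ := hξ
    have h1 : HasDerivAt (fun y : ℝ => Complex.exp (Complex.I * y * ξ))
        (Complex.exp (Complex.I * y * ξ) * (Complex.I * 1 * ξ)) y := by
      have h2 : HasDerivAt (fun y : ℝ => (y : ℂ)) 1 y := Complex.ofRealCLM.hasDerivAt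
      exact ((h2.const_mul Complex.I).mul_const (ξ : ℂ)).cexp
    have h3 := h1.mul_const ((ξ ^ a * Real.exp (-t * ξ ^ α) : ℝ) : ℂ)
    convert! h3 using 1
    rw [Real.rpow_add_one hξ'.ne']
    push_cast
    ring

/-- The `k`-th derivative of the heat kernel in space. -/
def heatDeriv (α : ℝ) (k : ℕ) (t x : ℝ) : ℝ := iteratedDeriv k (heatKernel α t) x

theorem heatDeriv_eq {α t : ℝ} (hα : 0 < α) (ht : 0 < t) (k : ℕ) (x : ℝ) :
    heatDeriv α k t x = Real.pi⁻¹ * (Complex.I ^ k * halfFourier α t k x).re := by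
  induction k generalizing x with
  | zero => simp [heatDeriv, heatKernel_eq hα ht]
  | succ k ih =>
    have h1 : iteratedDeriv k (heatKernel α t) =
        fun x => Real.pi⁻¹ * (Complex.I ^ k * halfFourier α t k x).re := funext ih
    rw [heatDeriv, iteratedDeriv_succ, h1]
    have h2 := (hasDerivAt_halfFourier hα ht (a := k) (by
      have : (0 : ℝ) ≤ k := k.cast_nonneg
      linarith) x).const_mul (Complex.I ^ k)
    have h3 := Complex.reCLM.hasFDerivAt.comp_hasDerivAt x h2
    have h4 := (h3.const_mul Real.pi⁻¹).deriv
    simp only [Function.comp_def, Complex.reCLM_apply] at h4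
    rw [h4, pow_succ, mul_assoc]
    push_cast
    rfl

theorem hasDerivAt_heatDeriv {α t : ℝ} (hα : 0 < α) (ht : 0 < t) (k : ℕ) (x : ℝ) :
    HasDerivAt (heatDeriv α k t) (heatDeriv α (k + 1) t x) x := by
  have h1 : heatDeriv α k t = fun x => Real.pi⁻¹ * (Complex.I ^ k * halfFourier α t k x).re :=
    funext (heatDeriv_eq hα ht k)
  have h2 := (hasDerivAt_halfFourier hα ht (a := k) (by
      have : (0 : ℝ) ≤ k := k.cast_nonneg
      linarith) x).const_mul (Complex.I ^ k)
  have h3 := Complex.reCLM.hasFDerivAt.comp_hasDerivAt x h2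
  have h4 := h3.const_mul Real.pi⁻¹
  have h5 : heatDeriv α (k + 1) t x = deriv (heatDeriv α k t) x := by
    rw [heatDeriv, iteratedDeriv_succ]; rfl
  rw [h5]
  have h6 : HasDerivAt (heatDeriv α k t) (Real.pi⁻¹ *
      Complex.reCLM (Complex.I ^ k * (Complex.I * halfFourier α t (k + 1) x))) x := by
    rw [h1]; exact h4
  rw [h6.deriv]
  exact h6

theorem continuous_heatDeriv {α t : ℝ} (hα : 0 < α) (ht : 0 < t) (k : ℕ) :
    Continuous (heatDeriv α k t) :=
  continuous_iff_continuousAt.2 fun x => (hasDerivAt_heatDeriv hα ht k x).continuousAt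

/-- Self-similarity: `G(t, x) = t^(-1/α) G(1, t^(-1/α) x)`, differentiated `k` times. -/
theorem heatDeriv_scaling {α t : ℝ} (hα : 0 < α) (ht : 0 < t) (k : ℕ) (x : ℝ) :
    heatDeriv α k t x =
      (t ^ (-(1 / α))) ^ (k + 1) * heatDeriv α k 1 (t ^ (-(1 / α)) * x) := by
  set c : ℝ := t ^ (-(1 / α)) with hc
  have hc0 : 0 < c := by positivity
  have hcα : c ^ α * t = 1 := by
    rw [hc, ← Real.rpow_mul ht.le, show -(1 / α) * α = -1 by field_simp, Real.rpow_neg_one,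
      inv_mul_cancel₀ ht.ne']
  have key : halfFourier α t k x = ((c ^ (k + 1) : ℝ) : ℂ) * halfFourier α 1 k (c * x) := by
    have h := integral_comp_mul_left_Ioi (fun ξ : ℝ => Complex.exp (Complex.I * x * ξ) *
      ((ξ ^ (k : ℝ) * Real.exp (-t * ξ ^ α) : ℝ) : ℂ)) 0 hc0
    rw [mul_zero] at h
    have h2 : halfFourier α t k x = c • ∫ ξ in Set.Ioi (0 : ℝ),
        Complex.exp (Complex.I * x * ((c * ξ : ℝ) : ℂ)) *
        (((c * ξ) ^ (k : ℝ) * Real.exp (-t * (c * ξ) ^ α) : ℝ) : ℂ) := by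
      rw [h, smul_smul, mul_inv_cancel₀ hc0.ne', one_smul]; rfl
    rw [h2, halfFourier, ← integral_const_mul, ← integral_smul]
    refine setIntegral_congr_fun measurableSet_Ioi fun ξ hξ => ?_
    have hξ' : (0 : ℝ) < ξ := hξ
    have h3 : -t * (c * ξ) ^ α = -1 * ξ ^ α := by
      rw [Real.mul_rpow hc0.le hξ'.le]
      linear_combination (-(ξ ^ α)) * hcα
    rw [h3, Real.rpow_natCast, Real.rpow_natCast, mul_pow, Complex.real_smul]
    push_cast
    ring_nf
  rw [heatDeriv_eq hα ht, heatDeriv_eq hα one_pos, key]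
  have : Complex.I ^ k * (((c ^ (k + 1) : ℝ) : ℂ) * halfFourier α 1 k (c * x)) =
      ((c ^ (k + 1) : ℝ) : ℂ) * (Complex.I ^ k * halfFourier α 1 k (c * x)) := by ring
  rw [this, Complex.re_ofReal_mul]
  ring

/-- Integration by parts in `halfFourier`: a factor `x` lowers the powers of `ξ`. The boundary term
`0 ^ a` is present only for `a = 0`. -/
theorem mul_halfFourier {α a : ℝ} (hα : 0 < α) (ha : 0 ≤ a) (x : ℝ) :
    Complex.I * x * halfFourier α 1 a x = -((0 : ℝ) ^ a : ℝ) -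
      (a * halfFourier α 1 (a - 1) x - α * halfFourier α 1 (a + α - 1) x) := by
  have hu : ContinuousWithinAt (fun ξ : ℝ => Complex.exp (Complex.I * x * ξ) *
      ((ξ ^ a * Real.exp (-1 * ξ ^ α) : ℝ) : ℂ)) (Set.Ici 0) 0 := by
    refine ContinuousAt.continuousWithinAt ?_
    have h1 : ContinuousAt (fun ξ : ℝ => ξ ^ a * Real.exp (-1 * ξ ^ α)) 0 := by
      have := Real.continuousAt_rpow_const 0 a (Or.inr ha)
      have := Real.continuousAt_rpow_const 0 α (Or.inr hα.le)
      fun_prop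
    exact ContinuousAt.mul (by fun_prop) (Complex.continuous_ofReal.continuousAt.comp h1)
  have hderiv : ∀ ξ ∈ Set.Ioi (0 : ℝ), HasDerivAt (fun ξ : ℝ => Complex.exp (Complex.I * x * ξ) *
      ((ξ ^ a * Real.exp (-1 * ξ ^ α) : ℝ) : ℂ))
      (Complex.I * x * (Complex.exp (Complex.I * x * ξ) *
        ((ξ ^ a * Real.exp (-1 * ξ ^ α) : ℝ) : ℂ)) +
      (a * (Complex.exp (Complex.I * x * ξ) *
        ((ξ ^ (a - 1) * Real.exp (-1 * ξ ^ α) : ℝ) : ℂ)) -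
      α * (Complex.exp (Complex.I * x * ξ) *
        ((ξ ^ (a + α - 1) * Real.exp (-1 * ξ ^ α) : ℝ) : ℂ)))) ξ := by
    intro ξ hξ
    have hξ' : (0 : ℝ) < ξ := hξ
    have h1 : HasDerivAt (fun y : ℝ => Complex.exp (Complex.I * x * y))
        (Complex.exp (Complex.I * x * ξ) * (Complex.I * x * 1)) ξ := by
      have h2 : HasDerivAt (fun y : ℝ => (y : ℂ)) 1 ξ := Complex.ofRealCLM.hasDerivAt
      exact (h2.const_mul (Complex.I * x)).cexp
    have h2 : HasDerivAt (fun ξ : ℝ => ξ ^ a * Real.exp (-1 * ξ ^ α))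
        (a * ξ ^ (a - 1) * Real.exp (-1 * ξ ^ α) +
          ξ ^ a * (Real.exp (-1 * ξ ^ α) * (-1 * (α * ξ ^ (α - 1))))) ξ :=
      (Real.hasDerivAt_rpow_const (Or.inl hξ'.ne')).mul
        (((Real.hasDerivAt_rpow_const (Or.inl hξ'.ne')).const_mul (-1)).exp)
    have h3 := h1.mul h2.ofReal_comp
    convert! h3 using 1
    have h4 : ξ ^ (a + α - 1) = ξ ^ a * ξ ^ (α - 1) := by
      rw [← Real.rpow_add hξ']; ring_nf
    rw [h4]
    push_cast
    ring
  have i1 := (integrableOn_halfFourier hα one_pos (a := a) (by linarith) x).const_mul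
    (Complex.I * x)
  have i2 : IntegrableOn (fun ξ : ℝ => a * (Complex.exp (Complex.I * x * ξ) *
        ((ξ ^ (a - 1) * Real.exp (-1 * ξ ^ α) : ℝ) : ℂ))) (Set.Ioi 0) := by
    rcases ha.eq_or_lt with rfl | ha'
    · simp
    · exact (integrableOn_halfFourier hα one_pos (a := a - 1) (by linarith) x).const_mul (a : ℂ)
  have i3 := (integrableOn_halfFourier hα one_pos (a := a + α - 1) (by linarith) x).const_mul
    (α : ℂ)
  have hlim : Tendsto (fun ξ : ℝ => Complex.exp (Complex.I * x * ξ) *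
      ((ξ ^ a * Real.exp (-1 * ξ ^ α) : ℝ) : ℂ)) atTop (𝓝 0) := by
    rw [tendsto_zero_iff_norm_tendsto_zero]
    have h1 : Tendsto (fun ξ : ℝ => ξ ^ (a / α) * Real.exp (-1 * ξ)) atTop (𝓝 0) :=
      tendsto_rpow_mul_exp_neg_mul_atTop_nhds_zero _ _ one_pos
    refine (h1.comp (tendsto_rpow_atTop hα)).congr' ?_
    filter_upwards [eventually_gt_atTop 0] with ξ hξ
    rw [norm_mul, norm_cexp_I_mul_mul, one_mul, Complex.norm_real,
      Real.norm_of_nonneg (by positivity), Function.comp_apply, ← Real.rpow_mul hξ.le]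
    congr 2
    field_simp
  have h := integral_Ioi_of_hasDerivAt_of_tendsto hu hderiv (i1.add (i2.sub i3)) hlim
  have e : ∫ ξ in Set.Ioi (0 : ℝ), (Complex.I * x * (Complex.exp (Complex.I * x * ξ) *
        ((ξ ^ a * Real.exp (-1 * ξ ^ α) : ℝ) : ℂ)) +
      (a * (Complex.exp (Complex.I * x * ξ) *
        ((ξ ^ (a - 1) * Real.exp (-1 * ξ ^ α) : ℝ) : ℂ)) -
      α * (Complex.exp (Complex.I * x * ξ) *
        ((ξ ^ (a + α - 1) * Real.exp (-1 * ξ ^ α) : ℝ) : ℂ)))) =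
      Complex.I * x * halfFourier α 1 a x +
      (a * halfFourier α 1 (a - 1) x - α * halfFourier α 1 (a + α - 1) x) := by
    have i23 : IntegrableOn (fun ξ : ℝ => a * (Complex.exp (Complex.I * x * ξ) *
        ((ξ ^ (a - 1) * Real.exp (-1 * ξ ^ α) : ℝ) : ℂ)) -
      α * (Complex.exp (Complex.I * x * ξ) *
        ((ξ ^ (a + α - 1) * Real.exp (-1 * ξ ^ α) : ℝ) : ℂ))) (Set.Ioi 0) := i2.sub i3
    rw [integral_add i1 i23, integral_sub i2 i3, integral_const_mul, integral_const_mul,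
      integral_const_mul]
    rfl
  rw [e] at h
  have h0 : Complex.exp (Complex.I * x * ((0 : ℝ) : ℂ)) *
      (((0 : ℝ) ^ a * Real.exp (-1 * (0 : ℝ) ^ α) : ℝ) : ℂ) = ((0 : ℝ) ^ a : ℝ) := by
    rw [Real.zero_rpow hα.ne']
    simp
  rw [h0] at h
  linear_combination h

theorem exists_abs_mul_halfFourier_le {α a : ℝ} (hα : 0 < α) (ha : 0 ≤ a) :
    ∃ C, ∀ x, |x| * ‖halfFourier α 1 a x‖ ≤ C := by
  refine ⟨|(0 : ℝ) ^ a| + (a * (∫ ξ in Set.Ioi (0 : ℝ), ξ ^ (a - 1) * Real.exp (-1 * ξ ^ α)) +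
    α * ∫ ξ in Set.Ioi (0 : ℝ), ξ ^ (a + α - 1) * Real.exp (-1 * ξ ^ α)), fun x => ?_⟩
  have h1 : |x| * ‖halfFourier α 1 a x‖ = ‖Complex.I * x * halfFourier α 1 a x‖ := by
    simp
  rw [h1, mul_halfFourier hα ha]
  refine (norm_sub_le _ _).trans (add_le_add ?_ ((norm_sub_le _ _).trans (add_le_add ?_ ?_)))
  · rw [norm_neg, Complex.norm_real, Real.norm_eq_abs]
  · rw [norm_mul, Complex.norm_real, Real.norm_of_nonneg ha]
    gcongr
    exact norm_halfFourier_le _ _ _ _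
  · rw [norm_mul, Complex.norm_real, Real.norm_of_nonneg hα.le]
    gcongr
    exact norm_halfFourier_le _ _ _ _

theorem exists_sq_mul_halfFourier_le {α a : ℝ} (hα : 0 < α) (ha : 1 ≤ a) :
    ∃ C, ∀ x, x ^ 2 * ‖halfFourier α 1 a x‖ ≤ C := by
  obtain ⟨C₁, h₁⟩ := exists_abs_mul_halfFourier_le hα (a := a - 1) (by linarith)
  obtain ⟨C₂, h₂⟩ := exists_abs_mul_halfFourier_le hα (a := a + α - 1) (by linarith)
  refine ⟨a * C₁ + α * C₂, fun x => ?_⟩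
  have h1 : x ^ 2 * ‖halfFourier α 1 a x‖ = |x| * ‖Complex.I * x * halfFourier α 1 a x‖ := by
    simp only [norm_mul, Complex.norm_I, one_mul, Complex.norm_real, Real.norm_eq_abs]
    rw [← mul_assoc, abs_mul_abs_self, sq]
  rw [h1, mul_halfFourier hα (by linarith), Real.zero_rpow (by linarith)]
  have h2 : ‖-((0 : ℝ) : ℂ) - (a * halfFourier α 1 (a - 1) x -
      α * halfFourier α 1 (a + α - 1) x)‖ ≤
      a * ‖halfFourier α 1 (a - 1) x‖ + α * ‖halfFourier α 1 (a + α - 1) x‖ := by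
    rw [Complex.ofReal_zero, neg_zero, zero_sub, norm_neg]
    refine (norm_sub_le _ _).trans (le_of_eq ?_)
    rw [norm_mul, norm_mul, Complex.norm_real, Complex.norm_real,
      Real.norm_of_nonneg (by linarith : 0 ≤ a), Real.norm_of_nonneg hα.le]
  calc _ ≤ |x| * (a * ‖halfFourier α 1 (a - 1) x‖ + α * ‖halfFourier α 1 (a + α - 1) x‖) := by
        gcongr
    _ = a * (|x| * ‖halfFourier α 1 (a - 1) x‖) + α * (|x| * ‖halfFourier α 1 (a + α - 1) x‖) := by
        ring
    _ ≤ a * C₁ + α * C₂ := by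
        gcongr
        · exact h₁ x
        · exact h₂ x

theorem abs_heatDeriv_le {α : ℝ} (hα : 0 < α) (k : ℕ) (x : ℝ) :
    |heatDeriv α k 1 x| ≤ ‖halfFourier α 1 k x‖ := by
  rw [heatDeriv_eq hα one_pos, abs_mul, abs_of_pos (by have := Real.pi_pos; positivity)]
  have h1 : |(Complex.I ^ k * halfFourier α 1 k x).re| ≤ ‖halfFourier α 1 k x‖ := by
    refine (Complex.abs_re_le_norm _).trans (le_of_eq ?_)
    rw [norm_mul, norm_pow, Complex.norm_I, one_pow, one_mul]
  have h2 : Real.pi⁻¹ ≤ 1 := inv_le_one_of_one_le₀ (by linarith [Real.pi_gt_three])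
  calc _ ≤ 1 * ‖halfFourier α 1 k x‖ := by gcongr
    _ = _ := one_mul _

/-- All derivatives of the heat kernel are `O(1 / (1 + |x|))`. For the kernel itself this is weaker
than the true decay, but it suffices for finite energy. -/
theorem exists_heatDeriv_le {α : ℝ} (hα : 0 < α) (k : ℕ) :
    ∃ C, ∀ x, |heatDeriv α k 1 x| ≤ C * (1 + |x|)⁻¹ := by
  obtain ⟨C, hC⟩ := exists_abs_mul_halfFourier_le hα (a := k) k.cast_nonneg
  refine ⟨(∫ ξ in Set.Ioi (0 : ℝ), ξ ^ (k : ℝ) * Real.exp (-1 * ξ ^ α)) + C, fun x => ?_⟩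
  rw [← div_eq_mul_inv, le_div_iff₀ (by positivity)]
  have h1 := norm_halfFourier_le α 1 k x
  have h2 := hC x
  have h3 := abs_heatDeriv_le hα k x
  nlinarith [abs_nonneg x]

/-- The derivatives of positive order decay quadratically, for every `α`: the boundary term of the
first integration by parts vanishes, and a second one is possible. -/
theorem exists_heatDeriv_succ_le {α : ℝ} (hα : 0 < α) (k : ℕ) :
    ∃ C, ∀ x, |heatDeriv α (k + 1) 1 x| ≤ C * (1 + x ^ 2)⁻¹ := by
  obtain ⟨C, hC⟩ := exists_sq_mul_halfFourier_le hα (a := ((k + 1 : ℕ) : ℝ)) (by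
    push_cast; linarith [(k.cast_nonneg : (0 : ℝ) ≤ k)])
  refine ⟨(∫ ξ in Set.Ioi (0 : ℝ), ξ ^ ((k + 1 : ℕ) : ℝ) * Real.exp (-1 * ξ ^ α)) + C, fun x => ?_⟩
  rw [← div_eq_mul_inv, le_div_iff₀ (by positivity)]
  have h1 := norm_halfFourier_le α 1 ((k + 1 : ℕ) : ℝ) x
  have h2 := hC x
  have h3 := abs_heatDeriv_le hα (k + 1) x
  nlinarith [sq_nonneg x]

/-! ### The energy of the derivatives of the heat kernel -/

theorem lintegral_comp_mul_left {c : ℝ} (hc : 0 < c) {f : ℝ → ℝ≥0∞} (hf : Measurable f) :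
    ∫⁻ y, f (c * y) = ENNReal.ofReal c⁻¹ * ∫⁻ y, f y := by
  have h1 := Real.map_volume_mul_left hc.ne'
  rw [← lintegral_map hf (measurable_const_mul c), h1, lintegral_smul_measure,
    abs_of_pos (inv_pos.2 hc), smul_eq_mul]

/-- The scaling of the energy, from the homogeneity of the Riesz kernel. -/
theorem spatialEnergy_comp {γ : ℝ} {g : ℝ → ℝ}
    (hg : Measurable g) {c : ℝ} (hc : 0 < c) (x : ℝ) :
    spatialEnergy γ (fun z => g (c * (x - z))) =
      ENNReal.ofReal (c ^ (-1 - 4 * γ)) * spatialEnergy γ g := by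
  have hK : ∀ w, rieszKernel γ w = c ^ (1 - 4 * γ) * rieszKernel γ (c * w) := by
    intro w
    unfold rieszKernel
    rw [abs_mul, abs_of_pos hc, Real.mul_rpow hc.le (abs_nonneg _)]
    have : c ^ (1 - 4 * γ) * c ^ (4 * γ - 1) = 1 := by
      rw [← Real.rpow_add hc]; simp
    linear_combination (-(Real.Gamma (1 / 2 - 2 * γ) /
      (√Real.pi * 2 ^ (4 * γ) * Real.Gamma (2 * γ)) * |w| ^ (4 * γ - 1))) * this
  have hKneg : ∀ w, rieszKernel γ (-w) = rieszKernel γ w := by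
    intro w; unfold rieszKernel; rw [abs_neg]
  have hin : ∀ y : ℝ, ∫⁻ z : ℝ, ENNReal.ofReal (|g (c * y)| * rieszKernel γ (y - z) * |g (c * z)|)
      = ENNReal.ofReal (c ^ (1 - 4 * γ)) * (ENNReal.ofReal c⁻¹ *
        ∫⁻ z : ℝ, ENNReal.ofReal (|g (c * y)| * rieszKernel γ (c * y - z) * |g z|)) := by
    intro y
    rw [← lintegral_comp_mul_left hc (by fun_prop), ← lintegral_const_mul _ (by fun_prop)]
    refine lintegral_congr fun z => ?_
    rw [← ENNReal.ofReal_mul (by positivity), hK, mul_sub]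
    congr 1; ring
  have hshift : spatialEnergy γ (fun z => g (c * (x - z))) =
      ∫⁻ y : ℝ, ∫⁻ z : ℝ, ENNReal.ofReal (|g (c * y)| * rieszKernel γ (y - z) * |g (c * z)|) := by
    unfold spatialEnergy
    rw [← lintegral_sub_left_eq_self (fun y => ∫⁻ z : ℝ,
      ENNReal.ofReal (|g (c * y)| * rieszKernel γ (y - z) * |g (c * z)|)) x]
    refine lintegral_congr fun y => ?_
    rw [← lintegral_sub_left_eq_self (fun z =>
      ENNReal.ofReal (|g (c * (x - y))| * rieszKernel γ (x - y - z) * |g (c * z)|)) x]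
    refine lintegral_congr fun z => ?_
    rw [← hKneg, show -(y - z) = x - y - (x - z) by ring]
  have hm : Measurable fun y : ℝ =>
      ∫⁻ z : ℝ, ENNReal.ofReal (|g y| * rieszKernel γ (y - z) * |g z|) :=
    Measurable.lintegral_prod_right (f := fun y z : ℝ =>
      ENNReal.ofReal (|g y| * rieszKernel γ (y - z) * |g z|)) (by unfold Function.uncurry; fun_prop)
  rw [hshift, lintegral_congr hin, lintegral_const_mul' _ _ ENNReal.ofReal_ne_top,
    lintegral_const_mul' _ _ ENNReal.ofReal_ne_top,
    lintegral_comp_mul_left hc hm, ← mul_assoc, ← mul_assoc,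
    ← ENNReal.ofReal_mul (by positivity), ← ENNReal.ofReal_mul (by positivity)]
  unfold spatialEnergy
  congr 2
  rw [← Real.rpow_neg_one, ← Real.rpow_add hc, ← Real.rpow_add hc]
  congr 1
  ring

/-- The energy of the `k`-th derivative of the heat kernel at time one. -/
def heatEnergy (α γ : ℝ) (k : ℕ) : ℝ≥0∞ := spatialEnergy γ (heatDeriv α k 1)

theorem heatEnergy_lt_top {α γ : ℝ} (hα : 0 < α) (hγ : 0 < γ) (hγ' : γ < 1 / 4) (k : ℕ) :
    heatEnergy α γ k < ∞ := by
  obtain ⟨C, hC⟩ := exists_heatDeriv_le hα k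
  exact spatialEnergy_lt_top hγ hγ' hC

theorem spatialEnergy_heatDeriv {α γ t : ℝ} (hα : 0 < α)
    (ht : 0 < t) (k : ℕ) (x : ℝ) :
    spatialEnergy γ (fun z => heatDeriv α k t (x - z)) =
      ENNReal.ofReal (t ^ (-((1 - 4 * γ + 2 * k) / α))) * heatEnergy α γ k := by
  have h1 : (fun z => heatDeriv α k t (x - z)) = fun z => (t ^ (-(1 / α))) ^ (k + 1) *
      heatDeriv α k 1 (t ^ (-(1 / α)) * (x - z)) := funext fun z => heatDeriv_scaling hα ht k _
  have hc : 0 < t ^ (-(1 / α)) := by positivity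
  rw [h1, spatialEnergy_const_mul, spatialEnergy_comp
    (continuous_heatDeriv hα one_pos k).measurable hc, ← mul_assoc, heatEnergy,
    ← ENNReal.ofReal_mul (by positivity)]
  congr 2
  rw [← pow_mul, ← Real.rpow_natCast, ← Real.rpow_add hc, ← Real.rpow_mul ht.le]
  congr 1
  push_cast
  field_simp
  ring

section

/-! ### The spectral representation of the norm of integrands -/

open scoped FourierTransform

/-- The multiplication formula for the Fourier transform. -/
theorem integral_fourier_mul_eq {f g : ℝ → ℂ} (hf : Integrable f) (hg : Integrable g) :
    ∫ ξ, 𝓕 f ξ * g ξ = ∫ x, f x * 𝓕 g x := by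
  simpa using! VectorFourier.integral_fourierIntegral_smul_eq_flip (L := innerₗ ℝ)
    Real.continuous_fourierChar continuous_inner hf hg

/-- Plancherel's theorem for the classical Fourier transform on `L¹ ∩ L²`. The classical transform
and the one on `L²` agree because they agree as distributions. -/
theorem eLpNorm_fourier_eq {f : ℝ → ℂ} (h1 : Integrable f) (h2 : MemLp f 2) :
    eLpNorm (𝓕 f) 2 volume = eLpNorm f 2 volume := by
  set F : Lp ℂ 2 (volume : Measure ℝ) := h2.toLp f with hF
  have hFf : F =ᵐ[volume] f := h2.coeFn_toLp
  have hcont : Continuous (𝓕 f) := by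
    exact VectorFourier.fourierIntegral_continuous Real.continuous_fourierChar
      (L := innerₗ ℝ) continuous_inner h1
  obtain ⟨Fh, hFh⟩ : ∃ Fh : Lp ℂ 2 (volume : Measure ℝ), 𝓕 F = Fh := ⟨_, rfl⟩
  have hdist := Lp.fourier_toTemperedDistribution_eq F
  have hnorm := Lp.norm_fourier_eq F
  rw [hFh] at hdist hnorm
  have hpair : ∀ G : SchwartzMap ℝ ℂ, ∫ x, G x * Fh x = ∫ x, G x * 𝓕 f x := by
    intro G
    have h3 := congrArg (fun T => T G) hdist
    simp only [TemperedDistribution.fourier_apply, Lp.toTemperedDistribution_apply,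
      smul_eq_mul] at h3
    rw [← h3, ← integral_fourier_mul_eq G.integrable h1]
    refine integral_congr_ae ?_
    filter_upwards [hFf] with x hx
    rw [hx, SchwartzMap.fourier_coe]
  have hae : Fh =ᵐ[volume] 𝓕 f := by
    generalize 𝓕 f = fh at hcont hpair
    have hloc : LocallyIntegrable Fh (volume : Measure ℝ) :=
      (Lp.memLp Fh).locallyIntegrable one_le_two
    refine ae_eq_of_integral_contDiff_smul_eq hloc hcont.locallyIntegrable ?_
    intro g hg hgs
    have hgs' : HasCompactSupport (Complex.ofRealCLM ∘ g) := hgs.comp_left rfl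
    have hg' : ContDiff ℝ (⊤ : ℕ∞) (Complex.ofRealCLM ∘ g) := Complex.ofRealCLM.contDiff.comp hg
    simpa using hpair (hgs'.toSchwartzMap hg')
  rw [← eLpNorm_congr_ae hae, ← eLpNorm_congr_ae hFf]
  rw [Lp.norm_def, Lp.norm_def] at hnorm
  exact (ENNReal.toReal_eq_toReal_iff' (Lp.eLpNorm_ne_top _) (Lp.eLpNorm_ne_top _)).1 hnorm

/-- The Fourier transform, without the damping factor, of a combination
`y ↦ ∑ i, aᵢ ∂^{kᵢ} G(xᵢ - y)` of derivatives of the heat kernel. -/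
def symbol {ι : Type*} (I : Finset ι) (a : ι → ℝ) (k : ι → ℕ) (x : ι → ℝ) (ξ : ℝ) : ℂ :=
  ∑ i ∈ I, a i * ((Complex.I * ξ) ^ k i * Complex.exp (Complex.I * x i * ξ))

theorem continuous_symbol {ι : Type*} (I : Finset ι) (a : ι → ℝ) (k : ι → ℕ) (x : ι → ℝ) :
    Continuous (symbol I a k x) := by
  unfold symbol
  fun_prop

/-- The derivatives of the heat kernel as Fourier integrals over the whole line. -/
theorem integrable_and_heatDeriv_eq {α t : ℝ} (hα : 0 < α) (ht : 0 < t) (k : ℕ) (x : ℝ) :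
    Integrable (fun ξ : ℝ => (Complex.I * ξ) ^ k * Complex.exp (Complex.I * x * ξ) *
      (Real.exp (-t * |ξ| ^ α) : ℂ)) ∧
    ((heatDeriv α k t x : ℝ) : ℂ) = (2 * Real.pi : ℂ)⁻¹ *
      ∫ ξ : ℝ, (Complex.I * ξ) ^ k * Complex.exp (Complex.I * x * ξ) *
        (Real.exp (-t * |ξ| ^ α) : ℂ) := by
  set f : ℝ → ℂ := fun ξ => (Complex.I * ξ) ^ k * Complex.exp (Complex.I * x * ξ) *
        (Real.exp (-t * |ξ| ^ α) : ℂ) with hf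
  have h1 : ∀ ξ ∈ Set.Ioi (0 : ℝ), f ξ = Complex.I ^ k * (Complex.exp (Complex.I * x * ξ) *
      ((ξ ^ (k : ℝ) * Real.exp (-t * ξ ^ α) : ℝ) : ℂ)) := by
    intro ξ hξ
    have hξ' : (0 : ℝ) < ξ := hξ
    simp only [hf]
    rw [abs_of_pos hξ', Real.rpow_natCast, mul_pow]
    push_cast
    ring
  have h2 : ∀ ξ ∈ Set.Ioi (0 : ℝ), f (-ξ) = (starRingEnd ℂ) (f ξ) := by
    intro ξ hξ
    simp only [hf]
    rw [map_mul, map_mul, map_pow, ← Complex.exp_conj, Complex.conj_ofReal, abs_neg]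
    congr 3
    · simp
    · simp
  have hI1 : IntegrableOn f (Set.Ioi 0) :=
    IntegrableOn.congr_fun ((integrableOn_halfFourier hα ht (a := k) (by
      linarith [(k.cast_nonneg : (0 : ℝ) ≤ k)]) x).const_mul (Complex.I ^ k))
      (fun ξ hξ => (h1 ξ hξ).symm) measurableSet_Ioi
  have e1 : ∫ ξ in Set.Ioi (0 : ℝ), f ξ = Complex.I ^ k * halfFourier α t k x := by
    rw [setIntegral_congr_fun measurableSet_Ioi h1, integral_const_mul]
    rfl
  obtain ⟨h3, h4⟩ := integral_of_conj_symm hI1 h2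
  refine ⟨h3, ?_⟩
  rw [h4, e1, heatDeriv_eq hα ht]
  push_cast
  have : (Real.pi : ℂ) ≠ 0 := by exact_mod_cast Real.pi_ne_zero
  field_simp

variable {ι : Type*} (I : Finset ι) (a : ι → ℝ) (k : ι → ℕ) (x : ι → ℝ)

theorem integrable_symbol_mul_exp {α t : ℝ} (hα : 0 < α) (ht : 0 < t) :
    Integrable (fun v : ℝ => symbol I a k x (2 * Real.pi * v) *
      (Real.exp (-t * |2 * Real.pi * v| ^ α) : ℂ)) := by
  have h1 : Integrable (fun ξ : ℝ => symbol I a k x ξ * (Real.exp (-t * |ξ| ^ α) : ℂ)) := by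
    unfold symbol
    simp_rw [Finset.sum_mul, mul_assoc]
    refine integrable_finsetSum _ fun i _ => Integrable.const_mul ?_ _
    have := (integrable_and_heatDeriv_eq hα ht (k i) (x i)).1
    simpa only [mul_assoc] using this
  simpa using h1.comp_mul_left' (R := 2 * Real.pi) (by have := Real.pi_pos; positivity)

theorem sum_heatDeriv_eq_fourier {α t : ℝ} (hα : 0 < α) (ht : 0 < t) (y : ℝ) :
    ((∑ i ∈ I, a i * heatDeriv α (k i) t (x i - y) : ℝ) : ℂ) =
      𝓕 (fun v : ℝ => symbol I a k x (2 * Real.pi * v) *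
        (Real.exp (-t * |2 * Real.pi * v| ^ α) : ℂ)) y := by
  have hpi := Real.pi_pos
  have h0 := Measure.integral_comp_mul_left (fun ξ : ℝ => Complex.exp (-(Complex.I * y * ξ)) *
    (symbol I a k x ξ * (Real.exp (-t * |ξ| ^ α) : ℂ))) (2 * Real.pi)
  rw [Real.fourier_real_eq_integral_exp_smul]
  have h1 : ∀ v : ℝ, Complex.exp (((-2 * Real.pi * v * y : ℝ) : ℂ) * Complex.I) •
      (symbol I a k x (2 * Real.pi * v) * (Real.exp (-t * |2 * Real.pi * v| ^ α) : ℂ)) =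
      Complex.exp (-(Complex.I * y * ((2 * Real.pi * v : ℝ) : ℂ))) *
      (symbol I a k x (2 * Real.pi * v) * (Real.exp (-t * |2 * Real.pi * v| ^ α) : ℂ)) := by
    intro v
    rw [smul_eq_mul]
    congr 2
    push_cast
    ring
  simp_rw [h1]
  rw [h0, abs_of_pos (by positivity)]
  have h2 : ∀ ξ : ℝ, Complex.exp (-(Complex.I * y * ξ)) *
      (symbol I a k x ξ * (Real.exp (-t * |ξ| ^ α) : ℂ)) =
      ∑ i ∈ I, (a i : ℂ) * ((Complex.I * ξ) ^ k i *
        Complex.exp (Complex.I * ((x i - y : ℝ) : ℂ) * ξ) * (Real.exp (-t * |ξ| ^ α) : ℂ)) := by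
    intro ξ
    unfold symbol
    rw [Finset.sum_mul, Finset.mul_sum]
    refine Finset.sum_congr rfl fun i _ => ?_
    have : Complex.exp (Complex.I * ((x i - y : ℝ) : ℂ) * ξ) =
        Complex.exp (-(Complex.I * y * ξ)) * Complex.exp (Complex.I * x i * ξ) := by
      rw [← Complex.exp_add]; congr 1; push_cast; ring
    rw [this]
    ring
  simp_rw [h2]
  rw [integral_finsetSum _ fun i _ =>
    (integrable_and_heatDeriv_eq hα ht (k i) (x i - y)).1.const_mul _]
  simp_rw [integral_const_mul]
  push_cast
  rw [Finset.smul_sum]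
  refine Finset.sum_congr rfl fun i _ => ?_
  have h3 := (integrable_and_heatDeriv_eq hα ht (k i) (x i - y)).2
  push_cast at h3
  rw [h3, Complex.real_smul]
  push_cast
  ring

theorem fourier_gaussian_shift {u : ℝ} (hu : 0 < u) (w v : ℝ) :
    𝓕 (fun y : ℝ => (Real.exp (-2 * u * (y - w) ^ 2) : ℂ)) v =
      Complex.exp (((-2 * Real.pi * v * w : ℝ) : ℂ) * Complex.I) *
        ((√(Real.pi / (2 * u)) * Real.exp (-(Real.pi * v) ^ 2 / (2 * u)) : ℝ) : ℂ) := by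
  have hpi : (Real.pi : ℂ) ≠ 0 := by exact_mod_cast Real.pi_ne_zero
  have hu' : (u : ℂ) ≠ 0 := by exact_mod_cast hu.ne'
  have h1 := integral_cexp_quadratic (b := ((-2 * u : ℝ) : ℂ)) (by simpa using hu)
    (-2 * Real.pi * v * Complex.I + 4 * u * w) (-2 * u * w ^ 2)
  rw [Real.fourier_real_eq_integral_exp_smul]
  have h2 : ∀ y : ℝ, Complex.exp (((-2 * Real.pi * y * v : ℝ) : ℂ) * Complex.I) •
      (Real.exp (-2 * u * (y - w) ^ 2) : ℂ) = Complex.exp (((-2 * u : ℝ) : ℂ) * y ^ 2 +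
        (-2 * Real.pi * v * Complex.I + 4 * u * w) * y + -2 * u * w ^ 2) := by
    intro y
    rw [smul_eq_mul, Complex.ofReal_exp, ← Complex.exp_add]
    congr 1
    push_cast
    ring
  simp_rw [h2]
  rw [h1]
  have h3 : (Real.pi / -((-2 * u : ℝ) : ℂ)) ^ (1 / 2 : ℂ) = ((√(Real.pi / (2 * u)) : ℝ) : ℂ) := by
    rw [Real.sqrt_eq_rpow, Complex.ofReal_cpow (by have := Real.pi_pos; positivity)]
    push_cast
    congr 1
    ring
  rw [h3]
  push_cast
  conv_rhs => rw [mul_left_comm, ← Complex.exp_add]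
  congr 2
  field_simp
  ring_nf
  rw [Complex.I_sq]
  ring

end

section

open scoped FourierTransform

/-- The mixture formula on the Fourier side: it produces the Fourier transform `|ξ| ^ (-4γ)` of the
Riesz kernel at `ξ = 2πv`. -/
theorem lintegral_mixWeight_mul_gaussian {γ : ℝ} (hγ : 0 < γ) {v : ℝ} (hv : v ≠ 0) :
    ∫⁻ u in Set.Ioi (0 : ℝ), ENNReal.ofReal (mixWeight γ u ^ 2 *
      (√(Real.pi / (2 * u)) * Real.exp (-(Real.pi * v) ^ 2 / (2 * u))) ^ 2) =
      ENNReal.ofReal (|2 * Real.pi * v| ^ (-(4 * γ))) := by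
  have hpi := Real.pi_pos
  set c : ℝ := (Real.pi * v) ^ 2 with hc
  have hc0 : 0 < c := by positivity
  have hΓ := Real.Gamma_pos_of_pos (show (0 : ℝ) < 2 * γ by linarith)
  set κ : ℝ := (√Real.pi * 2 ^ (4 * γ) * Real.Gamma (2 * γ))⁻¹ * √Real.pi with hκ
  have hκ0 : 0 < κ := by positivity
  have h1 : ∀ u ∈ Set.Ioi (0 : ℝ), mixWeight γ u ^ 2 *
      (√(Real.pi / (2 * u)) * Real.exp (-c / (2 * u))) ^ 2 =
      κ * ((|(-1 : ℝ)| * u ^ ((-1 : ℝ) - 1)) •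
        (fun r : ℝ => r ^ (2 * γ - 1) * Real.exp (-c * r)) (u ^ (-1 : ℝ))) := by
    intro u hu
    have hu' : (0 : ℝ) < u := hu
    have e1 := mixWeight_sq hγ hu'
    have e2 : √(Real.pi / (4 * u)) * (√Real.pi * u ^ (-(1 / 2) : ℝ)) = Real.pi / (2 * u) := by
      rw [Real.sqrt_div hpi.le, Real.sqrt_mul (by norm_num), show (4 : ℝ) = 2 ^ 2 by norm_num,
        Real.sqrt_sq (by norm_num), Real.rpow_neg hu'.le, ← Real.sqrt_eq_rpow]
      have := Real.sqrt_pos.2 hu'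
      field_simp
      rw [Real.sq_sqrt hpi.le, Real.sq_sqrt hu'.le, mul_comm]
    have e3 : Real.exp (-c / (2 * u)) ^ 2 = Real.exp (-c * u ^ (-1 : ℝ)) := by
      rw [← Real.exp_nat_mul, Real.rpow_neg_one]
      congr 1
      push_cast
      field_simp
    have e4 : u ^ (1 / 2 - 2 * γ - 1) * u ^ (-(1 / 2) : ℝ) =
        u ^ ((-1 : ℝ) - 1) * (u ^ (-1 : ℝ)) ^ (2 * γ - 1) := by
      rw [← Real.rpow_add hu', ← Real.rpow_mul hu'.le, ← Real.rpow_add hu']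
      congr 1; ring
    have e5 : (√(Real.pi / (2 * u)) * Real.exp (-c / (2 * u))) ^ 2 =
        √(Real.pi / (4 * u)) * (√Real.pi * u ^ (-(1 / 2) : ℝ)) * Real.exp (-c * u ^ (-1 : ℝ)) := by
      rw [mul_pow, Real.sq_sqrt (by positivity), e3, e2]
    rw [e5]
    simp only [smul_eq_mul, abs_neg, abs_one, one_mul]
    calc _ = (mixWeight γ u * mixWeight γ u * √(Real.pi / (4 * u))) * √Real.pi *
          u ^ (-(1 / 2) : ℝ) * Real.exp (-c * u ^ (-1 : ℝ)) := by ring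
      _ = κ * (u ^ (1 / 2 - 2 * γ - 1) * u ^ (-(1 / 2) : ℝ)) * Real.exp (-c * u ^ (-1 : ℝ)) := by
          rw [e1, hκ]; ring
      _ = _ := by rw [e4]; ring
  have hg : IntegrableOn (fun r : ℝ => r ^ (2 * γ - 1) * Real.exp (-c * r)) (Set.Ioi 0) := by
    have := integrableOn_rpow_mul_exp_neg_mul_rpow (p := 1) (s := 2 * γ - 1) (b := c)
      (by linarith) one_pos hc0
    simpa using this
  have hI := (integrableOn_Ioi_comp_rpow_iff (fun r : ℝ => r ^ (2 * γ - 1) * Real.exp (-c * r))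
    (p := -1) (by norm_num)).2 hg
  rw [setLIntegral_congr_fun measurableSet_Ioi fun u hu => by rw [h1 u hu],
    ← ofReal_integral_eq_lintegral_ofReal (hI.const_mul κ), integral_const_mul,
    integral_comp_rpow_Ioi (fun r : ℝ => r ^ (2 * γ - 1) * Real.exp (-c * r)) (by norm_num)]
  · congr 1
    have e := Real.integral_rpow_mul_exp_neg_mul_Ioi (a := 2 * γ) (r := c) (by linarith) hc0
    simp_rw [← neg_mul] at e
    rw [e, hκ, one_div, Real.inv_rpow hc0.le, ← Real.rpow_neg hc0.le]
    have e2 : c ^ (-(2 * γ)) = |Real.pi * v| ^ (-(4 * γ)) := by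
      rw [hc, ← sq_abs, ← Real.rpow_natCast, ← Real.rpow_mul (abs_nonneg _)]
      congr 1; push_cast; ring
    have e3 : |2 * Real.pi * v| ^ (-(4 * γ)) = (2 ^ (4 * γ))⁻¹ * |Real.pi * v| ^ (-(4 * γ)) := by
      rw [mul_assoc, abs_mul, abs_two, Real.mul_rpow (by norm_num) (abs_nonneg _),
        Real.rpow_neg (by norm_num)]
    rw [e2, e3]
    have : √Real.pi ≠ 0 := (Real.sqrt_pos.2 hpi).ne'
    field_simp
  · filter_upwards [self_mem_ae_restrict measurableSet_Ioi] with u hu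
    have hu' : (0 : ℝ) < u := hu
    simp only [smul_eq_mul, Pi.zero_apply]
    positivity

variable {ι : Type*} (I : Finset ι) (a : ι → ℝ) (k : ι → ℕ) (x : ι → ℝ)

/-- The function whose Fourier transform at `w` is the integral of a combination of derivatives of
the heat kernel against the Gaussian `y ↦ exp (-2 u (y - w)²)`. -/
def dampedSymbol (α t u v : ℝ) : ℂ :=
  symbol I a k x (2 * Real.pi * v) * (Real.exp (-t * |2 * Real.pi * v| ^ α) : ℂ) *
    ((√(Real.pi / (2 * u)) * Real.exp (-(Real.pi * v) ^ 2 / (2 * u)) : ℝ) : ℂ)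

theorem norm_dampedSymbol_sq (α t u v : ℝ) : ‖dampedSymbol I a k x α t u v‖ ^ 2 =
    ‖symbol I a k x (2 * Real.pi * v)‖ ^ 2 * Real.exp (-(2 * t * |2 * Real.pi * v| ^ α)) *
      (√(Real.pi / (2 * u)) * Real.exp (-(Real.pi * v) ^ 2 / (2 * u))) ^ 2 := by
  unfold dampedSymbol
  rw [norm_mul, norm_mul, Complex.norm_real, Complex.norm_real, Real.norm_of_nonneg (by positivity),
    Real.norm_of_nonneg (by positivity), mul_pow, mul_pow, ← Real.exp_nat_mul]
  congr 3
  push_cast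
  ring

theorem integral_sum_heatDeriv_mul_rieszRoot {α t : ℝ} (hα : 0 < α) (ht : 0 < t) (γ : ℝ) {u : ℝ}
    (hu : 0 < u) (w : ℝ) :
    ((∫ y, (∑ i ∈ I, a i * heatDeriv α (k i) t (x i - y)) * rieszRoot γ (u, w) y : ℝ) : ℂ) =
      mixWeight γ u * 𝓕 (dampedSymbol I a k x α t u) w := by
  have hg : Integrable (fun y : ℝ => (Real.exp (-2 * u * (y - w) ^ 2) : ℂ)) := by
    have h1 := (integrable_exp_neg_mul_sq (b := 2 * u) (by positivity)).comp_sub_right w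
    simpa only [neg_mul] using! h1.ofReal (𝕜 := ℂ)
  rw [← integral_complex_ofReal]
  have h2 : ∀ y : ℝ, (((∑ i ∈ I, a i * heatDeriv α (k i) t (x i - y)) * rieszRoot γ (u, w) y : ℝ) : ℂ) =
      mixWeight γ u * (𝓕 (fun v : ℝ => symbol I a k x (2 * Real.pi * v) *
        (Real.exp (-t * |2 * Real.pi * v| ^ α) : ℂ)) y * (Real.exp (-2 * u * (y - w) ^ 2) : ℂ)) := by
    intro y
    rw [Complex.ofReal_mul, sum_heatDeriv_eq_fourier I a k x hα ht y, rieszRoot]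
    push_cast
    ring
  simp_rw [h2]
  rw [integral_const_mul, integral_fourier_mul_eq (integrable_symbol_mul_exp I a k x hα ht) hg,
    Real.fourier_real_eq_integral_exp_smul]
  congr 1
  refine integral_congr_ae (ae_of_all _ fun v => ?_)
  simp only
  rw [fourier_gaussian_shift hu, smul_eq_mul, dampedSymbol]
  ring

theorem integrable_symbol_sq_mul_exp {α t : ℝ} (hα : 0 < α) (ht : 0 < t) :
    Integrable (fun ξ : ℝ => ‖symbol I a k x ξ‖ ^ 2 * Real.exp (-(2 * t * |ξ| ^ α))) := by
  have h1 : ∀ i, Integrable (fun ξ : ℝ => a i ^ 2 * (‖(Complex.I * ξ) ^ (2 * k i) *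
      Complex.exp (Complex.I * (0 : ℝ) * ξ) * (Real.exp (-(2 * t) * |ξ| ^ α) : ℂ)‖)) := fun i =>
    (integrable_and_heatDeriv_eq hα (by linarith : 0 < 2 * t) (2 * k i) 0).1.norm.const_mul _
  have h2 := (integrable_finsetSum I fun i _ => h1 i).const_mul (I.card : ℝ)
  refine h2.mono' ?_ (ae_of_all _ fun ξ => ?_)
  · refine AEStronglyMeasurable.mul ?_ (Measurable.aestronglyMeasurable (by fun_prop))
    exact ((continuous_symbol I a k x).norm.pow 2).aestronglyMeasurable
  · rw [Real.norm_of_nonneg (by positivity)]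
    have h3 : ‖symbol I a k x ξ‖ ≤ ∑ i ∈ I, |a i| * |ξ| ^ k i := by
      refine (norm_sum_le _ _).trans (Finset.sum_le_sum fun i _ => le_of_eq ?_)
      rw [norm_mul, norm_mul, norm_cexp_I_mul_mul, mul_one, Complex.norm_real, norm_pow, norm_mul,
        Complex.norm_I, one_mul, Complex.norm_real, Real.norm_eq_abs, Real.norm_eq_abs]
    have h4 : ‖symbol I a k x ξ‖ ^ 2 ≤ (I.card : ℝ) * ∑ i ∈ I, (|a i| * |ξ| ^ k i) ^ 2 :=
      (pow_le_pow_left₀ (norm_nonneg _) h3 2).trans sq_sum_le_card_mul_sum_sq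
    refine (mul_le_mul_of_nonneg_right h4 (Real.exp_pos _).le).trans (le_of_eq ?_)
    rw [mul_assoc, Finset.sum_mul]
    congr 1
    refine Finset.sum_congr rfl fun i _ => ?_
    rw [norm_mul, norm_mul, norm_cexp_I_mul_mul, mul_one, norm_pow, norm_mul, Complex.norm_I,
      one_mul, Complex.norm_real, Complex.norm_real, Real.norm_eq_abs, Real.norm_eq_abs,
      abs_of_pos (Real.exp_pos _), mul_pow, sq_abs, ← pow_mul, mul_comm (k i), mul_assoc, neg_mul]

theorem integrable_dampedSymbol {α t : ℝ} (hα : 0 < α) (ht : 0 < t) {u : ℝ} (hu : 0 < u) :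
    Integrable (dampedSymbol I a k x α t u) ∧ MemLp (dampedSymbol I a k x α t u) 2 := by
  have hpi := Real.pi_pos
  have hcont : Continuous (fun v : ℝ =>
      √(Real.pi / (2 * u)) * Real.exp (-(Real.pi * v) ^ 2 / (2 * u))) := by fun_prop
  have hb : ∀ v : ℝ, ‖√(Real.pi / (2 * u)) *
      Real.exp (-(Real.pi * v) ^ 2 / (2 * u))‖ ≤ √(Real.pi / (2 * u)) := by
    intro v
    rw [Real.norm_of_nonneg (by positivity)]
    refine mul_le_of_le_one_right (Real.sqrt_nonneg _) (Real.exp_le_one_iff.2 ?_)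
    have : 0 ≤ (Real.pi * v) ^ 2 / (2 * u) := by positivity
    rw [neg_div]; linarith
  have h1 : Integrable (dampedSymbol I a k x α t u) :=
    (integrable_symbol_mul_exp I a k x hα ht).mul_bdd (c := √(Real.pi / (2 * u)))
      (Complex.continuous_ofReal.comp hcont).aestronglyMeasurable
      (ae_of_all _ fun v => by
        rw [Complex.norm_real]; exact hb v)
  refine ⟨h1, (memLp_two_iff_integrable_sq_norm h1.1).2 ?_⟩
  simp_rw [norm_dampedSymbol_sq]
  have h2 := (integrable_symbol_sq_mul_exp I a k x hα ht).comp_mul_left' (R := 2 * Real.pi)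
    (by positivity)
  refine h2.mul_bdd (c := √(Real.pi / (2 * u)) ^ 2) (hcont.pow 2).aestronglyMeasurable
    (ae_of_all _ fun v => ?_)
  rw [norm_pow]
  exact pow_le_pow_left₀ (norm_nonneg _) (hb v) 2

/-- The squared norm of a combination of derivatives of the heat kernel at a fixed time, in terms
of its Fourier transform. Plancherel's theorem is applied in the variable `w` of the parameters
`(u, w)`; integrating over `u` leaves `|ξ| ^ (-4γ)`. This avoids the Fourier transform of the Riesz
kernel as a distribution. -/
theorem lintegral_sq_sum_heatDeriv {α t γ : ℝ} (hα : 0 < α) (ht : 0 < t) (hγ : 0 < γ) :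
    ∫⁻ e, ‖∫ y, (∑ i ∈ I, a i * heatDeriv α (k i) t (x i - y)) * rieszRoot γ e y‖ₑ ^ 2
      ∂mixMeasure = ENNReal.ofReal (2 * Real.pi)⁻¹ *
        ∫⁻ ξ : ℝ, ENNReal.ofReal (‖symbol I a k x ξ‖ ^ 2 * |ξ| ^ (-(4 * γ)) *
          Real.exp (-(2 * t * |ξ| ^ α))) := by
  have hpi := Real.pi_pos
  have hcs := continuous_symbol I a k x
  have hm1 : Measurable (Function.uncurry fun (_ : ℝ) y =>
      ∑ i ∈ I, a i * heatDeriv α (k i) t (x i - y)) := by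
    refine Finset.measurable_sum _ fun i _ => Measurable.const_mul ?_ _
    exact (continuous_heatDeriv hα ht (k i)).measurable.comp
      (measurable_const.sub measurable_snd)
  have hm2 : Measurable fun e : ℝ × ℝ =>
      ∫ y, (∑ i ∈ I, a i * heatDeriv α (k i) t (x i - y)) * rieszRoot γ e y :=
    (stronglyMeasurable_integrandRoot γ hm1).measurable.comp
      (measurable_const (a := (0 : ℝ)) |>.prodMk measurable_id)
  rw [mixMeasure, lintegral_prod _ (hm2.enorm.pow_const 2).aemeasurable]
  have h1 : ∀ u ∈ Set.Ioi (0 : ℝ), ∫⁻ w, ‖∫ y, (∑ i ∈ I, a i * heatDeriv α (k i) t (x i - y)) *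
      rieszRoot γ (u, w) y‖ₑ ^ 2 = ∫⁻ v : ℝ,
        ENNReal.ofReal (‖symbol I a k x (2 * Real.pi * v)‖ ^ 2 *
          Real.exp (-(2 * t * |2 * Real.pi * v| ^ α))) * ENNReal.ofReal (mixWeight γ u ^ 2 *
      (√(Real.pi / (2 * u)) * Real.exp (-(Real.pi * v) ^ 2 / (2 * u))) ^ 2) := by
    intro u hu
    obtain ⟨i1, i2⟩ := integrable_dampedSymbol I a k x hα ht hu
    have h2 : ∀ w, ‖∫ y, (∑ i ∈ I, a i * heatDeriv α (k i) t (x i - y)) *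
        rieszRoot γ (u, w) y‖ₑ ^ 2 = ENNReal.ofReal (mixWeight γ u ^ 2) *
          ‖𝓕 (dampedSymbol I a k x α t u) w‖ₑ ^ 2 := by
      intro w
      have h3 := congrArg (fun z => ‖z‖ₑ) (integral_sum_heatDeriv_mul_rieszRoot I a k x hα ht γ hu w)
      simp only [enorm_mul] at h3
      rw [← ofReal_norm, Complex.norm_real, ofReal_norm] at h3
      rw [h3, mul_pow, ← ofReal_norm (mixWeight γ u : ℂ), Complex.norm_real,
        Real.norm_of_nonneg (mixWeight_nonneg _ _), ENNReal.ofReal_pow (mixWeight_nonneg _ _)]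
    simp_rw [h2]
    rw [lintegral_const_mul' _ _ ENNReal.ofReal_ne_top, ← eLpNorm_two_sq,
      eLpNorm_fourier_eq i1 i2, eLpNorm_two_sq, ← lintegral_const_mul' _ _ ENNReal.ofReal_ne_top]
    refine lintegral_congr fun v => ?_
    rw [← ofReal_norm, ← ENNReal.ofReal_pow (norm_nonneg _), norm_dampedSymbol_sq,
      ← ENNReal.ofReal_mul (by positivity), ← ENNReal.ofReal_mul (by positivity)]
    congr 1
    ring
  rw [setLIntegral_congr_fun measurableSet_Ioi h1, lintegral_lintegral_swap]
  · have h4 : ∀ᵐ v : ℝ, ∫⁻ u in Set.Ioi (0 : ℝ),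
        ENNReal.ofReal (‖symbol I a k x (2 * Real.pi * v)‖ ^ 2 *
          Real.exp (-(2 * t * |2 * Real.pi * v| ^ α))) * ENNReal.ofReal (mixWeight γ u ^ 2 *
        (√(Real.pi / (2 * u)) * Real.exp (-(Real.pi * v) ^ 2 / (2 * u))) ^ 2) =
        ENNReal.ofReal (‖symbol I a k x (2 * Real.pi * v)‖ ^ 2 * |2 * Real.pi * v| ^ (-(4 * γ)) *
          Real.exp (-(2 * t * |2 * Real.pi * v| ^ α))) := by
      filter_upwards [compl_mem_ae_iff.2 (measure_singleton (0 : ℝ))] with v hv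
      rw [lintegral_const_mul' _ _ ENNReal.ofReal_ne_top, lintegral_mixWeight_mul_gaussian hγ hv,
        ← ENNReal.ofReal_mul (by positivity)]
      congr 1
      ring
    rw [lintegral_congr_ae h4]
    exact lintegral_comp_mul_left (c := 2 * Real.pi) (by positivity)
      (f := fun ξ => ENNReal.ofReal (‖symbol I a k x ξ‖ ^ 2 * |ξ| ^ (-(4 * γ)) *
          Real.exp (-(2 * t * |ξ| ^ α)))) (by fun_prop)
  · have := measurable_mixWeight γ
    refine Measurable.aemeasurable ?_
    unfold Function.uncurry
    fun_prop

end

section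

/-! ### Space-time kernels built from the heat kernel -/

/-- The integrand `(s, z) ↦ σ (∂ₓᵏ G)(θ ρ(s), x - z)` for `s ∈ S`. The clock `ρ` is `s ↦ t - s` for
the mild solution, and `s ↦ s` for its time reversal and for the remainder. -/
def heatField (α θ σ : ℝ) (S : Set ℝ) (ρ : ℝ → ℝ) (k : ℕ) (x s z : ℝ) : ℝ :=
  S.indicator (fun s => σ * heatDeriv α k (θ * ρ s) (x - z)) s

/-- The spectral density in the frequency `ξ` of the noise accumulated over the times `S`, with
respect to the factor `|ξ| ^ (-4γ)` of the Riesz kernel. -/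
def timeDensity (α θ : ℝ) (S : Set ℝ) (ρ : ℝ → ℝ) (ξ : ℝ) : ℝ≥0∞ :=
  ∫⁻ s in S, ENNReal.ofReal (Real.exp (-(2 * (θ * ρ s) * |ξ| ^ α)))

/-- The integral of `|p|²` against the spectral measure
`σ² / (2π) |ξ|^(-4γ) timeDensity ξ dξ` of the stationary fields obtained by integrating
`heatField`. -/
def spectralNorm (α γ θ σ : ℝ) (S : Set ℝ) (ρ : ℝ → ℝ) (p : ℝ → ℂ) : ℝ≥0∞ :=
  ENNReal.ofReal (σ ^ 2 / (2 * Real.pi)) *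
    ∫⁻ ξ : ℝ, ENNReal.ofReal (‖p ξ‖ ^ 2 * |ξ| ^ (-(4 * γ))) * timeDensity α θ S ρ ξ

variable {α γ θ σ : ℝ} {S : Set ℝ} {ρ : ℝ → ℝ}

theorem measurable_heatField (hα : 0 < α) (hθ : 0 < θ) (hS : MeasurableSet S)
    (hρ : Measurable ρ) (hpos : ∀ s ∈ S, 0 < ρ s) (k : ℕ) (x : ℝ) :
    Measurable (Function.uncurry (heatField α θ σ S ρ k x)) := by
  have h1 : Function.uncurry (heatField α θ σ S ρ k x) = (S ×ˢ Set.univ).indicator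
      (fun p => σ * (((θ * ρ p.1) ^ (-(1 / α))) ^ (k + 1) *
        heatDeriv α k 1 ((θ * ρ p.1) ^ (-(1 / α)) * (x - p.2)))) := by
    ext ⟨s, z⟩
    by_cases hs : s ∈ S
    · simp only [Function.uncurry_apply_pair, heatField, Set.indicator_of_mem hs]
      rw [Set.indicator_of_mem (by simpa using hs)]
      simp only
      rw [heatDeriv_scaling hα (mul_pos hθ (hpos s hs))]
    · simp only [Function.uncurry_apply_pair, heatField, Set.indicator_of_notMem hs]
      rw [Set.indicator_of_notMem (by simpa using hs)]
  rw [h1]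
  refine Measurable.indicator ?_ (hS.prod MeasurableSet.univ)
  have := (continuous_heatDeriv hα one_pos k).measurable
  fun_prop

theorem continuousOn_heatField (hα : 0 < α) (hθ : 0 < θ)
    (hρ : Continuous ρ) (hpos : ∀ s ∈ S, 0 < ρ s) (k : ℕ) (x : ℝ) :
    ContinuousOn (Function.uncurry (heatField α θ σ S ρ k x)) (S ×ˢ Set.univ) := by
  have h1 : ContinuousOn (fun p : ℝ × ℝ => σ * (((θ * ρ p.1) ^ (-(1 / α))) ^ (k + 1) *
        heatDeriv α k 1 ((θ * ρ p.1) ^ (-(1 / α)) * (x - p.2)))) (S ×ˢ Set.univ) := by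
    have h2 : ContinuousOn (fun p : ℝ × ℝ => (θ * ρ p.1) ^ (-(1 / α))) (S ×ˢ Set.univ) := by
      refine ContinuousOn.rpow_const (by fun_prop) fun p hp => Or.inl ?_
      exact (mul_pos hθ (hpos p.1 hp.1)).ne'
    have h3 := continuous_heatDeriv hα one_pos k
    refine continuousOn_const.mul ((h2.pow _).mul (h3.comp_continuousOn (h2.mul ?_)))
    fun_prop
  refine h1.congr fun p hp => ?_
  simp only [Function.uncurry, heatField, Set.indicator_of_mem hp.1]
  rw [heatDeriv_scaling hα (mul_pos hθ (hpos p.1 hp.1))]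

variable {ι : Type*} (I : Finset ι) (a : ι → ℝ) (k : ι → ℕ) (x : ι → ℝ)

/-- The squared norm of a combination of the kernels `heatField` is the spectral integral of the
squared modulus of its symbol. -/
theorem eLpNorm_sq_sum_heatField (hα : 0 < α) (hγ : 0 < γ) (hθ : 0 < θ)
    (hS : MeasurableSet S) (hS0 : S ⊆ Set.Ioi 0)
    (hρ : Measurable ρ) (hpos : ∀ s ∈ S, 0 < ρ s) :
    eLpNorm (integrandRoot γ fun s z => ∑ i ∈ I, a i * heatField α θ σ S ρ (k i) (x i) s z) 2
      rootMeasure ^ 2 = spectralNorm α γ θ σ S ρ (symbol I a k x) := by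
  have hpi := Real.pi_pos
  have hcs := continuous_symbol I a k x
  have hm : Measurable (Function.uncurry fun s z =>
      ∑ i ∈ I, a i * heatField α θ σ S ρ (k i) (x i) s z) :=
    Finset.measurable_sum _ fun i _ => (measurable_heatField hα hθ hS hρ hpos _ _).const_mul _
  have hm2 := (stronglyMeasurable_integrandRoot γ hm).measurable
  rw [eLpNorm_two_sq, rootMeasure, lintegral_prod _ (hm2.enorm.pow_const 2).aemeasurable]
  have h1 : ∀ s, ∫⁻ e, ‖integrandRoot γ (fun s z =>
      ∑ i ∈ I, a i * heatField α θ σ S ρ (k i) (x i) s z) (s, e)‖ₑ ^ 2 ∂mixMeasure =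
      S.indicator (fun s => ENNReal.ofReal (σ ^ 2 / (2 * Real.pi)) * ∫⁻ ξ : ℝ,
        ENNReal.ofReal (‖symbol I a k x ξ‖ ^ 2 * |ξ| ^ (-(4 * γ))) *
          ENNReal.ofReal (Real.exp (-(2 * (θ * ρ s) * |ξ| ^ α)))) s := by
    intro s
    by_cases hs : s ∈ S
    · rw [Set.indicator_of_mem hs]
      have h2 : ∀ e, integrandRoot γ (fun s z =>
          ∑ i ∈ I, a i * heatField α θ σ S ρ (k i) (x i) s z) (s, e) =
          σ * ∫ y, (∑ i ∈ I, a i * heatDeriv α (k i) (θ * ρ s) (x i - y)) * rieszRoot γ e y := by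
        intro e
        unfold integrandRoot
        rw [← integral_const_mul]
        refine integral_congr_ae (ae_of_all _ fun y => ?_)
        simp only [heatField, Set.indicator_of_mem hs]
        rw [← mul_assoc, Finset.mul_sum]
        congr 1
        exact Finset.sum_congr rfl fun i _ => by ring
      simp_rw [h2, enorm_mul, mul_pow]
      rw [lintegral_const_mul' _ _ (by simp),
        lintegral_sq_sum_heatDeriv I a k x hα (mul_pos hθ (hpos s hs)) hγ, ← mul_assoc]
      congr 1
      · rw [← ofReal_norm, ← ENNReal.ofReal_pow (norm_nonneg _), ← ENNReal.ofReal_mul (by positivity),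
          Real.norm_eq_abs, sq_abs, div_eq_mul_inv]
      · refine lintegral_congr fun ξ => ?_
        rw [← ENNReal.ofReal_mul (by positivity)]
    · rw [Set.indicator_of_notMem hs]
      simp [integrandRoot, heatField, Set.indicator_of_notMem hs]
  simp_rw [h1]
  rw [setLIntegral_indicator hS, Set.inter_eq_self_of_subset_left hS0,
    lintegral_const_mul' _ _ ENNReal.ofReal_ne_top, spectralNorm, lintegral_lintegral_swap]
  · congr 1
    refine lintegral_congr fun ξ => ?_
    rw [lintegral_const_mul' _ _ ENNReal.ofReal_ne_top]
    rfl
  · refine Measurable.aemeasurable ?_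
    unfold Function.uncurry
    fun_prop

theorem spatialEnergy_heatField_of_mem (hα : 0 < α) (hθ : 0 < θ) {s : ℝ} (hs : s ∈ S) (hs' : 0 < ρ s)
    (k : ℕ) (x : ℝ) : spatialEnergy γ (heatField α θ σ S ρ k x s) =
      ENNReal.ofReal (σ ^ 2) * (ENNReal.ofReal ((θ * ρ s) ^ (-((1 - 4 * γ + 2 * k) / α))) *
        heatEnergy α γ k) := by
  rw [← spatialEnergy_heatDeriv hα (mul_pos hθ hs') k x, ← spatialEnergy_const_mul]
  congr 1
  ext z
  rw [heatField, Set.indicator_of_mem hs]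

theorem energy_heatField (hα : 0 < α) (hθ : 0 < θ) (hS : MeasurableSet S) (hS0 : S ⊆ Set.Ioi 0)
    (hρ : Measurable ρ) (hpos : ∀ s ∈ S, 0 < ρ s) (k : ℕ) (x : ℝ) :
    energy γ (heatField α θ σ S ρ k x) = ENNReal.ofReal (σ ^ 2) * ((∫⁻ s in S,
      ENNReal.ofReal ((θ * ρ s) ^ (-((1 - 4 * γ + 2 * k) / α)))) * heatEnergy α γ k) := by
  have h0 : ∀ s, spatialEnergy γ (heatField α θ σ S ρ k x s) = S.indicator
      (fun s => ENNReal.ofReal (σ ^ 2) * (ENNReal.ofReal ((θ * ρ s) ^ (-((1 - 4 * γ + 2 * k) / α))) *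
        heatEnergy α γ k)) s := by
    intro s
    by_cases hs : s ∈ S
    · rw [Set.indicator_of_mem hs, spatialEnergy_heatField_of_mem hα hθ hs (hpos s hs)]
    · rw [Set.indicator_of_notMem hs]
      simp [spatialEnergy, heatField, Set.indicator_of_notMem hs]
  rw [energy_eq_lintegral_spatialEnergy]
  simp_rw [h0]
  rw [setLIntegral_indicator hS, Set.inter_eq_self_of_subset_left hS0,
    lintegral_const_mul' _ _ ENNReal.ofReal_ne_top, lintegral_mul_const _ (by fun_prop)]

theorem lintegral_Ioo_rpow_lt_top (hθ : 0 < θ) {t q : ℝ} (ht : 0 < t) (hq : q < 1) :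
    ∫⁻ s in Set.Ioo 0 t, ENNReal.ofReal ((θ * s) ^ (-q)) < ∞ := by
  have h1 := (intervalIntegral.intervalIntegrable_rpow' (a := 0) (b := t) (r := -q)
    (by linarith)).const_mul (θ ^ (-q))
  rw [intervalIntegrable_iff_integrableOn_Ioo_of_le ht.le] at h1
  have h2 := h1.2
  refine lt_of_le_of_lt (le_of_eq ?_) h2
  refine setLIntegral_congr_fun measurableSet_Ioo fun s hs => ?_
  have : 0 < s := hs.1
  simp only
  rw [Real.mul_rpow hθ.le hs.1.le, Real.enorm_of_nonneg (by positivity)]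

theorem setLIntegral_Ioo_comp_sub (f : ℝ → ℝ≥0∞) (t : ℝ) :
    ∫⁻ s in Set.Ioo 0 t, f (t - s) = ∫⁻ s in Set.Ioo 0 t, f s := by
  rw [← lintegral_indicator measurableSet_Ioo, ← lintegral_indicator measurableSet_Ioo,
    ← lintegral_sub_left_eq_self _ t]
  refine lintegral_congr fun s => ?_
  by_cases hs : s ∈ Set.Ioo 0 t
  · have : t - s ∈ Set.Ioo 0 t := ⟨by linarith [hs.2], by linarith [hs.1]⟩
    rw [Set.indicator_of_mem hs, Set.indicator_of_mem this]
    simp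
  · have : t - s ∉ Set.Ioo 0 t := fun h => hs ⟨by linarith [h.2], by linarith [h.1]⟩
    rw [Set.indicator_of_notMem hs, Set.indicator_of_notMem this]

theorem lintegral_Ioi_rpow_lt_top (hθ : 0 < θ) {t q : ℝ} (ht : 0 < t) (hq : 1 < q) :
    ∫⁻ s in Set.Ioi t, ENNReal.ofReal ((θ * s) ^ (-q)) < ∞ := by
  have h1 := (integrableOn_Ioi_rpow_of_lt (a := -q) (by linarith) ht).const_mul (θ ^ (-q))
  refine lt_of_le_of_lt (le_of_eq ?_) h1.2
  refine setLIntegral_congr_fun measurableSet_Ioi fun s hs => ?_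
  have : 0 < s := ht.trans hs
  simp only
  rw [Real.mul_rpow hθ.le this.le, Real.enorm_of_nonneg (by positivity)]

end

section

/-! ### Continuous versions of processes -/

/-- The largest point of `2⁻ⁿ ℤ` below `x`. -/
def dyadicFloor (n : ℕ) (x : ℝ) : ℝ := (⌊2 ^ n * x⌋ : ℝ) / 2 ^ n

theorem abs_sub_dyadicFloor_le (n : ℕ) (x : ℝ) : |x - dyadicFloor n x| ≤ (2⁻¹ : ℝ) ^ n := by
  have h2 : (0 : ℝ) < 2 ^ n := by positivity
  have h1 := Int.floor_le (2 ^ n * x)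
  have h3 := (Int.lt_floor_add_one (2 ^ n * x)).le
  have h4 : x - dyadicFloor n x = (2 ^ n * x - ⌊2 ^ n * x⌋) / 2 ^ n := by
    unfold dyadicFloor; field_simp
  rw [h4, abs_of_nonneg (div_nonneg (by linarith) h2.le), inv_pow, div_le_iff₀ h2,
    inv_mul_cancel₀ h2.ne']
  linarith

theorem abs_floor_le {n N : ℕ} {x : ℝ} (hx : |x| ≤ N) : |⌊(2 : ℝ) ^ n * x⌋| ≤ N * 2 ^ n := by
  have h2 : (0 : ℝ) < 2 ^ n := by positivity
  obtain ⟨h3, h4⟩ := abs_le.1 hx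
  rw [abs_le]
  constructor
  · rw [Int.le_floor]
    push_cast
    nlinarith
  · have h5 : (⌊(2 : ℝ) ^ n * x⌋ : ℝ) ≤ ((N * 2 ^ n : ℤ) : ℝ) := by
      refine (Int.floor_le _).trans ?_
      push_cast
      nlinarith
    exact_mod_cast h5

/-- A function with geometrically small increments along the dyadic grids has a continuous
limit along these grids. -/
theorem exists_continuous_tendsto_dyadicFloor {f : ℝ → ℝ} {M r : ℝ} (hr0 : 0 ≤ r) (hr : r < 1)
    (hf : ∀ n : ℕ, ∀ k : ℤ, |k| ≤ (n + 1) * 2 ^ n →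
      |f (((k + 1 : ℤ) : ℝ) / 2 ^ n) - f ((k : ℝ) / 2 ^ n)| ≤ M * r ^ n) :
    ∃ g : ℝ → ℝ, Continuous g ∧ ∀ x, Tendsto (fun n => f (dyadicFloor n x)) atTop (𝓝 (g x)) := by
  have hM : 0 ≤ M := by
    have := (abs_nonneg _).trans (hf 0 0 (by simp))
    simpa using this
  have hstep : ∀ (N : ℕ) (x : ℝ), |x| ≤ N → ∀ n, N ≤ n →
      dist (f (dyadicFloor n x)) (f (dyadicFloor (n + 1) x)) ≤ M * r ^ n := by
    intro N x hx n hn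
    have hk := abs_floor_le (n := n) hx
    set j : ℤ := ⌊(2 : ℝ) ^ n * x⌋ with hj
    have hj1 := Int.floor_le ((2 : ℝ) ^ n * x)
    have hj2 := Int.lt_floor_add_one ((2 : ℝ) ^ n * x)
    rw [← hj] at hj1 hj2
    have h0 : dyadicFloor n x = ((2 * j : ℤ) : ℝ) / 2 ^ (n + 1) := by
      unfold dyadicFloor
      rw [← hj, pow_succ]
      push_cast
      field_simp
    have hcase : ⌊(2 : ℝ) ^ (n + 1) * x⌋ = 2 * j ∨ ⌊(2 : ℝ) ^ (n + 1) * x⌋ = 2 * j + 1 := by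
      have h1 : 2 * j ≤ ⌊(2 : ℝ) ^ (n + 1) * x⌋ := by
        rw [Int.le_floor, pow_succ]; push_cast; linarith
      have h2 : ⌊(2 : ℝ) ^ (n + 1) * x⌋ < 2 * j + 2 := by
        rw [Int.floor_lt, pow_succ]; push_cast; linarith
      omega
    have hrn : M * r ^ (n + 1) ≤ M * r ^ n :=
      mul_le_mul_of_nonneg_left (pow_le_pow_of_le_one hr0 hr.le (Nat.le_succ n)) hM
    rcases hcase with h | h
    · rw [h0]
      unfold dyadicFloor
      rw [h, dist_self]
      positivity
    · rw [h0]
      unfold dyadicFloor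
      rw [h, dist_comm, Real.dist_eq]
      refine (hf (n + 1) (2 * j) ?_).trans hrn
      rw [abs_mul, abs_two, pow_succ]
      have hn' : (N : ℤ) ≤ n := by exact_mod_cast hn
      have h2n : (0 : ℤ) < 2 ^ n := by positivity
      push_cast
      nlinarith
  have hlim : ∀ (N : ℕ) (x : ℝ), |x| ≤ N → ∃ y, Tendsto (fun n => f (dyadicFloor n x)) atTop (𝓝 y) ∧
      ∀ n, N ≤ n → dist (f (dyadicFloor n x)) y ≤ M * r ^ n / (1 - r) := by
    intro N x hx
    have h1 : ∀ n, dist (f (dyadicFloor (n + N) x)) (f (dyadicFloor (n + 1 + N) x)) ≤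
        (M * r ^ N) * r ^ n := by
      intro n
      have := hstep N x hx (n + N) (by omega)
      rw [show n + 1 + N = n + N + 1 by ring]
      refine this.trans (le_of_eq ?_)
      rw [pow_add]; ring
    obtain ⟨y, hy⟩ := cauchySeq_tendsto_of_complete (cauchySeq_of_le_geometric r _ hr h1)
    refine ⟨y, (tendsto_add_atTop_iff_nat N).1 hy, fun n hn => ?_⟩
    have h2 := dist_le_of_le_geometric_of_tendsto r _ hr h1 hy (n - N)
    rw [Nat.sub_add_cancel hn, mul_assoc, ← pow_add, Nat.add_sub_cancel' hn] at h2
    exact h2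
  choose g hg using fun x : ℝ => hlim ⌈|x|⌉₊ x (Nat.le_ceil _)
  have hg2 : ∀ (N : ℕ) (x : ℝ), |x| ≤ N → ∀ n, N ≤ n →
      dist (f (dyadicFloor n x)) (g x) ≤ M * r ^ n / (1 - r) := by
    intro N x hx n hn
    obtain ⟨y, hy1, hy2⟩ := hlim N x hx
    rw [tendsto_nhds_unique (hg x).1 hy1]
    exact hy2 n hn
  refine ⟨g, ?_, fun x => (hg x).1⟩
  rw [continuous_iff_continuousAt]
  intro x
  rw [Metric.continuousAt_iff]
  intro ε hε
  obtain ⟨N, hN⟩ := exists_nat_ge (|x| + 1)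
  have hlim0 : Tendsto (fun n : ℕ => (2 * (M / (1 - r)) + M) * r ^ n) atTop (𝓝 0) := by
    simpa using (tendsto_pow_atTop_nhds_zero_of_lt_one hr0 hr).const_mul (2 * (M / (1 - r)) + M)
  obtain ⟨n, hn1, hn2⟩ := ((hlim0.eventually_lt_const hε).and (eventually_ge_atTop N)).exists
  refine ⟨(2⁻¹ : ℝ) ^ n, by positivity, fun {y} hy => ?_⟩
  have hpow : (2⁻¹ : ℝ) ^ n ≤ 1 := pow_le_one₀ (by norm_num) (by norm_num)
  have hyN : |y| ≤ N := by
    have : |y| ≤ |x| + |y - x| := by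
      have := abs_add_le x (y - x); rwa [add_sub_cancel] at this
    rw [Real.dist_eq] at hy
    linarith
  have hxN : |x| ≤ N := by linarith
  have h2n : (0 : ℝ) < 2 ^ n := by positivity
  -- the dyadic approximations of two points at distance less than `2⁻ⁿ` are equal or neighbours
  have hnear : ∀ u v : ℝ, u ≤ v → v - u < (2⁻¹ : ℝ) ^ n → |u| ≤ N →
      dist (f (dyadicFloor n u)) (f (dyadicFloor n v)) ≤ M * r ^ n := by
    intro u v huv hvu hu
    have h1 : (2 : ℝ) ^ n * v < 2 ^ n * u + 1 := by
      have := mul_lt_mul_of_pos_left hvu h2n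
      rw [← mul_pow, mul_inv_cancel₀ two_ne_zero, one_pow] at this
      linarith
    have h3 : ⌊(2 : ℝ) ^ n * u⌋ ≤ ⌊(2 : ℝ) ^ n * v⌋ := Int.floor_mono (by gcongr)
    have h4 : ⌊(2 : ℝ) ^ n * v⌋ ≤ ⌊(2 : ℝ) ^ n * u⌋ + 1 := by
      rw [← Int.floor_add_one]; exact Int.floor_mono h1.le
    have hk := abs_floor_le (n := n) hu
    have hn' : (N : ℤ) ≤ n := by exact_mod_cast hn2
    have h2n' : (0 : ℤ) < 2 ^ n := by positivity
    rcases (by omega : ⌊(2 : ℝ) ^ n * v⌋ = ⌊(2 : ℝ) ^ n * u⌋ ∨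
        ⌊(2 : ℝ) ^ n * v⌋ = ⌊(2 : ℝ) ^ n * u⌋ + 1) with h | h
    · unfold dyadicFloor
      rw [h, dist_self]
      positivity
    · unfold dyadicFloor
      rw [h, dist_comm, Real.dist_eq]
      exact hf n _ (by nlinarith)
  have hxy : dist (f (dyadicFloor n y)) (f (dyadicFloor n x)) ≤ M * r ^ n := by
    rw [Real.dist_eq] at hy
    rcases le_total y x with h | h
    · exact hnear y x h (by rw [abs_sub_comm, abs_of_nonneg (by linarith)] at hy; exact hy) hyN
    · rw [dist_comm]
      exact hnear x y h (by rw [abs_of_nonneg (by linarith)] at hy; exact hy) hxN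
  calc dist (g y) (g x) ≤ dist (g y) (f (dyadicFloor n y)) +
        dist (f (dyadicFloor n y)) (f (dyadicFloor n x)) + dist (f (dyadicFloor n x)) (g x) :=
        dist_triangle4 _ _ _ _
    _ ≤ M * r ^ n / (1 - r) + M * r ^ n + M * r ^ n / (1 - r) := by
        rw [dist_comm (g y)]
        exact add_le_add (add_le_add (hg2 N y hyN n hn2) hxy) (hg2 N x hxN n hn2)
    _ = (2 * (M / (1 - r)) + M) * r ^ n := by ring
    _ < ε := hn1

variable {Ω : Type*} [MeasurableSpace Ω] {P : Measure Ω}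

/-- If a sum of expectations is finite, the summands are almost surely bounded and tend to zero. -/
theorem ae_tsum_lt_top {F : ℕ → Ω → ℝ≥0∞} (hF : ∀ n, AEMeasurable (F n) P)
    (h : ∑' n, ∫⁻ ω, F n ω ∂P ≠ ∞) : ∀ᵐ ω ∂P, ∑' n, F n ω < ∞ := by
  rw [← lintegral_tsum hF] at h
  exact ae_lt_top' (AEMeasurable.tsum hF) h

/-- The Kolmogorov continuity theorem on the real line. -/
theorem exists_continuous_version {Y : ℝ → Ω → ℝ} (hY : ∀ x, AEMeasurable (Y x) P)
    {N : ℕ} (hN : N ≠ 0) {K : ℝ≥0} {δ : ℝ} (hδ : 0 < δ)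
    (h : ∀ x y, ∫⁻ ω, ‖Y y ω - Y x ω‖ₑ ^ N ∂P ≤ K * ENNReal.ofReal (|y - x| ^ (1 + δ))) :
    ∃ Z : ℝ → Ω → ℝ, (∀ ω, Continuous fun x => Z x ω) ∧ ∀ x, Z x =ᵐ[P] Y x := by
  have hN' : (0 : ℝ) < N := by positivity
  -- `q = 2^(δ/2)` and `r = q^(-1/N)`
  set r : ℝ := (2 : ℝ) ^ (-(δ / (2 * N))) with hr
  have hr0 : 0 < r := by positivity
  have hr1 : r < 1 := Real.rpow_lt_one_of_one_lt_of_neg (by norm_num) (by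
    have : 0 < δ / (2 * N) := by positivity
    linarith)
  set q : ℝ := (2 : ℝ) ^ (-(δ / 2)) with hq
  have hq0 : 0 < q := by positivity
  have hq1 : q < 1 := Real.rpow_lt_one_of_one_lt_of_neg (by norm_num) (by linarith)
  have hrq : r ^ N = q := by
    rw [hr, ← Real.rpow_natCast, ← Real.rpow_mul (by norm_num)]
    congr 1
    field_simp
  have hq2 : ∀ n : ℕ, ((2⁻¹ : ℝ) ^ n) ^ (1 + δ) = (2⁻¹) ^ n * (q ^ n * q ^ n) := by
    intro n
    rw [Real.rpow_add (by positivity), Real.rpow_one, ← mul_pow, hq, ← Real.rpow_add (by norm_num),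
      ← Real.rpow_natCast _ n, ← Real.rpow_natCast _ n, Real.inv_rpow (by norm_num),
      ← Real.rpow_neg (by norm_num), ← Real.rpow_mul (by norm_num), ← Real.rpow_mul (by norm_num)]
    congr 2
    ring
  let A : ℕ → Finset ℤ := fun n => Finset.Icc (-((n + 1) * 2 ^ n)) ((n + 1) * 2 ^ n)
  let D : ℕ → Ω → ℝ≥0∞ := fun n ω => ∑ k ∈ A n, ENNReal.ofReal (q⁻¹ ^ n) *
    ‖Y (((k + 1 : ℤ) : ℝ) / 2 ^ n) ω - Y ((k : ℝ) / 2 ^ n) ω‖ₑ ^ N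
  have hYm : ∀ x y, AEMeasurable (fun ω => ‖Y x ω - Y y ω‖ₑ ^ N) P := fun x y =>
    ((hY x).sub (hY y)).enorm.pow_const N
  have hDm : ∀ n, AEMeasurable (D n) P := fun n =>
    Finset.aemeasurable_fun_sum _ fun k _ => (hYm _ _).const_mul _
  have hcard : ∀ n, ((A n).card : ℝ) * (2⁻¹) ^ n ≤ 2 * n + 3 := by
    intro n
    have h2n : (0 : ℝ) < 2 ^ n := by positivity
    have h1 : ((A n).card : ℤ) = 2 * ((n + 1) * 2 ^ n) + 1 := by
      simp only [A, Int.card_Icc]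
      have : (0 : ℤ) ≤ (n + 1) * 2 ^ n := by positivity
      rw [Int.toNat_of_nonneg (by linarith)]
      ring
    have h2 : ((A n).card : ℝ) = 2 * ((n + 1) * 2 ^ n) + 1 := by exact_mod_cast h1
    rw [h2, inv_pow, mul_inv_le_iff₀ h2n]
    have : (1 : ℝ) ≤ 2 ^ n := one_le_pow₀ (by norm_num)
    nlinarith
  have hDint : ∀ n, ∫⁻ ω, D n ω ∂P ≤ ENNReal.ofReal (K * ((2 * n + 3) * q ^ n)) := by
    intro n
    have h1 : ∀ k : ℤ, |((k + 1 : ℤ) : ℝ) / 2 ^ n - (k : ℝ) / 2 ^ n| = (2⁻¹) ^ n := by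
      intro k
      push_cast
      rw [← sub_div, add_sub_cancel_left, abs_of_pos (by positivity), one_div, inv_pow]
    simp only [D]
    rw [lintegral_finsetSum' _ fun k _ => (hYm _ _).const_mul _]
    calc _ ≤ ∑ k ∈ A n, ENNReal.ofReal (K * ((2⁻¹) ^ n * q ^ n)) := by
          refine Finset.sum_le_sum fun k _ => ?_
          rw [lintegral_const_mul' _ _ ENNReal.ofReal_ne_top]
          refine (mul_le_mul_right (h _ _) _).trans (le_of_eq ?_)
          rw [h1, hq2, ← ENNReal.ofReal_coe_nnreal, ← ENNReal.ofReal_mul (by positivity),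
            ← ENNReal.ofReal_mul (by positivity)]
          congr 1
          have : q⁻¹ ^ n * q ^ n = 1 := by rw [← mul_pow, inv_mul_cancel₀ hq0.ne', one_pow]
          linear_combination (K * (2⁻¹) ^ n * q ^ n) * this
      _ = ENNReal.ofReal (K * ((((A n).card : ℝ) * (2⁻¹) ^ n) * q ^ n)) := by
          rw [Finset.sum_const, nsmul_eq_mul, ← ENNReal.ofReal_natCast,
            ← ENNReal.ofReal_mul (by positivity)]
          congr 1; ring
      _ ≤ _ := by
          refine ENNReal.ofReal_le_ofReal ?_
          gcongr
          exact hcard n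
  have hsum : Summable fun n : ℕ => (K : ℝ) * ((2 * n + 3) * q ^ n) := by
    have s1 : Summable fun n : ℕ => (n : ℝ) * q ^ n := by
      simpa using summable_pow_mul_geometric_of_norm_lt_one 1
        (by rw [Real.norm_of_nonneg hq0.le]; exact hq1 : ‖q‖ < 1)
    have s2 := summable_geometric_of_lt_one hq0.le hq1
    refine (((s1.mul_left 2).add (s2.mul_left 3)).congr fun n => ?_).mul_left _
    ring
  have hDfin : ∑' n, ∫⁻ ω, D n ω ∂P ≠ ∞ := by
    refine ne_top_of_le_ne_top ?_ (ENNReal.tsum_le_tsum hDint)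
    rw [← ENNReal.ofReal_tsum_of_nonneg (fun n => by positivity) hsum]
    exact ENNReal.ofReal_ne_top
  -- the increments along the `n`-th dyadic grid are almost surely `O(r ^ n)`
  have hgood : ∀ᵐ ω ∂P, ∃ g : ℝ → ℝ, Continuous g ∧
      ∀ x, Tendsto (fun n => Y (dyadicFloor n x) ω) atTop (𝓝 (g x)) := by
    filter_upwards [ae_tsum_lt_top hDm hDfin] with ω hω
    set M : ℝ := (∑' n, D n ω).toReal with hM
    have hM0 : 0 ≤ M := ENNReal.toReal_nonneg
    refine exists_continuous_tendsto_dyadicFloor (f := fun x => Y x ω) (M := M + 1) hr0.le hr1 fun n k hk => ?_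
    have hkA : k ∈ A n := by
      simp only [A, Finset.mem_Icc]; exact abs_le.1 hk
    set d : ℝ := |Y (((k + 1 : ℤ) : ℝ) / 2 ^ n) ω - Y ((k : ℝ) / 2 ^ n) ω| with hd
    have h1 : ENNReal.ofReal (q⁻¹ ^ n * d ^ N) ≤ ∑' n, D n ω := by
      refine le_trans ?_ (ENNReal.le_tsum n)
      refine le_trans (le_of_eq ?_) (Finset.single_le_sum (fun _ _ => zero_le) hkA)
      rw [ENNReal.ofReal_mul (by positivity), ENNReal.ofReal_pow (abs_nonneg _),
        Real.enorm_eq_ofReal_abs]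
    have h2 : q⁻¹ ^ n * d ^ N ≤ M := (ENNReal.ofReal_le_iff_le_toReal hω.ne).1 h1
    have h3 : d ^ N ≤ ((M + 1) * r ^ n) ^ N := by
      rw [mul_pow, ← pow_mul, mul_comm n N, pow_mul, hrq]
      have h4 : d ^ N ≤ M * q ^ n := by
        rw [inv_pow, inv_mul_le_iff₀ (by positivity)] at h2
        linarith
      refine h4.trans (mul_le_mul_of_nonneg_right ?_ (by positivity))
      exact (by linarith : M ≤ M + 1).trans (le_self_pow₀ (by linarith) hN)
    exact le_of_pow_le_pow_left₀ hN (by positivity) h3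
  -- the limit along the grids is a version, by the moment bound for the distance to the grids
  have hconv : ∀ x, ∀ᵐ ω ∂P, Tendsto (fun n => Y (dyadicFloor n x) ω) atTop (𝓝 (Y x ω)) := by
    intro x
    have h1 : ∑' n : ℕ, ∫⁻ ω, ‖Y (dyadicFloor n x) ω - Y x ω‖ₑ ^ N ∂P ≠ ∞ := by
      have h2 : ∀ n, ∫⁻ ω, ‖Y (dyadicFloor n x) ω - Y x ω‖ₑ ^ N ∂P ≤
          ENNReal.ofReal (K * (2⁻¹) ^ n) := by
        intro n
        refine (h _ _).trans ?_
        rw [← ENNReal.ofReal_coe_nnreal, ← ENNReal.ofReal_mul (by positivity)]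
        refine ENNReal.ofReal_le_ofReal (mul_le_mul_of_nonneg_left ?_ K.2)
        rw [abs_sub_comm]
        have h3 : |x - dyadicFloor n x| ^ (1 + δ) ≤ ((2⁻¹ : ℝ) ^ n) ^ (1 + δ) :=
          Real.rpow_le_rpow (abs_nonneg _) (abs_sub_dyadicFloor_le n x) (by linarith)
        refine h3.trans ?_
        rw [hq2]
        refine mul_le_of_le_one_right (by positivity) ?_
        exact mul_le_one₀ (pow_le_one₀ hq0.le hq1.le) (by positivity) (pow_le_one₀ hq0.le hq1.le)
      refine ne_top_of_le_ne_top ?_ (ENNReal.tsum_le_tsum h2)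
      have s : Summable fun n : ℕ => (K : ℝ) * (2⁻¹) ^ n :=
        (summable_geometric_of_lt_one (by norm_num) (by norm_num)).mul_left _
      rw [← ENNReal.ofReal_tsum_of_nonneg (fun n => by positivity) s]
      exact ENNReal.ofReal_ne_top
    filter_upwards [ae_tsum_lt_top (fun n => hYm _ _) h1] with ω hω
    have h3 := ENNReal.tendsto_atTop_zero_of_tsum_ne_top hω.ne
    rw [tendsto_iff_edist_tendsto_0]
    have h4 : Tendsto (fun y : ℝ≥0∞ => y ^ ((N : ℝ)⁻¹)) (𝓝 0) (𝓝 0) := by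
      have := (ENNReal.continuous_rpow_const (y := (N : ℝ)⁻¹)).tendsto 0
      rwa [ENNReal.zero_rpow_of_pos (by positivity)] at this
    refine (h4.comp h3).congr fun n => ?_
    rw [Function.comp_apply, edist_eq_enorm_sub, ← ENNReal.rpow_natCast, ← ENNReal.rpow_mul,
      mul_inv_cancel₀ hN'.ne', ENNReal.rpow_one]
  classical
  refine ⟨fun x ω => if hω : ∃ g : ℝ → ℝ, Continuous g ∧
      ∀ x, Tendsto (fun n => Y (dyadicFloor n x) ω) atTop (𝓝 (g x)) then hω.choose x else 0,
    fun ω => ?_, fun x => ?_⟩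
  · by_cases hω : ∃ g : ℝ → ℝ, Continuous g ∧
      ∀ x, Tendsto (fun n => Y (dyadicFloor n x) ω) atTop (𝓝 (g x))
    · simp only [dif_pos hω]
      exact hω.choose_spec.1
    · simp only [dif_neg hω]
      exact continuous_const
  · filter_upwards [hgood, hconv x] with ω h1 h2
    rw [dif_pos h1]
    exact tendsto_nhds_unique (h1.choose_spec.2 x) h2

end

section

variable {Ω : Type*} [MeasurableSpace Ω] {P : Measure Ω}

/-- The even moments of a centered Gaussian variable are powers of its variance. -/
theorem lintegral_enorm_pow_of_map_eq_gaussianReal {Y : Ω → ℝ} (hY : AEMeasurable Y P) {v : ℝ≥0}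
    (h : P.map Y = gaussianReal 0 v) (n : ℕ) :
    ∫⁻ ω, ‖Y ω‖ₑ ^ (2 * n) ∂P = (∫⁻ x, ‖x‖ₑ ^ (2 * n) ∂(gaussianReal 0 1)) * (v : ℝ≥0∞) ^ n := by
  have h1 : gaussianReal 0 v = (gaussianReal 0 1).map ((√(v : ℝ)) * ·) := by
    rw [gaussianReal_map_const_mul]
    congr 1
    · simp
    · ext; simp
  have h2 : ∫⁻ x, ‖x‖ₑ ^ (2 * n) ∂(P.map Y) = ∫⁻ ω, ‖Y ω‖ₑ ^ (2 * n) ∂P :=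
    lintegral_map' (by fun_prop) hY
  rw [← h2, h, h1, lintegral_map (by fun_prop) (by fun_prop)]
  have h3 : ‖√(v : ℝ)‖ₑ ^ 2 = v := by
    rw [Real.enorm_of_nonneg (Real.sqrt_nonneg _), ← ENNReal.ofReal_pow (Real.sqrt_nonneg _),
      Real.sq_sqrt (NNReal.coe_nonneg v), ENNReal.ofReal_coe_nnreal]
  simp_rw [enorm_mul, mul_pow]
  rw [lintegral_const_mul' _ _ (by simp), pow_mul, h3, mul_comm]

theorem lintegral_gaussianReal_pow_lt_top (n : ℕ) :
    ∫⁻ x, ‖x‖ₑ ^ (2 * n) ∂(gaussianReal 0 1) < ∞ := by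
  rcases Nat.eq_zero_or_pos n with rfl | hn
  · simp
  have h1 := memLp_id_gaussianReal (μ := 0) (v := 1) ((2 * n : ℕ) : ℝ≥0)
  have h2 := eLpNorm_nnreal_pow_eq_lintegral (f := (id : ℝ → ℝ)) (μ := gaussianReal 0 1)
    (p := ((2 * n : ℕ) : ℝ≥0)) (by positivity)
  have h3 := ENNReal.rpow_lt_top_of_nonneg (y := (((2 * n : ℕ) : ℝ≥0) : ℝ)) (by positivity) h1.2.ne
  rw [h2] at h3
  simpa only [NNReal.coe_natCast, ENNReal.rpow_natCast, id] using! h3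

/-- A process whose increments are centered Gaussian variables with Hölder continuous variance has a
continuous version. -/
theorem exists_continuous_version_of_gaussian {Y : ℝ → Ω → ℝ} (hY : ∀ x, MemLp (Y x) 2 P)
    (hG : ∀ x y, P.map (fun ω => Y y ω - Y x ω) =
      gaussianReal 0 (eLpNorm (fun ω => Y y ω - Y x ω) 2 P ^ 2).toNNReal)
    {C h : ℝ} (hC : 0 ≤ C) (hh : 0 < h)
    (hv : ∀ x y, eLpNorm (fun ω => Y y ω - Y x ω) 2 P ^ 2 ≤ ENNReal.ofReal (C * |y - x| ^ h)) :
    ∃ Z : ℝ → Ω → ℝ, (∀ ω, Continuous fun x => Z x ω) ∧ ∀ x, Z x =ᵐ[P] Y x := by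
  -- the moment of order `2n` of an increment is of order `n h > 1` in its length
  obtain ⟨n, hn⟩ := exists_nat_gt (1 / h)
  have hn1 : 1 < n * h := by rwa [div_lt_iff₀ hh] at hn
  have hn0 : n ≠ 0 := by
    rintro rfl
    simp at hn1
    linarith
  have hM := lintegral_gaussianReal_pow_lt_top n
  refine exists_continuous_version (fun x => (hY x).1.aemeasurable) (N := 2 * n) (by positivity)
    (K := (∫⁻ x, ‖x‖ₑ ^ (2 * n) ∂(gaussianReal 0 1)).toNNReal * C.toNNReal ^ n)
    (δ := n * h - 1) (by linarith) fun x y => ?_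
  have hm : MemLp (fun ω => Y y ω - Y x ω) 2 P := (hY y).sub (hY x)
  rw [lintegral_enorm_pow_of_map_eq_gaussianReal hm.1.aemeasurable (hG x y) n,
    ENNReal.coe_toNNReal (ENNReal.pow_ne_top hm.2.ne), ENNReal.coe_mul, ENNReal.coe_toNNReal hM.ne,
    mul_assoc]
  gcongr
  refine (pow_le_pow_left' (hv x y) n).trans (le_of_eq ?_)
  rw [ENNReal.ofReal_mul hC, mul_pow, ENNReal.coe_pow,
    ← ENNReal.ofReal_pow (p := |y - x| ^ h) (by positivity)]
  refine congrArg₂ (· * ·) rfl (congrArg _ ?_)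
  rw [← Real.rpow_natCast, ← Real.rpow_mul (abs_nonneg _)]
  congr 1
  ring

/-! ### Integration of paths -/

theorem tendsto_riemannSum {f : ℝ → ℝ} (hf : Continuous f) :
    Tendsto (fun n : ℕ => ∑ i ∈ Finset.range (n + 1), ((n : ℝ) + 1)⁻¹ * f (i / (n + 1))) atTop
      (𝓝 (∫ r in (0 : ℝ)..1, f r)) := by
  have huc := isCompact_Icc (a := (0 : ℝ)) (b := 1) |>.uniformContinuousOn_of_continuous
    hf.continuousOn
  rw [Metric.uniformContinuousOn_iff] at huc
  rw [Metric.tendsto_atTop]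
  intro ε hε
  obtain ⟨δ, hδ, hd⟩ := huc (ε / 2) (by linarith)
  obtain ⟨N, hN⟩ := exists_nat_gt (1 / δ)
  refine ⟨N, fun n hn => ?_⟩
  have hn0 : (0 : ℝ) < n + 1 := by positivity
  have hnδ : ((n : ℝ) + 1)⁻¹ < δ := by
    rw [div_lt_iff₀ hδ] at hN
    rw [inv_lt_iff_one_lt_mul₀ hn0]
    have : (N : ℝ) ≤ n := by exact_mod_cast hn
    nlinarith
  have hstep : ∀ i : ℕ, ((i + 1 : ℕ) : ℝ) / (n + 1) - i / (n + 1) = ((n : ℝ) + 1)⁻¹ := by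
    intro i
    push_cast
    rw [← sub_div, add_sub_cancel_left, one_div]
  have h1 := intervalIntegral.sum_integral_adjacent_intervals (f := f) (μ := volume)
    (a := fun i : ℕ => (i : ℝ) / (n + 1)) (n := n + 1) fun i _ => hf.intervalIntegrable _ _
  have h2 : ((n + 1 : ℕ) : ℝ) / (n + 1) = 1 := by push_cast; exact div_self hn0.ne'
  simp only [h2] at h1
  rw [Nat.cast_zero, zero_div] at h1
  rw [← h1, dist_eq_norm, ← Finset.sum_sub_distrib]
  calc _ ≤ ∑ i ∈ Finset.range (n + 1), ε / 2 * ((n : ℝ) + 1)⁻¹ := by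
        refine norm_sum_le_of_le _ fun i hi => ?_
        have hi' : (i : ℝ) + 1 ≤ n + 1 := by
          have := Finset.mem_range.1 hi
          exact_mod_cast this
        have hle : (i : ℝ) / (n + 1) ≤ ((i + 1 : ℕ) : ℝ) / (n + 1) := by
          have := hstep i
          have : (0 : ℝ) < ((n : ℝ) + 1)⁻¹ := by positivity
          linarith
        have h3 : ((n : ℝ) + 1)⁻¹ * f (i / (n + 1)) =
            ∫ _ in (i : ℝ) / (n + 1)..((i + 1 : ℕ) : ℝ) / (n + 1), f (i / (n + 1)) := by
          rw [intervalIntegral.integral_const, hstep, smul_eq_mul]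
        rw [h3, ← intervalIntegral.integral_sub (by simp) (hf.intervalIntegrable _ _)]
        refine (intervalIntegral.norm_integral_le_of_norm_le_const (C := ε / 2) fun r hr => ?_).trans
          (le_of_eq ?_)
        · rw [Set.uIoc_of_le hle] at hr
          have hi0 : 0 ≤ (i : ℝ) / (n + 1) := by positivity
          have hi1 : ((i + 1 : ℕ) : ℝ) / (n + 1) ≤ 1 := by
            rw [div_le_one hn0]; push_cast; exact hi'
          rw [← dist_eq_norm]
          refine (hd _ ⟨hi0, hle.trans hi1⟩ _ ⟨hi0.trans hr.1.le, hr.2.trans hi1⟩ ?_).le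
          rw [dist_comm, Real.dist_eq, abs_of_pos (by linarith [hr.1])]
          linarith [hr.2, hstep i]
        · rw [hstep, abs_of_pos (by positivity)]
    _ = ε / 2 := by
        rw [Finset.sum_const, Finset.card_range, nsmul_eq_mul]
        push_cast
        field_simp
    _ < ε := by linarith

/-- If `V'` is the derivative of `V` in `L²(P)`, with a rate, then integrating a continuous version
of `V'` gives a version of `V`. -/
theorem ae_sub_eq_integral {V V' Z : ℝ → Ω → ℝ} (hV : ∀ x, MemLp (V x) 2 P)
    (hV' : ∀ x, MemLp (V' x) 2 P) {C ε : ℝ} (hε : 0 < ε)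
    (h : ∀ x y, eLpNorm (fun ω => V y ω - V x ω - (y - x) * V' x ω) 2 P ≤
      ENNReal.ofReal (C * |y - x| ^ (1 + ε)))
    (hZ : ∀ ω, Continuous fun x => Z x ω) (hZV : ∀ x, Z x =ᵐ[P] V' x) (x : ℝ) :
    ∀ᵐ ω ∂P, V x ω - V 0 ω = ∫ r in (0 : ℝ)..x, Z r ω := by
  let p : ℕ → ℕ → ℝ := fun n i => x * (i / (n + 1))
  let S : ℕ → Ω → ℝ := fun n ω =>
    ∑ i ∈ Finset.range (n + 1), (p n (i + 1) - p n i) * V' (p n i) ω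
  have hstep : ∀ n i, p n (i + 1) - p n i = x * ((n : ℝ) + 1)⁻¹ := by
    intro n i
    simp only [p]
    push_cast
    rw [← mul_sub, ← sub_div, add_sub_cancel_left, one_div]
  have hSm : ∀ n, AEStronglyMeasurable (S n) P := fun n =>
    Finset.aestronglyMeasurable_fun_sum _ fun i _ => ((hV' _).1.const_mul _)
  have hpath : ∀ ω, Tendsto (fun n : ℕ => ∑ i ∈ Finset.range (n + 1),
      (p n (i + 1) - p n i) * Z (p n i) ω) atTop (𝓝 (∫ r in (0 : ℝ)..x, Z r ω)) := by
    intro ω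
    have h1 := (tendsto_riemannSum (f := fun r => Z (x * r) ω)
      ((hZ ω).comp (continuous_const_mul x))).const_mul x
    have h2 : x * ∫ r in (0 : ℝ)..1, Z (x * r) ω = ∫ r in (0 : ℝ)..x, Z r ω := by
      have := intervalIntegral.smul_integral_comp_mul_left (a := 0) (b := 1) (fun r => Z r ω) x
      simpa using this
    rw [h2] at h1
    refine h1.congr fun n => ?_
    rw [Finset.mul_sum]
    refine Finset.sum_congr rfl fun i _ => ?_
    rw [hstep, mul_assoc]
  -- the Taylor remainders of `V` over `n + 1` intervals sum up to `O(n ^ (-ε))`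
  have hL2 : Tendsto (fun n => eLpNorm (S n - fun ω => V x ω - V 0 ω) 2 P) atTop (𝓝 0) := by
    have hb : ∀ n : ℕ, eLpNorm (S n - fun ω => V x ω - V 0 ω) 2 P ≤
        ENNReal.ofReal (C * |x| ^ (1 + ε) * (((n : ℝ) + 1) ^ (-ε))) := by
      intro n
      have hn0 : (0 : ℝ) < (n : ℝ) + 1 := by positivity
      have e1 : ((fun ω => V x ω - V 0 ω) - S n) = ∑ i ∈ Finset.range (n + 1),
          fun ω => V (p n (i + 1)) ω - V (p n i) ω - (p n (i + 1) - p n i) * V' (p n i) ω := by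
        ext ω
        rw [Finset.sum_apply, Finset.sum_sub_distrib,
          Finset.sum_range_sub (fun i => V (p n i) ω) (n + 1)]
        simp only [Pi.sub_apply, S]
        have e2 : p n (n + 1) = x := by
          simp only [p]; push_cast; rw [div_self hn0.ne', mul_one]
        have e3 : p n 0 = 0 := by simp [p]
        rw [e2, e3]
      rw [eLpNorm_sub_comm, e1]
      refine (eLpNorm_sum_le (fun i _ => (((hV _).1.sub (hV _).1).sub ((hV' _).1.const_mul _)))
        one_le_two).trans ?_
      refine (Finset.sum_le_sum fun i _ => h (p n i) (p n (i + 1))).trans (le_of_eq ?_)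
      simp_rw [hstep]
      rw [Finset.sum_const, Finset.card_range, nsmul_eq_mul, ← ENNReal.ofReal_natCast,
        ← ENNReal.ofReal_mul (by positivity)]
      congr 1
      rw [abs_mul, abs_of_pos (inv_pos.2 hn0), Real.mul_rpow (abs_nonneg _) (by positivity),
        Real.inv_rpow hn0.le, ← Real.rpow_neg hn0.le, show -(1 + ε) = -1 + -ε by ring,
        Real.rpow_add hn0, Real.rpow_neg_one]
      push_cast
      field_simp
    refine tendsto_of_tendsto_of_tendsto_of_le_of_le tendsto_const_nhds ?_ (fun _ => zero_le) hb
    rw [← ENNReal.ofReal_zero]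
    refine ENNReal.tendsto_ofReal ?_
    rw [← mul_zero (C * |x| ^ (1 + ε))]
    refine Tendsto.const_mul _ ?_
    exact (tendsto_rpow_neg_atTop hε).comp
      (tendsto_atTop_add_const_right _ _ tendsto_natCast_atTop_atTop)
  have hmeas := tendstoInMeasure_of_tendsto_eLpNorm (p := 2) (by norm_num) hSm
    ((hV x).1.sub (hV 0).1) hL2
  obtain ⟨ns, hns, hae⟩ := hmeas.exists_seq_tendsto_ae
  have hall : ∀ᵐ ω ∂P, ∀ n i, Z (p n i) ω = V' (p n i) ω := by
    rw [ae_all_iff]; intro n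
    rw [ae_all_iff]; intro i
    exact hZV _
  filter_upwards [hae, hall] with ω h1 h2
  refine tendsto_nhds_unique h1 (((hpath ω).comp hns.tendsto_atTop).congr fun n => ?_)
  simp only [Function.comp_apply, S, h2]

/-- A tower of processes, each of them the derivative in `L²(P)` of the previous one, has smooth
versions as soon as the top one has a continuous version. -/
theorem exists_contDiff_version (n : ℕ) {V : ℕ → ℝ → Ω → ℝ} (hV : ∀ k x, MemLp (V k x) 2 P)
    {ε : ℝ} (hε : 0 < ε)
    (h : ∀ k, k < n → ∃ C : ℝ, ∀ x y, eLpNorm (fun ω => V k y ω - V k x ω - (y - x) * V (k + 1) x ω) 2 P ≤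
      ENNReal.ofReal (C * |y - x| ^ (1 + ε)))
    (htop : ∃ Z : ℝ → Ω → ℝ, (∀ ω, Continuous fun x => Z x ω) ∧ ∀ x, Z x =ᵐ[P] V n x) :
    ∃ Z : ℝ → Ω → ℝ, (∀ ω, ContDiff ℝ n fun x => Z x ω) ∧ (∀ x, Z x =ᵐ[P] V 0 x) ∧
      ∀ x, (fun ω => iteratedDeriv n (fun y => Z y ω) x) =ᵐ[P] V n x := by
  induction n generalizing V with
  | zero =>
    obtain ⟨Z, h1, h2⟩ := htop
    exact ⟨Z, fun ω => contDiff_zero.2 (h1 ω), h2, by simpa using h2⟩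
  | succ n ih =>
    obtain ⟨Z', h1, h2, h3⟩ := ih (V := fun k => V (k + 1)) (fun k => hV (k + 1))
      (fun k hk => h (k + 1) (by omega)) htop
    have hc : ∀ ω, Continuous fun x => Z' x ω := fun ω => (h1 ω).continuous
    have hd : ∀ ω x, HasDerivAt (fun x => V 0 0 ω + ∫ r in (0 : ℝ)..x, Z' r ω) (Z' x ω) x :=
      fun ω x => ((hc ω).integral_hasStrictDerivAt 0 x).hasDerivAt.const_add _
    have hd' : ∀ ω, deriv (fun x => V 0 0 ω + ∫ r in (0 : ℝ)..x, Z' r ω) = fun x => Z' x ω :=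
      fun ω => funext fun x => (hd ω x).deriv
    refine ⟨fun x ω => V 0 0 ω + ∫ r in (0 : ℝ)..x, Z' r ω, fun ω => ?_, fun x => ?_, fun x => ?_⟩
    · push_cast
      rw [contDiff_succ_iff_deriv]
      refine ⟨fun x => (hd ω x).differentiableAt, by simp, ?_⟩
      rw [hd']
      exact h1 ω
    · obtain ⟨C, hC⟩ := h 0 (by omega)
      filter_upwards [ae_sub_eq_integral (hV 0) (hV 1) hε hC hc h2 x] with ω hω
      rw [← hω]; ring
    · filter_upwards [h3 x] with ω hω
      rw [iteratedDeriv_succ', hd']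
      exact hω

/-! ### Paths as random elements -/

/-- Continuous processes that are versions of each other are indistinguishable. -/
theorem ae_forall_eq_of_continuous {Y Z : ℝ → Ω → ℝ} (hY : ∀ᵐ ω ∂P, Continuous fun x => Y x ω)
    (hZ : ∀ᵐ ω ∂P, Continuous fun x => Z x ω) (h : ∀ x, Y x =ᵐ[P] Z x) :
    ∀ᵐ ω ∂P, ∀ x, Y x ω = Z x ω := by
  have h1 : ∀ᵐ ω ∂P, ∀ q : ℚ, Y q ω = Z q ω := ae_all_iff.2 fun q => h q
  filter_upwards [hY, hZ, h1] with ω h2 h3 h4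
  have := (Rat.isDenseEmbedding_coe_real.dense).equalizer h2 h3 (by
    ext q; exact h4 q)
  exact fun x => congrFun this x

/-- The path of a process with almost surely continuous paths is measurable for the product
`σ`-algebra, although this is generated by uncountably many coordinates. -/
theorem aemeasurable_path {Y : ℝ → Ω → ℝ} (hY : ∀ x, AEMeasurable (Y x) P)
    (hc : ∀ᵐ ω ∂P, Continuous fun x => Y x ω) : AEMeasurable (fun ω x => Y x ω) P := by
  classical
  have h1 : ∀ᵐ ω ∂P, (Continuous fun x => Y x ω) ∧ ∀ q : ℚ, Y q ω = (hY q).mk _ ω :=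
    hc.and (ae_all_iff.2 fun q => (hY q).ae_eq_mk)
  set N : Set Ω := toMeasurable P {ω | ¬ ((Continuous fun x => Y x ω) ∧
    ∀ q : ℚ, Y q ω = (hY q).mk _ ω)} with hN
  have hN0 : P N = 0 := by rw [hN, measure_toMeasurable]; exact h1
  have hNm : MeasurableSet N := measurableSet_toMeasurable _ _
  have hgood : ∀ ω ∉ N, (Continuous fun x => Y x ω) ∧ ∀ q : ℚ, Y q ω = (hY q).mk _ ω := by
    intro ω hω
    by_contra h2
    exact hω (subset_toMeasurable _ _ h2)
  -- off the null set `N`, each coordinate is a limit of coordinates at rational points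
  refine ⟨fun ω x => Nᶜ.indicator (Y x) ω, ?_, ?_⟩
  · refine measurable_pi_lambda _ fun x => ?_
    obtain ⟨q, hq⟩ : ∃ q : ℕ → ℚ, Tendsto (fun n => (q n : ℝ)) atTop (𝓝 x) := by
      obtain ⟨u, hu1, hu2⟩ := mem_closure_iff_seq_limit.1 (Rat.isDenseEmbedding_coe_real.dense x)
      choose q hq using hu1
      exact ⟨q, by simpa only [hq] using hu2⟩
    refine measurable_of_tendsto_metrizable (f := fun n => Nᶜ.indicator ((hY (q n)).mk _))
      (fun n => (hY (q n)).measurable_mk.indicator hNm.compl) ?_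
    rw [tendsto_pi_nhds]
    intro ω
    by_cases hω : ω ∈ N
    · have : ω ∉ Nᶜ := by simpa using hω
      simp only [Set.indicator_of_notMem this]
      exact tendsto_const_nhds
    · have h2 : ω ∈ Nᶜ := hω
      simp only [Set.indicator_of_mem h2]
      obtain ⟨h3, h4⟩ := hgood ω hω
      simp only [← h4]
      exact (h3.tendsto x).comp hq
  · have : ∀ᵐ ω ∂P, ω ∉ N := measure_eq_zero_iff_ae_notMem.1 hN0
    filter_upwards [this] with ω hω
    have h2 : ω ∈ Nᶜ := hω
    ext x
    rw [Set.indicator_of_mem h2]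

end

section

/-! ### Spectral estimates -/

theorem lintegral_comp_abs {F : ℝ → ℝ≥0∞} :
    ∫⁻ ξ, F |ξ| = 2 * ∫⁻ ξ in Set.Ioi (0 : ℝ), F ξ := by
  rw [← lintegral_add_compl _ (measurableSet_Ioi (a := (0 : ℝ))), Set.compl_Ioi, two_mul]
  congr 1
  · exact setLIntegral_congr_fun measurableSet_Ioi fun ξ hξ => by
      rw [abs_of_pos (show (0 : ℝ) < ξ from hξ)]
  · rw [setLIntegral_congr Iio_ae_eq_Iic.symm]
    have h6 := (Measure.measurePreserving_neg (volume : Measure ℝ)).setLIntegral_comp_preimage_emb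
      (Homeomorph.neg ℝ).measurableEmbedding (fun ξ => F |ξ|) (Set.Iio 0)
    have h7 : (fun ξ : ℝ => -ξ) ⁻¹' (Set.Iio 0) = Set.Ioi 0 := by ext; simp
    rw [← h6]
    change ∫⁻ ξ in (fun ξ : ℝ => -ξ) ⁻¹' (Set.Iio 0), F |(-ξ)| = _
    rw [h7]
    exact setLIntegral_congr_fun measurableSet_Ioi fun ξ hξ => by
      rw [abs_neg, abs_of_pos (show (0 : ℝ) < ξ from hξ)]

variable {α γ θ σ : ℝ} {S : Set ℝ} {ρ : ℝ → ℝ}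

theorem timeDensity_Ioo_comp_sub (α θ t : ℝ) :
    timeDensity α θ (Set.Ioo 0 t) (fun s => t - s) = timeDensity α θ (Set.Ioo 0 t) (fun s => s) := by
  ext ξ
  exact setLIntegral_Ioo_comp_sub
    (fun s => ENNReal.ofReal (Real.exp (-(2 * (θ * s) * |ξ| ^ α)))) t

theorem timeDensity_mono {S' : Set ℝ} (h : S ⊆ S') (ξ : ℝ) :
    timeDensity α θ S ρ ξ ≤ timeDensity α θ S' ρ ξ :=
  lintegral_mono_set h

theorem timeDensity_Ioi (α : ℝ) (hθ : 0 < θ) (t : ℝ) {ξ : ℝ} (hξ : ξ ≠ 0) :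
    timeDensity α θ (Set.Ioi t) (fun s => s) ξ =
      ENNReal.ofReal (Real.exp (-(2 * θ * t * |ξ| ^ α)) * ((2 * θ)⁻¹ * |ξ| ^ (-α))) := by
  have hξ' : 0 < |ξ| ^ α := by have := abs_pos.2 hξ; positivity
  have hb : -(2 * θ * |ξ| ^ α) < 0 := by
    have : 0 < 2 * θ * |ξ| ^ α := by positivity
    linarith
  have h1 := integrableOn_exp_mul_Ioi hb t
  have h2 := integral_exp_mul_Ioi hb t
  unfold timeDensity
  have h3 : ∀ s : ℝ, Real.exp (-(2 * (θ * s) * |ξ| ^ α)) = Real.exp (-(2 * θ * |ξ| ^ α) * s) := by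
    intro s; congr 1; ring
  simp_rw [h3]
  rw [← ofReal_integral_eq_lintegral_ofReal h1 (ae_of_all _ fun s => (Real.exp_pos _).le), h2,
    Real.rpow_neg (abs_nonneg _)]
  congr 1
  rw [show -(2 * θ * |ξ| ^ α) * t = -(2 * θ * t * |ξ| ^ α) by ring]
  field_simp

theorem timeDensity_Ioo_le (hθ : 0 < θ) (t ξ : ℝ) :
    timeDensity α θ (Set.Ioo 0 t) (fun s => s) ξ ≤ ENNReal.ofReal t := by
  calc _ ≤ ∫⁻ s in Set.Ioo 0 t, 1 := by
        refine setLIntegral_mono' measurableSet_Ioo fun s hs => ?_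
        rw [← ENNReal.ofReal_one]
        refine ENNReal.ofReal_le_ofReal (Real.exp_le_one_iff.2 ?_)
        have := hs.1
        have : 0 ≤ 2 * (θ * s) * |ξ| ^ α := by positivity
        linarith
    _ = _ := by rw [setLIntegral_one, Real.volume_Ioo, sub_zero]

/-- The times before and after `t` together make up almost all times. -/
theorem timeDensity_union {t : ℝ} (ht : 0 < t) :
    timeDensity α θ (Set.Ioo 0 t ∪ Set.Ioi t) (fun s => s) =
      timeDensity α θ (Set.Ioi 0) (fun s => s) := by
  ext ξ
  have h : (Set.Ioo 0 t ∪ Set.Ioi t : Set ℝ) =ᵐ[volume] Set.Ioi 0 := by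
    have h1 : (Set.Ioo 0 t ∪ Set.Ioi t : Set ℝ) =ᵐ[volume] (Set.Ioc 0 t ∪ Set.Ioi t : Set ℝ) :=
      Ioo_ae_eq_Ioc.union (ae_eq_refl _)
    rwa [Set.Ioc_union_Ioi_eq_Ioi ht.le] at h1
  exact setLIntegral_congr h

/-- The moment of order `2r` of the spectral measure. -/
def spectralMoment (α γ θ : ℝ) (S : Set ℝ) (ρ : ℝ → ℝ) (r : ℝ) : ℝ≥0∞ :=
  ∫⁻ ξ : ℝ, ENNReal.ofReal (|ξ| ^ (2 * r - 4 * γ)) * timeDensity α θ S ρ ξ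

theorem ae_ne_zero : ∀ᵐ ξ : ℝ, ξ ≠ 0 := compl_mem_ae_iff.2 (measure_singleton (0 : ℝ))

theorem spectralNorm_le {p : ℝ → ℂ} {A r : ℝ} (hA : 0 ≤ A)
    (h : ∀ ξ, ‖p ξ‖ ^ 2 ≤ A * |ξ| ^ (2 * r)) :
    spectralNorm α γ θ σ S ρ p ≤
      ENNReal.ofReal (σ ^ 2 / (2 * Real.pi)) * (ENNReal.ofReal A * spectralMoment α γ θ S ρ r) := by
  unfold spectralNorm spectralMoment
  rw [← lintegral_const_mul' (ENNReal.ofReal A) _ ENNReal.ofReal_ne_top]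
  refine mul_le_mul_right (lintegral_mono_ae ?_) _
  filter_upwards [ae_ne_zero] with ξ hξ
  rw [← mul_assoc, ← ENNReal.ofReal_mul hA]
  refine mul_le_mul_left (ENNReal.ofReal_le_ofReal ?_) _
  rw [sub_eq_add_neg, Real.rpow_add (abs_pos.2 hξ), ← mul_assoc]
  exact mul_le_mul_of_nonneg_right (h ξ) (by positivity)

theorem spectralNorm_mono {S' : Set ℝ} (h : S ⊆ S') (p : ℝ → ℂ) :
    spectralNorm α γ θ σ S ρ p ≤ spectralNorm α γ θ σ S' ρ p :=
  mul_le_mul_right (lintegral_mono fun ξ => mul_le_mul_right (timeDensity_mono h ξ) _) _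

/-- At small times the spectral measure decays like `|ξ|^(-4γ-α)` for large `ξ`, and is bounded by a
multiple of `|ξ|^(-4γ)` for small `ξ`. -/
theorem spectralMoment_Ioo_lt_top (hγ' : γ < 1 / 4) (hθ : 0 < θ) {r : ℝ} (hr : 0 ≤ r)
    (hr' : 2 * r - 4 * γ - α < -1) (t : ℝ) :
    spectralMoment α γ θ (Set.Ioo 0 t) (fun s => s) r < ∞ := by
  rcases le_or_gt t 0 with ht | ht
  · simp [spectralMoment, timeDensity, Set.Ioo_eq_empty_of_le ht]
  let F : ℝ → ℝ≥0∞ := fun ξ => if ξ ≤ 1 then ENNReal.ofReal (ξ ^ (2 * r - 4 * γ) * t) else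
    ENNReal.ofReal ((2 * θ)⁻¹ * ξ ^ (2 * r - 4 * γ - α))
  have h1 : spectralMoment α γ θ (Set.Ioo 0 t) (fun s => s) r ≤ ∫⁻ ξ, F |ξ| := by
    refine lintegral_mono_ae ?_
    filter_upwards [ae_ne_zero] with ξ hξ
    have hξ' := abs_pos.2 hξ
    simp only [F]
    split_ifs
    · rw [ENNReal.ofReal_mul (by positivity)]
      exact mul_le_mul_right (timeDensity_Ioo_le hθ t ξ) _
    · refine (mul_le_mul_right (timeDensity_mono Set.Ioo_subset_Ioi_self ξ) _).trans (le_of_eq ?_)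
      rw [timeDensity_Ioi α hθ 0 hξ, ← ENNReal.ofReal_mul (by positivity)]
      congr 1
      rw [sub_eq_add_neg _ α, Real.rpow_add hξ']
      simp
      ring
  refine h1.trans_lt ?_
  rw [lintegral_comp_abs, ← Set.Ioc_union_Ioi_eq_Ioi zero_le_one]
  refine ENNReal.mul_lt_top (by simp) ((lintegral_union_le _ _ _).trans_lt (ENNReal.add_lt_top.2 ⟨?_, ?_⟩))
  · have i1 := (intervalIntegral.intervalIntegrable_rpow' (a := 0) (b := 1) (r := 2 * r - 4 * γ)
      (by linarith)).mul_const t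
    rw [intervalIntegrable_iff_integrableOn_Ioc_of_le zero_le_one] at i1
    refine lt_of_le_of_lt (le_of_eq ?_) i1.2
    refine setLIntegral_congr_fun measurableSet_Ioc fun ξ hξ => ?_
    have : 0 < ξ := hξ.1
    simp only [F]
    rw [if_pos hξ.2, Real.enorm_of_nonneg (by positivity)]
  · have i1 := (integrableOn_Ioi_rpow_of_lt (a := 2 * r - 4 * γ - α) (by linarith)
      one_pos).const_mul (2 * θ)⁻¹
    refine lt_of_le_of_lt (le_of_eq ?_) i1.2
    refine setLIntegral_congr_fun measurableSet_Ioi fun ξ hξ => ?_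
    have h2 : 1 < ξ := hξ
    have : 0 < ξ := one_pos.trans h2
    simp only [F]
    rw [if_neg (not_le.2 h2), Real.enorm_of_nonneg (by positivity)]

/-- After time `t` the spectral measure decays like `exp (-2θt|ξ|^α)` for large `ξ`, so that all
high moments are finite. For small `ξ` it behaves like `|ξ|^(-4γ-α)`, which is why low moments are
infinite. -/
theorem spectralMoment_Ioi_lt_top (hα : 0 < α) (hθ : 0 < θ) {r : ℝ}
    (hr : -1 < 2 * r - 4 * γ - α) {t : ℝ} (ht : 0 < t) :
    spectralMoment α γ θ (Set.Ioi t) (fun s => s) r < ∞ := by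
  let F : ℝ → ℝ≥0∞ := fun ξ => ENNReal.ofReal ((2 * θ)⁻¹ *
    (ξ ^ (2 * r - 4 * γ - α) * Real.exp (-(2 * θ * t) * ξ ^ α)))
  have h1 : spectralMoment α γ θ (Set.Ioi t) (fun s => s) r = ∫⁻ ξ, F |ξ| := by
    refine lintegral_congr_ae ?_
    filter_upwards [ae_ne_zero] with ξ hξ
    have hξ' := abs_pos.2 hξ
    simp only [F]
    rw [timeDensity_Ioi α hθ t hξ, ← ENNReal.ofReal_mul (by positivity)]
    congr 1
    rw [sub_eq_add_neg _ α, Real.rpow_add hξ', neg_mul]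
    ring
  rw [h1, lintegral_comp_abs]
  refine ENNReal.mul_lt_top (by simp) ?_
  have i1 := (integrableOn_rpow_mul_exp_neg_mul_rpow hr hα
    (by positivity : 0 < 2 * θ * t)).const_mul (2 * θ)⁻¹
  refine lt_of_le_of_lt (le_of_eq ?_) i1.2
  refine setLIntegral_congr_fun measurableSet_Ioi fun ξ hξ => ?_
  have : (0 : ℝ) < ξ := hξ
  simp only [F]
  rw [Real.enorm_of_nonneg (by positivity)]

/-! ### Symbols of increments -/

theorem symbol_sub (k : ℕ) (x y ξ : ℝ) :
    symbol Finset.univ ![1, -1] ![k, k] ![y, x] ξ =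
      (Complex.I * ξ) ^ k * (Complex.exp (Complex.I * y * ξ) - Complex.exp (Complex.I * x * ξ)) := by
  simp [symbol]
  ring

theorem norm_symbol_sub_sq (k : ℕ) (x y ξ : ℝ) :
    ‖symbol Finset.univ ![1, -1] ![k, k] ![y, x] ξ‖ ^ 2 =
      2 * (1 - Real.cos ((y - x) * ξ)) * |ξ| ^ (2 * (k : ℝ)) := by
  have h1 : ‖Complex.exp (Complex.I * y * ξ) - Complex.exp (Complex.I * x * ξ)‖ ^ 2 =
      2 * (1 - Real.cos ((y - x) * ξ)) := by
    have e : ∀ u v : ℝ, Complex.I * u * v = ((u * v : ℝ) : ℂ) * Complex.I := by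
      intro u v; push_cast; ring
    rw [e, e, Complex.sq_norm, Complex.normSq_apply, Complex.sub_re, Complex.sub_im,
      Complex.exp_ofReal_mul_I_re, Complex.exp_ofReal_mul_I_re, Complex.exp_ofReal_mul_I_im,
      Complex.exp_ofReal_mul_I_im, show (y - x) * ξ = y * ξ - x * ξ by ring, Real.cos_sub]
    linear_combination Real.sin_sq_add_cos_sq (y * ξ) + Real.sin_sq_add_cos_sq (x * ξ)
  rw [symbol_sub, norm_mul, mul_pow, h1, norm_pow, norm_mul, Complex.norm_I, one_mul,
    Complex.norm_real, Real.norm_eq_abs, mul_comm, ← pow_mul, mul_comm k 2]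
  congr 1
  rw [← Real.rpow_natCast]
  push_cast
  rfl

theorem norm_symbol_sub_sq_le (k : ℕ) (x y ξ : ℝ) :
    ‖symbol Finset.univ ![1, -1] ![k, k] ![y, x] ξ‖ ^ 2 ≤
      (y - x) ^ 2 * |ξ| ^ (2 * ((k : ℝ) + 1)) := by
  rw [norm_symbol_sub_sq]
  have h1 := Real.one_sub_sq_div_two_le_cos (x := (y - x) * ξ)
  have h2 : |ξ| ^ (2 * ((k : ℝ) + 1)) = ξ ^ 2 * |ξ| ^ (2 * (k : ℝ)) := by
    rw [mul_add, mul_one, add_comm, Real.rpow_add_of_nonneg (abs_nonneg _) (by norm_num)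
      (by positivity), Real.rpow_two, sq_abs]
  rw [h2, ← mul_assoc]
  refine mul_le_mul_of_nonneg_right ?_ (by positivity)
  nlinarith

/-- Interpolation between the bounds of order one and two for the first order Taylor remainder. -/
theorem norm_cexp_sub_one_sub_le {ε : ℝ} (hε : 0 ≤ ε) (hε' : ε ≤ 1) (u : ℝ) :
    ‖Complex.exp (Complex.I * u) - 1 - Complex.I * u‖ ≤ 2 * |u| ^ (1 + ε) := by
  have hn : ‖Complex.I * (u : ℂ)‖ = |u| := by simp
  rcases le_or_gt |u| 1 with h | h
  · have h1 := Complex.norm_exp_sub_one_sub_id_le (x := Complex.I * u) (by rw [hn]; exact h)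
    rw [hn] at h1
    rcases eq_or_ne u 0 with rfl | h0
    · simp
      positivity
    · have h2 : |u| ^ (2 : ℝ) ≤ |u| ^ (1 + ε) :=
        Real.rpow_le_rpow_of_exponent_ge (abs_pos.2 h0) h (by linarith)
      rw [Real.rpow_two] at h2
      have : 0 ≤ |u| ^ (1 + ε) := by positivity
      linarith
  · have h1 := Real.norm_exp_I_mul_ofReal_sub_one_le (x := u)
    have h2 : |u| ^ (1 : ℝ) ≤ |u| ^ (1 + ε) :=
      Real.rpow_le_rpow_of_exponent_le h.le (by linarith)
    rw [Real.rpow_one] at h2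
    refine (norm_sub_le _ _).trans ?_
    rw [hn]
    rw [Real.norm_eq_abs] at h1
    linarith

/-- The symbol of the Taylor remainder `∂ᵏ(y) - ∂ᵏ(x) - (y - x) ∂ᵏ⁺¹(x)`. -/
theorem norm_symbol_taylor_sq_le (k : ℕ) {ε : ℝ} (hε : 0 ≤ ε) (hε' : ε ≤ 1) (x y ξ : ℝ) :
    ‖symbol Finset.univ ![1, -1, -(y - x)] ![k, k, k + 1] ![y, x, x] ξ‖ ^ 2 ≤
      4 * |y - x| ^ (2 * (1 + ε)) * |ξ| ^ (2 * ((k : ℝ) + 1 + ε)) := by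
  have h1 : symbol Finset.univ ![1, -1, -(y - x)] ![k, k, k + 1] ![y, x, x] ξ =
      (Complex.I * ξ) ^ k * Complex.exp (Complex.I * x * ξ) *
        (Complex.exp (Complex.I * (((y - x) * ξ : ℝ) : ℂ)) - 1 -
          Complex.I * (((y - x) * ξ : ℝ) : ℂ)) := by
    have h2 : Complex.exp (Complex.I * y * ξ) = Complex.exp (Complex.I * x * ξ) *
        Complex.exp (Complex.I * (((y - x) * ξ : ℝ) : ℂ)) := by
      rw [← Complex.exp_add]; congr 1; push_cast; ring
    simp only [symbol, Fin.sum_univ_three, Matrix.cons_val]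
    rw [h2]
    push_cast
    ring
  rw [h1, norm_mul, norm_mul, norm_cexp_I_mul_mul, mul_one, norm_pow, norm_mul, Complex.norm_I,
    one_mul, Complex.norm_real, Real.norm_eq_abs, mul_pow, ← pow_mul]
  have h3 := pow_le_pow_left₀ (norm_nonneg _) (norm_cexp_sub_one_sub_le hε hε' ((y - x) * ξ)) 2
  refine (mul_le_mul_of_nonneg_left h3 (by positivity)).trans (le_of_eq ?_)
  have h4 : |ξ| ^ (2 * ((k : ℝ) + 1 + ε)) = |ξ| ^ (k * 2) * |ξ| ^ (2 * (1 + ε)) := by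
    rw [show 2 * ((k : ℝ) + 1 + ε) = ((k * 2 : ℕ) : ℝ) + 2 * (1 + ε) by push_cast; ring,
      Real.rpow_add_of_nonneg (abs_nonneg _) (by positivity) (by positivity), Real.rpow_natCast]
  have h5 : ∀ w : ℝ, (|w| ^ (1 + ε)) ^ 2 = |w| ^ (2 * (1 + ε)) := by
    intro w
    rw [← Real.rpow_natCast, ← Real.rpow_mul (abs_nonneg _)]
    congr 1; push_cast; ring
  rw [mul_pow, h5, abs_mul, Real.mul_rpow (abs_nonneg _) (abs_nonneg _), h4]
  ring

/-! ### The constant of the fractional Brownian motion -/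

theorem constIntegrand_nonneg (α γ : ℝ) (m : ℕ) (ξ : ℝ) : 0 ≤ constIntegrand α γ m ξ :=
  mul_nonneg (by linarith [Real.cos_le_one ξ]) (Real.rpow_nonneg (abs_nonneg _) _)

theorem measurable_constIntegrand (α γ : ℝ) (m : ℕ) : Measurable (constIntegrand α γ m) := by
  unfold constIntegrand
  fun_prop

variable {m : ℕ}

/-- Near zero the integrand is `O(|ξ|^(2-1-2H))`, at infinity it is `O(|ξ|^(-1-2H))`, where
`H = s* - m`. -/
theorem integrable_constIntegrand (hH : optReg α γ - m ∈ Set.Ioo (0 : ℝ) 1) :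
    Integrable (constIntegrand α γ m) := by
  obtain ⟨h1, h2⟩ := hH
  unfold optReg at h1 h2
  set q : ℝ := 2 * (m : ℝ) - 4 * γ - α with hq
  refine ⟨(measurable_constIntegrand α γ m).aestronglyMeasurable, ?_⟩
  let F : ℝ → ℝ≥0∞ := fun ξ => if ξ ≤ 1 then ENNReal.ofReal (ξ ^ (2 + q)) else
    ENNReal.ofReal (2 * ξ ^ q)
  have h3 : ∫⁻ ξ, ‖constIntegrand α γ m ξ‖ₑ ≤ ∫⁻ ξ, F |ξ| := by
    refine lintegral_mono_ae ?_
    filter_upwards [ae_ne_zero] with ξ hξ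
    have hξ' := abs_pos.2 hξ
    rw [Real.enorm_of_nonneg (constIntegrand_nonneg _ _ _ _)]
    have h4 := Real.one_sub_sq_div_two_le_cos (x := ξ)
    have h5 := Real.neg_one_le_cos ξ
    have h6 : 0 ≤ |ξ| ^ q := by positivity
    simp only [F]
    split_ifs
    · refine ENNReal.ofReal_le_ofReal ?_
      rw [Real.rpow_add hξ', Real.rpow_two, sq_abs]
      exact mul_le_mul_of_nonneg_right (by nlinarith) h6
    · exact ENNReal.ofReal_le_ofReal (mul_le_mul_of_nonneg_right (by linarith) h6)
  refine h3.trans_lt ?_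
  rw [lintegral_comp_abs, ← Set.Ioc_union_Ioi_eq_Ioi zero_le_one]
  refine ENNReal.mul_lt_top (by simp) ((lintegral_union_le _ _ _).trans_lt (ENNReal.add_lt_top.2 ⟨?_, ?_⟩))
  · have i1 := intervalIntegral.intervalIntegrable_rpow' (a := 0) (b := 1) (r := 2 + q)
      (by linarith)
    rw [intervalIntegrable_iff_integrableOn_Ioc_of_le zero_le_one] at i1
    refine lt_of_le_of_lt (le_of_eq ?_) i1.2
    refine setLIntegral_congr_fun measurableSet_Ioc fun ξ hξ => ?_
    have : 0 < ξ := hξ.1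
    simp only [F]
    rw [if_pos hξ.2, Real.enorm_of_nonneg (by positivity)]
  · have i1 := (integrableOn_Ioi_rpow_of_lt (a := q) (by linarith) one_pos).const_mul 2
    refine lt_of_le_of_lt (le_of_eq ?_) i1.2
    refine setLIntegral_congr_fun measurableSet_Ioi fun ξ hξ => ?_
    have h2 : 1 < ξ := hξ
    have : 0 < ξ := one_pos.trans h2
    simp only [F]
    rw [if_neg (not_le.2 h2), Real.enorm_of_nonneg (by positivity)]

theorem fbmConst_pos (hH : optReg α γ - m ∈ Set.Ioo (0 : ℝ) 1) : 0 < fbmConst α γ m := by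
  have h1 : 0 < ∫ ξ : ℝ, constIntegrand α γ m ξ := by
    rw [integral_pos_iff_support_of_nonneg (constIntegrand_nonneg α γ m)
      (integrable_constIntegrand hH)]
    refine lt_of_lt_of_le ?_ (measure_mono (s := Set.Ioo (0 : ℝ) 1) fun ξ hξ => ?_)
    · simp
    · have h2 : Real.cos ξ < 1 := by
        have := Real.cos_lt_cos_of_nonneg_of_le_pi (x := 0) (y := ξ) le_rfl
          (by linarith [hξ.2, Real.pi_gt_three]) hξ.1
        rwa [Real.cos_zero] at this
      have : 0 < ξ := hξ.1
      exact (mul_pos (by linarith) (by positivity)).ne'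
  have := Real.pi_pos
  exact Real.sqrt_pos.2 (by positivity)

theorem fbmConst_sq : fbmConst α γ m ^ 2 =
    (2 * Real.pi)⁻¹ * ∫ ξ : ℝ, constIntegrand α γ m ξ := by
  have h1 : 0 ≤ ∫ ξ : ℝ, constIntegrand α γ m ξ := integral_nonneg (constIntegrand_nonneg α γ m)
  have := Real.pi_pos
  exact Real.sq_sqrt (by positivity)

/-- With the noise of all times, the increments of the `m`-th derivative have the variance of a
fractional Brownian motion: the spectral density is then a power of `|ξ|`, and the substitution of
`|y - x| ξ` for `ξ` scales it out. -/
theorem spectralNorm_sub_eq (hθ : 0 < θ) (hH : optReg α γ - m ∈ Set.Ioo (0 : ℝ) 1) {t : ℝ}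
    (ht : 0 < t) (x y : ℝ) :
    spectralNorm α γ θ σ (Set.Ioo 0 t ∪ Set.Ioi t) (fun s => s)
      (symbol Finset.univ ![1, -1] ![m, m] ![y, x]) =
      ENNReal.ofReal ((fbmConst α γ m * (σ / √θ)) ^ 2 * |y - x| ^ (2 * (optReg α γ - m))) := by
  have hpi := Real.pi_pos
  have hH0 := hH.1
  rcases eq_or_ne y x with rfl | hxy
  · rw [sub_self, abs_zero, Real.zero_rpow (by positivity), mul_zero, ENNReal.ofReal_zero,
      spectralNorm]
    simp [norm_symbol_sub_sq]
  have hd : 0 < |y - x| := abs_pos.2 (sub_ne_zero.2 hxy)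
  set q : ℝ := 2 * (m : ℝ) - 4 * γ - α with hq
  have h1 : ∀ᵐ ξ : ℝ, ENNReal.ofReal (‖symbol Finset.univ ![1, -1] ![m, m] ![y, x] ξ‖ ^ 2 *
      |ξ| ^ (-(4 * γ))) * timeDensity α θ (Set.Ioo 0 t ∪ Set.Ioi t) (fun s => s) ξ =
      ENNReal.ofReal (θ⁻¹ * |y - x| ^ (-q)) *
        ENNReal.ofReal (constIntegrand α γ m (|y - x| * ξ)) := by
    filter_upwards [ae_ne_zero] with ξ hξ
    have hξ' := abs_pos.2 hξ
    have hcos := Real.cos_le_one ((y - x) * ξ)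
    rw [timeDensity_union ht, timeDensity_Ioi α hθ 0 hξ, norm_symbol_sub_sq,
      ← ENNReal.ofReal_mul (mul_nonneg (mul_nonneg (by linarith) (by positivity)) (by positivity)),
      ← ENNReal.ofReal_mul (by positivity)]
    congr 1
    have e1 : Real.cos (|y - x| * ξ) = Real.cos ((y - x) * ξ) := by
      rcases abs_choice (y - x) with h | h
      · rw [h]
      · rw [h, neg_mul, Real.cos_neg]
    have e2 : |y - x| ^ (-q) * |y - x| ^ q = 1 := by
      rw [← Real.rpow_add hd]; simp
    have e3 : |ξ| ^ q = |ξ| ^ (2 * (m : ℝ)) * |ξ| ^ (-(4 * γ)) * |ξ| ^ (-α) := by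
      rw [← Real.rpow_add hξ', ← Real.rpow_add hξ']; congr 1
    unfold constIntegrand
    rw [e1, abs_mul, abs_abs, ← hq, Real.mul_rpow hd.le hξ'.le, e3, mul_zero, zero_mul, neg_zero,
      Real.exp_zero, mul_inv]
    linear_combination (-(θ⁻¹ * (1 - Real.cos ((y - x) * ξ)) * (|ξ| ^ (2 * (m : ℝ)) *
      |ξ| ^ (-(4 * γ)) * |ξ| ^ (-α)))) * e2
  have hI : 0 ≤ ∫ ξ : ℝ, constIntegrand α γ m ξ := integral_nonneg (constIntegrand_nonneg α γ m)
  rw [spectralNorm, lintegral_congr_ae h1, lintegral_const_mul' _ _ ENNReal.ofReal_ne_top,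
    lintegral_comp_mul_left hd (measurable_constIntegrand α γ m).ennreal_ofReal,
    ← ofReal_integral_eq_lintegral_ofReal (integrable_constIntegrand hH)
      (ae_of_all _ (constIntegrand_nonneg α γ m)), ← ENNReal.ofReal_mul (by positivity),
    ← ENNReal.ofReal_mul (by positivity), ← ENNReal.ofReal_mul (by positivity)]
  congr 1
  have e4 : |y - x| ^ (2 * (optReg α γ - m)) = |y - x| ^ (-q) * |y - x|⁻¹ := by
    rw [← Real.rpow_neg_one, ← Real.rpow_add hd]
    congr 1
    unfold optReg
    rw [hq]
    ring
  rw [e4, mul_pow, fbmConst_sq, div_pow, Real.sq_sqrt hθ.le]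
  field_simp

end

section

/-! ### Wiener integrals of the heat kernel and its derivatives -/

/-- The conditions on the times `S` and the clock `ρ` under which `heatField` is measurable, and
continuous on `S × ℝ`: the kernels are only evaluated at positive times. -/
structure IsClock (S : Set ℝ) (ρ : ℝ → ℝ) : Prop where
  measurableSet : MeasurableSet S
  subset : S ⊆ Set.Ioi 0
  continuous : Continuous ρ
  pos : ∀ s ∈ S, 0 < ρ s

theorem isClock_Ioo_sub (t : ℝ) : IsClock (Set.Ioo 0 t) (fun s => t - s) :=
  ⟨measurableSet_Ioo, fun _ hs => hs.1, by fun_prop, fun _ hs => sub_pos.2 hs.2⟩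

theorem isClock_id {S : Set ℝ} (hS : MeasurableSet S) (h : S ⊆ Set.Ioi 0) :
    IsClock S (fun s => s) := ⟨hS, h, continuous_id, fun _ hs => h hs⟩

theorem isClock_Ioo (t : ℝ) : IsClock (Set.Ioo 0 t) (fun s => s) :=
  isClock_id measurableSet_Ioo fun _ hs => hs.1

theorem isClock_Ioi {t : ℝ} (ht : 0 < t) : IsClock (Set.Ioi t) (fun s => s) :=
  isClock_id measurableSet_Ioi fun _ hs => ht.trans hs

variable {α γ θ σ : ℝ} {S : Set ℝ} {ρ : ℝ → ℝ}

theorem IsClock.measurable_heatField (h : IsClock S ρ) (hα : 0 < α) (hθ : 0 < θ) (σ : ℝ) (k : ℕ)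
    (x : ℝ) : Measurable (Function.uncurry (heatField α θ σ S ρ k x)) :=
  RieszSPDE.measurable_heatField hα hθ h.measurableSet h.continuous.measurable h.pos k x

theorem energy_heatField_lt_top (hα : 0 < α) (hγ : 0 < γ) (hγ' : γ < 1 / 4) (hθ : 0 < θ)
    (h : IsClock S ρ) (k : ℕ)
    (hS : ∫⁻ s in S, ENNReal.ofReal ((θ * ρ s) ^ (-((1 - 4 * γ + 2 * k) / α))) < ∞) (x : ℝ) :
    energy γ (heatField α θ σ S ρ k x) < ∞ := by
  rw [energy_heatField hα hθ h.measurableSet h.subset h.continuous.measurable h.pos]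
  exact ENNReal.mul_lt_top ENNReal.ofReal_lt_top
    (ENNReal.mul_lt_top hS (heatEnergy_lt_top hα hγ hγ' k))

/-- The increments of a derivative of the heat kernel are dominated by a rescaled profile, with the
decay of the next derivative. -/
theorem exists_abs_heatDeriv_sub_le (hα : 0 < α) (k : ℕ) {τ₀ : ℝ} (hτ₀ : 0 < τ₀) (x y : ℝ) :
    ∃ A, ∀ τ, τ₀ ≤ τ → ∀ z, |heatDeriv α k τ (y - z) - heatDeriv α k τ (x - z)| ≤
      |A * (τ ^ (-(1 / α))) ^ (k + 2) * (1 + (τ ^ (-(1 / α)) * (x - z)) ^ 2)⁻¹| := by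
  obtain ⟨C, hC⟩ := exists_heatDeriv_succ_le hα k
  have hC0 : 0 ≤ C := by
    have := (abs_nonneg _).trans (hC 0)
    simpa using this
  set c₀ : ℝ := τ₀ ^ (-(1 / α)) with hc₀
  have hc₀0 : 0 < c₀ := by positivity
  set B : ℝ := 2 + 2 * c₀ ^ 2 * (y - x) ^ 2 with hB
  have hB0 : 0 < B := by positivity
  refine ⟨C * B * |y - x|, fun τ hτ z => ?_⟩
  have hτ0 : 0 < τ := hτ₀.trans_le hτ
  set c : ℝ := τ ^ (-(1 / α)) with hc
  have hc0 : 0 < c := by positivity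
  have hcc : c ≤ c₀ := Real.rpow_le_rpow_of_nonpos hτ₀ hτ (by
    have : 0 < 1 / α := by positivity
    linarith)
  have hder : ∀ w ∈ Set.uIcc (x - z) (y - z), ‖heatDeriv α (k + 1) τ w‖ ≤
      C * B * c ^ (k + 2) * (1 + (c * (x - z)) ^ 2)⁻¹ := by
    intro w hw
    have hwx : (x - z - w) ^ 2 ≤ (y - x) ^ 2 := by
      have h1 := Set.abs_sub_left_of_mem_uIcc hw
      rw [show y - z - (x - z) = y - x by ring] at h1
      rw [← sq_abs, ← sq_abs (y - x), abs_sub_comm]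
      exact pow_le_pow_left₀ (abs_nonneg _) h1 2
    have h2 : 1 + (c * (x - z)) ^ 2 ≤ B * (1 + (c * w) ^ 2) := by
      have h3 : (x - z) ^ 2 ≤ 2 * w ^ 2 + 2 * (y - x) ^ 2 := by nlinarith [sq_nonneg (x - z - 2 * w)]
      have h4 : c ^ 2 ≤ c₀ ^ 2 := pow_le_pow_left₀ hc0.le hcc 2
      have h5 : c ^ 2 * (x - z) ^ 2 ≤ 2 * (c ^ 2 * w ^ 2) + 2 * c₀ ^ 2 * (y - x) ^ 2 := by
        nlinarith [sq_nonneg c, sq_nonneg (y - x)]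
      have h6 : 0 ≤ 2 * c₀ ^ 2 * (y - x) ^ 2 * (c * w) ^ 2 := by positivity
      rw [hB, mul_pow, mul_pow]
      rw [mul_pow] at h6
      nlinarith [mul_nonneg (sq_nonneg c) (sq_nonneg w)]
    rw [heatDeriv_scaling hα hτ0, ← hc, Real.norm_eq_abs, abs_mul, abs_of_pos (by positivity)]
    have h7 : (1 + (c * w) ^ 2)⁻¹ ≤ B * (1 + (c * (x - z)) ^ 2)⁻¹ := by
      rw [inv_le_iff_one_le_mul₀ (by positivity), mul_right_comm, ← div_eq_mul_inv,
        le_div_iff₀ (by positivity), one_mul]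
      exact h2
    calc c ^ (k + 1 + 1) * |heatDeriv α (k + 1) 1 (c * w)|
        ≤ c ^ (k + 2) * (C * (B * (1 + (c * (x - z)) ^ 2)⁻¹)) := by
          refine mul_le_mul_of_nonneg_left ((hC _).trans ?_) (by positivity)
          exact mul_le_mul_of_nonneg_left h7 hC0
      _ = _ := by ring
  have h8 := (convex_uIcc (x - z) (y - z)).norm_image_sub_le_of_norm_hasDerivWithin_le
    (fun w _ => (hasDerivAt_heatDeriv hα hτ0 k w).hasDerivWithinAt) hder
    Set.left_mem_uIcc Set.right_mem_uIcc
  rw [Real.norm_eq_abs, Real.norm_eq_abs, show y - z - (x - z) = y - x by ring] at h8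
  refine h8.trans (le_trans (le_of_eq ?_) (le_abs_self _))
  ring

/-- After time `t` the increments of a field have finite energy even if the field itself has not:
for large times they decay like the next derivative. -/
theorem energy_heatField_sub_lt_top (hα : 0 < α) (hγ : 0 < γ) (hγ' : γ < 1 / 4) (hθ : 0 < θ)
    (k : ℕ) {t : ℝ} (ht : 0 < t) (hq : 1 < (1 - 4 * γ + 2 * (k + 1)) / α) (x y : ℝ) :
    energy γ (fun s z => heatField α θ σ (Set.Ioi t) (fun s => s) k y s z -
      heatField α θ σ (Set.Ioi t) (fun s => s) k x s z) < ∞ := by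
  obtain ⟨A, hA⟩ := exists_abs_heatDeriv_sub_le hα k (mul_pos hθ ht) x y
  let g : ℝ → ℝ := fun u => (1 + u ^ 2)⁻¹
  have hg : Measurable g := by fun_prop
  have hgE : spatialEnergy γ g < ∞ := by
    refine spatialEnergy_lt_top hγ hγ' (C := 2) fun u => ?_
    simp only [g]
    rw [abs_of_pos (by positivity), ← div_eq_mul_inv, inv_eq_one_div,
      div_le_div_iff₀ (by positivity) (by positivity), one_mul, ← sq_abs]
    nlinarith [sq_nonneg (|u| - 1), abs_nonneg u]
  let ψ : ℝ → ℝ → ℝ := fun s z => (Set.Ioi t).indicator (fun s => σ * (A *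
    ((θ * s) ^ (-(1 / α))) ^ (k + 2) * g ((θ * s) ^ (-(1 / α)) * (x - z)))) s
  have h1 : energy γ (fun s z => heatField α θ σ (Set.Ioi t) (fun s => s) k y s z -
      heatField α θ σ (Set.Ioi t) (fun s => s) k x s z) ≤ energy γ ψ := by
    refine energy_mono hγ hγ' fun s _ z => ?_
    by_cases hs : s ∈ Set.Ioi t
    · simp only [heatField, ψ, Set.indicator_of_mem hs]
      rw [← mul_sub, abs_mul, abs_mul σ]
      exact mul_le_mul_of_nonneg_left (hA _ (mul_le_mul_of_nonneg_left (le_of_lt hs) hθ.le) z)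
        (abs_nonneg _)
    · simp [heatField, ψ, Set.indicator_of_notMem hs]
  refine h1.trans_lt ?_
  have h2 : ∀ s, spatialEnergy γ (ψ s) = (Set.Ioi t).indicator (fun s =>
      ENNReal.ofReal ((σ * A) ^ 2) * (ENNReal.ofReal ((θ * s) ^ (-((1 - 4 * γ + 2 * (k + 1)) / α))) *
        spatialEnergy γ g)) s := by
    intro s
    by_cases hs : s ∈ Set.Ioi t
    · have hs0 : 0 < s := ht.trans hs
      have hc : 0 < (θ * s) ^ (-(1 / α)) := by positivity
      have e1 : ψ s = fun z => (σ * A * ((θ * s) ^ (-(1 / α))) ^ (k + 2)) *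
          g ((θ * s) ^ (-(1 / α)) * (x - z)) := by
        ext z
        simp only [ψ, Set.indicator_of_mem hs]
        ring
      rw [e1, Set.indicator_of_mem hs, spatialEnergy_const_mul, spatialEnergy_comp hg hc, mul_pow,
        ENNReal.ofReal_mul (by positivity), mul_assoc, ← mul_assoc (ENNReal.ofReal _) _
        (spatialEnergy γ g), ← ENNReal.ofReal_mul (by positivity)]
      congr 3
      rw [← pow_mul, ← Real.rpow_natCast, ← Real.rpow_add hc, ← Real.rpow_mul (by positivity)]
      congr 1
      push_cast
      field_simp
      ring
    · rw [Set.indicator_of_notMem hs]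
      simp [spatialEnergy, ψ, Set.indicator_of_notMem hs]
  rw [energy_eq_lintegral_spatialEnergy]
  simp_rw [h2]
  rw [setLIntegral_indicator measurableSet_Ioi, Set.Ioi_inter_Ioi, max_eq_left ht.le,
    lintegral_const_mul' _ _ ENNReal.ofReal_ne_top, lintegral_mul_const _ (by fun_prop)]
  exact ENNReal.mul_lt_top ENNReal.ofReal_lt_top
    (ENNReal.mul_lt_top (lintegral_Ioi_rpow_lt_top hθ ht hq) hgE)

theorem isApproximable_Ioo (hγ : 0 < γ) (hγ' : γ < 1 / 4) {φ : ℝ → ℝ → ℝ} {t : ℝ} (ht : 0 < t)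
    (hφ : Measurable (Function.uncurry φ)) (hE : energy γ φ < ∞)
    (hc : ContinuousOn (Function.uncurry φ) (Set.Ioo 0 t ×ˢ Set.univ))
    (h0 : ∀ s ∉ Set.Ioo 0 t, ∀ z, φ s z = 0) : IsApproximable γ φ := by
  have hlim : Tendsto (fun n : ℕ => t / ((n : ℝ) + 2)) atTop (𝓝 0) :=
    tendsto_const_nhds.div_atTop
      (tendsto_atTop_add_const_right _ _ tendsto_natCast_atTop_atTop)
  have hpos : ∀ n : ℕ, 0 < t / ((n : ℝ) + 2) := fun n => by positivity
  refine isApproximable_of_continuousOn hγ hγ' (S := Set.Ioo 0 t)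
    (a := fun n => t / ((n : ℝ) + 2)) (b := fun n => t - t / ((n : ℝ) + 2))
    (fun n => (hpos n).le) (fun n => ?_) (fun n s hs => ?_) (fun s hs => ?_) hφ hE hc h0
  · have h1 : t / ((n : ℝ) + 2) ≤ t / 2 := by
      gcongr
      linarith [(n.cast_nonneg : (0 : ℝ) ≤ n)]
    linarith
  · exact ⟨(hpos n).trans_le hs.1, by linarith [hs.2, hpos n]⟩
  · filter_upwards [hlim.eventually_lt_const hs.1,
      hlim.eventually_lt_const (sub_pos.2 hs.2)] with n h1 h2
    exact ⟨h1, by linarith⟩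

theorem isApproximable_Ioi (hγ : 0 < γ) (hγ' : γ < 1 / 4) {φ : ℝ → ℝ → ℝ} {t : ℝ} (ht : 0 < t)
    (hφ : Measurable (Function.uncurry φ)) (hE : energy γ φ < ∞)
    (hc : ContinuousOn (Function.uncurry φ) (Set.Ioi t ×ˢ Set.univ))
    (h0 : ∀ s ∉ Set.Ioi t, ∀ z, φ s z = 0) : IsApproximable γ φ := by
  have hpos : ∀ n : ℕ, 0 < 1 / ((n : ℝ) + 1) := fun n => by positivity
  refine isApproximable_of_continuousOn hγ hγ' (S := Set.Ioi t)
    (a := fun n => t + 1 / ((n : ℝ) + 1)) (b := fun n => t + 1 + n)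
    (fun n => by linarith [hpos n]) (fun n => ?_) (fun n s hs => ?_) (fun s hs => ?_) hφ hE hc h0
  · have h1 : 1 / ((n : ℝ) + 1) ≤ 1 := by
      rw [div_le_one (by positivity)]
      linarith [(n.cast_nonneg : (0 : ℝ) ≤ n)]
    linarith [(n.cast_nonneg : (0 : ℝ) ≤ n)]
  · exact (by linarith [hpos n] : t < t + 1 / ((n : ℝ) + 1)).trans_le hs.1
  · have hs' : t < s := hs
    filter_upwards [tendsto_one_div_add_atTop_nhds_zero_nat.eventually_lt_const (sub_pos.2 hs'),
      tendsto_natCast_atTop_atTop.eventually_ge_atTop s] with n h1 h2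
    exact ⟨by linarith, by linarith⟩

variable {Ω : Type*} [MeasurableSpace Ω] {P : Measure Ω} {W : ℝ≥0 × BddBorel → Ω → ℝ}

theorem heatField_of_notMem {s : ℝ} (hs : s ∉ S) (k : ℕ) (x z : ℝ) :
    heatField α θ σ S ρ k x s z = 0 := Set.indicator_of_notMem hs _

theorem exists_wienerIntegral_Ioo (hα : 0 < α) (hγ : 0 < γ) (hγ' : γ < 1 / 4) (hθ : 0 < θ)
    (hW : IsRieszNoise P γ W) {t : ℝ} (ht : 0 < t) (h : IsClock (Set.Ioo 0 t) ρ) (k : ℕ) (x : ℝ)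
    (hE : energy γ (heatField α θ σ (Set.Ioo 0 t) ρ k x) < ∞) :
    ∃ Y, IsWienerIntegral P γ W (heatField α θ σ (Set.Ioo 0 t) ρ k x) Y := by
  have hm := h.measurable_heatField hα hθ σ k x
  exact (isApproximable_Ioo hγ hγ' ht hm hE (continuousOn_heatField hα hθ h.continuous h.pos k x)
    fun s hs z => heatField_of_notMem hs k x z).exists_wienerIntegral hγ hγ' hW hm

/-- The variance of a Wiener integral whose integrand is a combination of the kernels `heatField`
of finite energy, even if the energy of the summands is infinite. -/
theorem eLpNorm_sq_eq_spectralNorm (hα : 0 < α) (hγ : 0 < γ) (hγ' : γ < 1 / 4) (hθ : 0 < θ)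
    (hW : IsRieszNoise P γ W) (hS : IsClock S ρ) {φ : ℝ → ℝ → ℝ} {Y : Ω → ℝ}
    (h : IsWienerIntegral P γ W φ Y) (hE : energy γ φ < ∞)
    {ι : Type*} (I : Finset ι) (a : ι → ℝ) (k : ι → ℕ) (x : ι → ℝ)
    (hφ : ∀ s z, φ s z = ∑ i ∈ I, a i * heatField α θ σ S ρ (k i) (x i) s z) :
    eLpNorm Y 2 P ^ 2 = spectralNorm α γ θ σ S ρ (symbol I a k x) := by
  obtain rfl : φ = fun s z => ∑ i ∈ I, a i * heatField α θ σ S ρ (k i) (x i) s z :=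
    funext fun s => funext fun z => hφ s z
  have hm : Measurable (Function.uncurry fun s z =>
      ∑ i ∈ I, a i * heatField α θ σ S ρ (k i) (x i) s z) :=
    Finset.measurable_sum _ fun i _ => (hS.measurable_heatField hα hθ σ _ _).const_mul _
  rw [h.eLpNorm_eq hγ hγ' hW hm hE, eLpNorm_sq_sum_heatField I a k x hα hγ hθ hS.measurableSet
    hS.subset hS.continuous.measurable hS.pos]

end

section

/-! ### Regularity of the mild solution and of the remainder -/

variable {α γ θ σ : ℝ} {m : ℕ}

/-- The energy at time `s` of the `k`-th derivative is of order `s ^ (-(1 - 4γ + 2k) / α)`, which is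
integrable at zero for `k ≤ m`, since `s* > m`. -/
theorem heatExponent_lt_one (hα : 0 < α) (hH : optReg α γ - m ∈ Set.Ioo (0 : ℝ) 1) {k : ℕ}
    (hk : k ≤ m) : (1 - 4 * γ + 2 * (k : ℝ)) / α < 1 := by
  have h1 := hH.1
  unfold optReg at h1
  have h2 : (k : ℝ) ≤ m := by exact_mod_cast hk
  rw [div_lt_one hα]
  linarith

/-- The energies of the derivatives of order greater than `m` are integrable at infinity, since
`s* < m + 1`. -/
theorem one_lt_heatExponent (hα : 0 < α) (hH : optReg α γ - m ∈ Set.Ioo (0 : ℝ) 1) {k : ℕ}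
    (hk : m ≤ k) : 1 < (1 - 4 * γ + 2 * ((k : ℝ) + 1)) / α := by
  have h1 := hH.2
  unfold optReg at h1
  have h2 : (m : ℝ) ≤ k := by exact_mod_cast hk
  rw [one_lt_div hα]
  linarith

theorem le_ofReal_of_sq_le {a : ℝ≥0∞} {C h r : ℝ} (hC : 0 ≤ C) (hh : 0 ≤ h)
    (ha : a ^ 2 ≤ ENNReal.ofReal (C * h ^ (2 * r))) : a ≤ ENNReal.ofReal (√C * h ^ r) := by
  by_contra! h1
  have h2 := ENNReal.pow_lt_pow_left two_ne_zero h1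
  rw [← ENNReal.ofReal_pow (by positivity), mul_pow, Real.sq_sqrt hC, ← Real.rpow_natCast (h ^ r),
    ← Real.rpow_mul hh] at h2
  refine absurd ha (not_le.2 ?_)
  convert! h2 using 4
  push_cast
  ring

theorem spectralNorm_taylor_le {S : Set ℝ} {ρ : ℝ → ℝ} {k : ℕ} {ε : ℝ} (hε : 0 ≤ ε) (hε' : ε ≤ 1)
    (hM : spectralMoment α γ θ S ρ ((k : ℝ) + 1 + ε) < ∞) : ∃ C : ℝ, 0 ≤ C ∧ ∀ x y : ℝ,
      spectralNorm α γ θ σ S ρ (symbol Finset.univ ![1, -1, -(y - x)] ![k, k, k + 1] ![y, x, x]) ≤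
        ENNReal.ofReal (C * |y - x| ^ (2 * (1 + ε))) := by
  have hpi := Real.pi_pos
  set M := (spectralMoment α γ θ S ρ ((k : ℝ) + 1 + ε)).toReal with hMdef
  have hM0 : 0 ≤ M := ENNReal.toReal_nonneg
  refine ⟨σ ^ 2 / (2 * Real.pi) * 4 * M, by positivity, fun x y => ?_⟩
  refine (spectralNorm_le (by positivity) (norm_symbol_taylor_sq_le k hε hε' x y)).trans
    (le_of_eq ?_)
  rw [← ENNReal.ofReal_toReal hM.ne, ← ENNReal.ofReal_mul (by positivity),
    ← ENNReal.ofReal_mul (by positivity)]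
  congr 1
  ring

theorem spectralNorm_sub_le {S : Set ℝ} {ρ : ℝ → ℝ} {k : ℕ}
    (hM : spectralMoment α γ θ S ρ ((k : ℝ) + 1) < ∞) : ∃ C : ℝ, 0 ≤ C ∧ ∀ x y : ℝ,
      spectralNorm α γ θ σ S ρ (symbol Finset.univ ![1, -1] ![k, k] ![y, x]) ≤
        ENNReal.ofReal (C * |y - x| ^ (2 : ℝ)) := by
  have hpi := Real.pi_pos
  set M := (spectralMoment α γ θ S ρ ((k : ℝ) + 1)).toReal with hMdef
  have hM0 : 0 ≤ M := ENNReal.toReal_nonneg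
  refine ⟨σ ^ 2 / (2 * Real.pi) * M, by positivity, fun x y => ?_⟩
  refine (spectralNorm_le (by positivity) (norm_symbol_sub_sq_le k x y)).trans (le_of_eq ?_)
  rw [← ENNReal.ofReal_toReal hM.ne, ← ENNReal.ofReal_mul (by positivity),
    ← ENNReal.ofReal_mul (by positivity), Real.rpow_two, sq_abs]
  congr 1
  ring

variable {Ω : Type*} [MeasurableSpace Ω] {P : Measure Ω} {W : ℝ≥0 × BddBorel → Ω → ℝ}

/-- The energies of the derivatives up to order `m` are finite at small times. The clock may run
forwards or backwards. -/
theorem energy_heatField_Ioo_lt_top (hα : 0 < α) (hγ : 0 < γ) (hγ' : γ < 1 / 4) (hθ : 0 < θ)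
    (hH : optReg α γ - m ∈ Set.Ioo (0 : ℝ) 1) {t : ℝ} (ht : 0 < t) {k : ℕ} (hk : k ≤ m) (x : ℝ) :
    energy γ (heatField α θ σ (Set.Ioo 0 t) (fun s => s) k x) < ∞ ∧
    energy γ (heatField α θ σ (Set.Ioo 0 t) (fun s => t - s) k x) < ∞ := by
  have h1 := lintegral_Ioo_rpow_lt_top hθ ht (heatExponent_lt_one hα hH hk)
  refine ⟨energy_heatField_lt_top hα hγ hγ' hθ (isClock_Ioo t) k h1 x,
    energy_heatField_lt_top hα hγ hγ' hθ (isClock_Ioo_sub t) k ?_ x⟩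
  rwa [setLIntegral_Ioo_comp_sub
    (fun s => ENNReal.ofReal ((θ * s) ^ (-((1 - 4 * γ + 2 * (k : ℝ)) / α))))]

theorem mildKernel_eq_heatField (α θ σ t x : ℝ) :
    mildKernel α θ σ t x = heatField α θ σ (Set.Ioo 0 t) (fun s => t - s) 0 x := by
  ext s z
  simp [mildKernel, heatField, heatDeriv]

theorem spectralNorm_Ioo_comp_sub (α γ θ σ t : ℝ) (p : ℝ → ℂ) :
    spectralNorm α γ θ σ (Set.Ioo 0 t) (fun s => t - s) p =
      spectralNorm α γ θ σ (Set.Ioo 0 t) (fun s => s) p := by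
  unfold spectralNorm
  rw [timeDensity_Ioo_comp_sub]

section

variable (hα : 0 < α) (hγ : 0 < γ) (hγ' : γ < 1 / 4) (hθ : 0 < θ)
  (hH : optReg α γ - m ∈ Set.Ioo (0 : ℝ) 1) (hW : IsRieszNoise P γ W) {t : ℝ} (ht : 0 < t)

include hα hγ hγ' hθ hH hW ht

/-- The field of the `m`-th derivatives is Hölder continuous in mean square, hence has a continuous
version. -/
theorem exists_continuous_version_heatField {ρ : ℝ → ℝ} (hρ : IsClock (Set.Ioo 0 t) ρ)
    (hdens : ∀ p, spectralNorm α γ θ σ (Set.Ioo 0 t) ρ p =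
      spectralNorm α γ θ σ (Set.Ioo 0 t) (fun s => s) p)
    (hE : ∀ x, energy γ (heatField α θ σ (Set.Ioo 0 t) ρ m x) < ∞) {Y : ℝ → Ω → ℝ}
    (hY : ∀ x, IsWienerIntegral P γ W (heatField α θ σ (Set.Ioo 0 t) ρ m x) (Y x)) :
    ∃ Z : ℝ → Ω → ℝ, (∀ ω, Continuous fun x => Z x ω) ∧ ∀ x, Z x =ᵐ[P] Y x := by
  have hm := fun x => hρ.measurable_heatField (θ := θ) hα hθ σ m x
  have hd := fun x y => (hY y).sub hγ hγ' hW (hm y) (hm x) (hY x)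
  have hH0 := hH.1
  refine exists_continuous_version_of_gaussian (fun x => (hY x).1) (fun x y => (hd x y).map_eq hW)
    (C := (fbmConst α γ m * (σ / √θ)) ^ 2) (h := 2 * (optReg α γ - m)) (by positivity)
    (by linarith) fun x y => ?_
  rw [eLpNorm_sq_eq_spectralNorm (σ := σ) hα hγ hγ' hθ hW hρ (hd x y)
    (energy_sub_lt_top hγ hγ' (hm y) (hm x) (hE y) (hE x)) Finset.univ ![1, -1] ![m, m] ![y, x]
    (fun s z => by simp [sub_eq_add_neg]), hdens, ← spectralNorm_sub_eq hθ hH ht]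
  exact spectralNorm_mono Set.subset_union_left _

/-- The mild solution at time `t` has a version with `m` times continuously differentiable paths,
and its `m`-th derivative is the Wiener integral of the differentiated kernel. -/
theorem exists_contDiff_mildSolution :
    ∃ Z : ℝ → Ω → ℝ, (∀ ω, ContDiff ℝ m fun x => Z x ω) ∧
      (∀ x, IsWienerIntegral P γ W (mildKernel α θ σ t x) (Z x)) ∧
      ∀ x, IsWienerIntegral P γ W (heatField α θ σ (Set.Ioo 0 t) (fun s => t - s) m x)
        (fun ω => iteratedDeriv m (fun y => Z y ω) x) := by
  have hρ := isClock_Ioo_sub t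
  have hE : ∀ k ≤ m, ∀ x, energy γ (heatField α θ σ (Set.Ioo 0 t) (fun s => t - s) k x) < ∞ :=
    fun k hk x => (energy_heatField_Ioo_lt_top hα hγ hγ' hθ hH ht hk x).2
  have hm := fun k x => hρ.measurable_heatField (θ := θ) hα hθ σ k x
  have hex : ∀ k x, ∃ Y : Ω → ℝ, MemLp Y 2 P ∧ (k ≤ m →
      IsWienerIntegral P γ W (heatField α θ σ (Set.Ioo 0 t) (fun s => t - s) k x) Y) := by
    intro k x
    by_cases hk : k ≤ m
    · obtain ⟨Y, hY⟩ := exists_wienerIntegral_Ioo hα hγ hγ' hθ hW ht hρ k x (hE k hk x)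
      exact ⟨Y, hY.1, fun _ => hY⟩
    · exact ⟨0, MemLp.zero, fun h => absurd h hk⟩
  choose V hV2 hV using hex
  obtain ⟨hH0, hH1⟩ := hH
  have hopt : optReg α γ = 2 * γ + α / 2 - 1 / 2 := rfl
  -- the moments of order `k + 1 + ε`, `k + 1 ≤ m`, are finite for every `ε < H`
  set ε : ℝ := (optReg α γ - m) / 2 with hε
  obtain ⟨Z, h1, h2, h3⟩ := exists_contDiff_version m hV2 (ε := ε) (by linarith) (fun k hk => by
      have hkm : (k : ℝ) + 1 ≤ m := by exact_mod_cast hk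
      obtain ⟨C, hC0, hC⟩ := spectralNorm_taylor_le (σ := σ) (k := k) (ε := ε) (by linarith)
        (by linarith) (spectralMoment_Ioo_lt_top (α := α) hγ' hθ (r := (k : ℝ) + 1 + ε)
          (by linarith [(k.cast_nonneg : (0 : ℝ) ≤ k)]) (by linarith) t)
      refine ⟨√C, fun x y => le_ofReal_of_sq_le hC0 (abs_nonneg _) (le_trans (le_of_eq ?_)
        (hC x y))⟩
      have hy := hV k y hk.le
      have hx := hV k x hk.le
      have hx' := hV (k + 1) x hk
      have hm1 := measurable_uncurry_sub (hm k y) (hm k x)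
      have hm2 := measurable_uncurry_const_mul (y - x) (hm (k + 1) x)
      rw [eLpNorm_sq_eq_spectralNorm (σ := σ) hα hγ hγ' hθ hW hρ
        ((hy.sub hγ hγ' hW (hm k y) (hm k x) hx).sub hγ hγ' hW hm1 hm2 (hx'.const_mul (y - x)))
        (energy_sub_lt_top hγ hγ' hm1 hm2
          (energy_sub_lt_top hγ hγ' (hm k y) (hm k x) (hE k hk.le y) (hE k hk.le x))
          (energy_const_mul_lt_top _ (hE (k + 1) hk x)))
        Finset.univ ![1, -1, -(y - x)] ![k, k, k + 1] ![y, x, x]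
        (fun s z => by simp [Fin.sum_univ_three]; ring), spectralNorm_Ioo_comp_sub])
    (exists_continuous_version_heatField hα hγ hγ' hθ ⟨hH0, hH1⟩ hW ht hρ
      (spectralNorm_Ioo_comp_sub α γ θ σ t) (hE m le_rfl) fun x => hV m x le_rfl)
  refine ⟨Z, h1, fun x => ?_, fun x => (hV m x le_rfl).congr (h3 x).symm⟩
  rw [mildKernel_eq_heatField]
  exact (hV 0 x (Nat.zero_le _)).congr (h2 x).symm

/-- The noise after time `t` contributes smooth increments to the `m`-th derivative. The field
itself may have infinite energy, so that it is normalised to vanish at the origin; its derivatives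
need no normalisation. -/
theorem exists_smooth_remainder :
    ∃ T : ℝ → Ω → ℝ, (∀ ω, Continuous fun x => T x ω) ∧
      (∀ᵐ ω ∂P, ContDiff ℝ (⊤ : ℕ∞) fun x => T x ω) ∧
      ∀ x, IsWienerIntegral P γ W (fun s z => heatField α θ σ (Set.Ioi t) (fun s => s) m x s z -
        heatField α θ σ (Set.Ioi t) (fun s => s) m 0 s z) (T x) := by
  have hρ := isClock_Ioi ht
  have hm := fun k x => hρ.measurable_heatField (θ := θ) hα hθ σ k x
  -- the integrands of the normalised field and of its derivatives
  let φ : ℕ → ℝ → ℝ → ℝ → ℝ := fun j x s z => match j with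
    | 0 => heatField α θ σ (Set.Ioi t) (fun s => s) m x s z -
        heatField α θ σ (Set.Ioi t) (fun s => s) m 0 s z
    | j + 1 => heatField α θ σ (Set.Ioi t) (fun s => s) (m + (j + 1)) x s z
  have hφm : ∀ j x, Measurable (Function.uncurry (φ j x)) := by
    rintro (_ | j) x
    · exact measurable_uncurry_sub (hm m x) (hm m 0)
    · exact hm _ x
  have hφE : ∀ j x, energy γ (φ j x) < ∞ := by
    rintro (_ | j) x
    · exact energy_heatField_sub_lt_top hα hγ hγ' hθ m ht (one_lt_heatExponent hα hH le_rfl) 0 x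
    · have h1 := lintegral_Ioi_rpow_lt_top hθ ht
        (one_lt_heatExponent hα hH (Nat.le_add_right m j))
      have h2 : ((m + j : ℕ) : ℝ) + 1 = ((m + (j + 1) : ℕ) : ℝ) := by push_cast; ring
      rw [h2] at h1
      exact energy_heatField_lt_top hα hγ hγ' hθ hρ _ h1 x
  have hex : ∀ j x, ∃ Y : Ω → ℝ, IsWienerIntegral P γ W (φ j x) Y := by
    intro j x
    refine (isApproximable_Ioi hγ hγ' ht (hφm j x) (hφE j x) ?_ ?_).exists_wienerIntegral hγ hγ' hW
      (hφm j x)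
    · rcases j with _ | j
      · exact (continuousOn_heatField hα hθ hρ.continuous hρ.pos m x).sub
          (continuousOn_heatField hα hθ hρ.continuous hρ.pos m 0)
      · exact continuousOn_heatField hα hθ hρ.continuous hρ.pos _ x
    · intro s hs z
      rcases j with _ | j
      · simp [φ, heatField_of_notMem hs]
      · exact heatField_of_notMem hs _ x z
  choose V hV using hex
  have hsub : ∀ j x y s z, φ j y s z - φ j x s z =
      heatField α θ σ (Set.Ioi t) (fun s => s) (m + j) y s z -
        heatField α θ σ (Set.Ioi t) (fun s => s) (m + j) x s z := by
    rintro (_ | j) x y s z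
    · simp [φ]
    · rfl
  have hH1 := hH.2
  have hopt : optReg α γ = 2 * γ + α / 2 - 1 / 2 := rfl
  have hmom : ∀ r : ℝ, (m : ℝ) + 1 ≤ r →
      spectralMoment α γ θ (Set.Ioi t) (fun s => s) r < ∞ := fun r hr =>
    spectralMoment_Ioi_lt_top hα hθ (by linarith) ht
  have htaylor : ∀ j, ∃ C : ℝ, ∀ x y,
      eLpNorm (fun ω => V j y ω - V j x ω - (y - x) * V (j + 1) x ω) 2 P ≤
        ENNReal.ofReal (C * |y - x| ^ (1 + (1 : ℝ))) := by
    intro j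
    obtain ⟨C, hC0, hC⟩ := spectralNorm_taylor_le (σ := σ) (k := m + j) (ε := 1) zero_le_one le_rfl
      (hmom (((m + j : ℕ) : ℝ) + 1 + 1) (by
        push_cast; linarith [(j.cast_nonneg : (0 : ℝ) ≤ j)]))
    refine ⟨√C, fun x y => le_ofReal_of_sq_le hC0 (abs_nonneg _) (le_trans (le_of_eq ?_)
      (hC x y))⟩
    have hm1 := measurable_uncurry_sub (hφm j y) (hφm j x)
    have hm2 := measurable_uncurry_const_mul (y - x) (hφm (j + 1) x)
    refine eLpNorm_sq_eq_spectralNorm (σ := σ) hα hγ hγ' hθ hW hρ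
      (((hV j y).sub hγ hγ' hW (hφm j y) (hφm j x) (hV j x)).sub hγ hγ' hW hm1 hm2
        ((hV (j + 1) x).const_mul (y - x)))
      (energy_sub_lt_top hγ hγ' hm1 hm2
        (energy_sub_lt_top hγ hγ' (hφm j y) (hφm j x) (hφE j y) (hφE j x))
        (energy_const_mul_lt_top _ (hφE (j + 1) x)))
      Finset.univ _ _ _ fun s z => ?_
    simp only [hsub, Fin.sum_univ_three, Matrix.cons_val]
    simp only [φ]
    rw [← add_assoc]
    ring
  have hcont : ∀ j, ∃ Z : ℝ → Ω → ℝ, (∀ ω, Continuous fun x => Z x ω) ∧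
      ∀ x, Z x =ᵐ[P] V j x := by
    intro j
    obtain ⟨C, hC0, hC⟩ := spectralNorm_sub_le (σ := σ) (k := m + j)
      (hmom (((m + j : ℕ) : ℝ) + 1) (by
        push_cast; linarith [(j.cast_nonneg : (0 : ℝ) ≤ j)]))
    have hd := fun x y => (hV j y).sub hγ hγ' hW (hφm j y) (hφm j x) (hV j x)
    refine exists_continuous_version_of_gaussian (fun x => (hV j x).1)
      (fun x y => (hd x y).map_eq hW) hC0 two_pos fun x y => le_trans (le_of_eq ?_) (hC x y)
    exact eLpNorm_sq_eq_spectralNorm (σ := σ) hα hγ hγ' hθ hW hρ (hd x y)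
      (energy_sub_lt_top hγ hγ' (hφm j y) (hφm j x) (hφE j y) (hφE j x)) Finset.univ _ _ _
      (fun s z => by simp [hsub, sub_eq_add_neg])
  obtain ⟨T, hT1, hT2⟩ := hcont 0
  refine ⟨T, hT1, ?_, fun x => (hV 0 x).congr (hT2 x).symm⟩
  have hall : ∀ n : ℕ, ∀ᵐ ω ∂P, ContDiff ℝ n fun x => T x ω := by
    intro n
    obtain ⟨Z, h1, h2, -⟩ := exists_contDiff_version n (fun k x => (hV k x).1) one_pos
      (fun k _ => htaylor k) (hcont n)
    filter_upwards [ae_forall_eq_of_continuous (ae_of_all _ hT1)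
      (ae_of_all _ fun ω => (h1 ω).continuous) fun x => (hT2 x).trans (h2 x).symm] with ω hω
    have : (fun x => T x ω) = fun x => Z x ω := funext hω
    rw [this]
    exact h1 ω
  filter_upwards [ae_all_iff.2 hall] with ω hω
  exact contDiff_infty.2 hω

end

end

section

/-! ### The decomposition -/

variable {α γ θ σ : ℝ} {m : ℕ} {Ω : Type*} [MeasurableSpace Ω] {P : Measure Ω}

/-- A centered Gaussian process vanishing at the origin is a fractional Brownian motion if its
increments have the right variance. -/
theorem isFractionalBrownianMotion_of_increments {H : ℝ} {B : ℝ → Ω → ℝ}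
    (hG : IsGaussianProcess B P) (hB : ∀ x, MemLp (B x) 2 P) (hc : ∀ x, ∫ ω, B x ω ∂P = 0)
    (h0 : B 0 =ᵐ[P] 0)
    (hinc : ∀ x y, eLpNorm (fun ω => B y ω - B x ω) 2 P ^ 2 = ENNReal.ofReal (|y - x| ^ (2 * H)))
    (hcont : ∀ᵐ ω ∂P, Continuous fun x => B x ω) : IsFractionalBrownianMotion P H B := by
  refine ⟨hG, hc, fun x y => ?_, hcont⟩
  have h1 : ∀ x y, ∫ ω, (B y ω - B x ω) ^ 2 ∂P = |y - x| ^ (2 * H) := by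
    intro x y
    have h2 := hinc x y
    have h3 : MemLp (fun ω => B y ω - B x ω) 2 P := (hB y).sub (hB x)
    rw [eLpNorm_two_sq_eq_integral h3,
      ENNReal.ofReal_eq_ofReal_iff (integral_nonneg fun _ => sq_nonneg _) (by positivity)] at h2
    exact h2
  have h3 : ∀ x, ∫ ω, B x ω ^ 2 ∂P = |x| ^ (2 * H) := by
    intro x
    rw [← sub_zero x, ← h1, sub_zero]
    refine integral_congr_ae ?_
    filter_upwards [h0] with ω hω
    simp [hω]
  -- polarization
  have h4 : ∀ ω, B x ω * B y ω = (B x ω ^ 2 + B y ω ^ 2 - (B x ω - B y ω) ^ 2) / 2 := fun ω => by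
    ring
  simp_rw [h4]
  have h5 : Integrable (fun ω => B x ω ^ 2 + B y ω ^ 2) P :=
    (hB x).integrable_sq.add (hB y).integrable_sq
  have h6 : Integrable (fun ω => (B x ω - B y ω) ^ 2) P := ((hB x).sub (hB y)).integrable_sq
  rw [integral_div, integral_sub h5 h6, integral_add (hB x).integrable_sq (hB y).integrable_sq,
    h1, h3, h3]

variable {W : ℝ≥0 × BddBorel → Ω → ℝ}

theorem remainderKernel_eq_heatField (α θ σ : ℝ) (m : ℕ) (t x s z : ℝ) :
    remainderKernel α θ σ m t x s z =
      (-1) * (heatField α θ σ (Set.Ioi t) (fun s => s) m x s z -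
        heatField α θ σ (Set.Ioi t) (fun s => s) m 0 s z) := by
  by_cases hs : s ∈ Set.Ioi t
  · simp only [remainderKernel, heatField, Set.indicator_of_mem hs, heatDeriv, zero_sub]
    ring
  · simp [remainderKernel, heatField, Set.indicator_of_notMem hs]

theorem heatField_union {S S' : Set ℝ} (h : Disjoint S S') (ρ : ℝ → ℝ) (k : ℕ) (x s z : ℝ) :
    heatField α θ σ (S ∪ S') ρ k x s z =
      heatField α θ σ S ρ k x s z + heatField α θ σ S' ρ k x s z := by
  simp only [heatField]
  rw [Set.indicator_union_of_disjoint h]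

section

variable (hα : 0 < α) (hγ : 0 < γ) (hγ' : γ < 1 / 4) (hθ : 0 < θ)
  (hH : optReg α γ - m ∈ Set.Ioo (0 : ℝ) 1) (hW : IsRieszNoise P γ W) {t : ℝ} (ht : 0 < t)

include hα hγ hγ' hθ hH hW ht

/-- The increments of the field driven by the noise at all times are those of a fractional Brownian
motion: the integral over the time of `exp (-2 θ s |ξ| ^ α)` is `(2 θ |ξ| ^ α)⁻¹`. -/
theorem isFractionalBrownianMotion_of_isWienerIntegral (hσ : 0 < σ) {U T : ℝ → Ω → ℝ}
    (hU : ∀ x, IsWienerIntegral P γ W (heatField α θ σ (Set.Ioo 0 t) (fun s => s) m x) (U x))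
    (hUc : ∀ ω, Continuous fun x => U x ω)
    (hT : ∀ x, IsWienerIntegral P γ W
      (fun s z => heatField α θ σ (Set.Ioi t) (fun s => s) m x s z -
        heatField α θ σ (Set.Ioi t) (fun s => s) m 0 s z) (T x))
    (hTc : ∀ ω, Continuous fun x => T x ω) :
    IsFractionalBrownianMotion P (optReg α γ - m)
      fun x ω => (fbmConst α γ m * (σ / √θ))⁻¹ * (U x ω - U 0 ω + T x ω) := by
  set κ := fbmConst α γ m * (σ / √θ) with hκ
  have hκ0 : 0 < κ := mul_pos (fbmConst_pos hH) (by positivity)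
  have hm1 := fun x => (isClock_Ioo t).measurable_heatField (θ := θ) hα hθ σ m x
  have hm2 := fun x => (isClock_Ioi ht).measurable_heatField (θ := θ) hα hθ σ m x
  have hE1 := fun x => (energy_heatField_Ioo_lt_top (σ := σ) hα hγ hγ' hθ hH ht le_rfl x).1
  have hE2 := fun x => energy_heatField_sub_lt_top (σ := σ) hα hγ hγ' hθ m ht
    (one_lt_heatExponent hα hH le_rfl) 0 x
  have hmU := fun x => measurable_uncurry_sub (hm1 x) (hm1 0)
  have hmT := fun x => measurable_uncurry_sub (hm2 x) (hm2 0)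
  have hmV := fun x => measurable_uncurry_const_mul κ⁻¹ (measurable_uncurry_add (hmU x) (hmT x))
  have hEV := fun x => energy_const_mul_lt_top κ⁻¹ (energy_add_lt_top hγ hγ' (hmU x) (hmT x)
    (energy_sub_lt_top hγ hγ' (hm1 x) (hm1 0) (hE1 x) (hE1 0)) (hE2 x))
  have hV := fun x => (((hU x).sub hγ hγ' hW (hm1 x) (hm1 0) (hU 0)).add hγ hγ' hW (hmU x) (hmT x)
    (hT x)).const_mul κ⁻¹
  refine isFractionalBrownianMotion_of_increments
    (isGaussianProcess_of_isWienerIntegral hγ hγ' hW hmV hV) (fun x => (hV x).1)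
    (fun x => (hV x).integral_eq_zero hW) ?_ (fun x y => ?_)
    (ae_of_all _ fun ω => (((hUc ω).sub continuous_const).add (hTc ω)).const_mul _)
  · have h0 := hV 0
    simp only [sub_self, add_zero, mul_zero] at h0
    have h1 := h0.ae_eq hγ hγ' hW measurable_const (by simp [energy]) IsWienerIntegral.zero
    simpa using! h1
  · have hdisj : Disjoint (Set.Ioo 0 t) (Set.Ioi t) :=
      Set.disjoint_left.2 fun s h1 h2 => lt_asymm h1.2 h2
    have hS : IsClock (Set.Ioo 0 t ∪ Set.Ioi t) (fun s => s) :=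
      isClock_id (measurableSet_Ioo.union measurableSet_Ioi)
        (Set.union_subset (fun _ hs => hs.1) fun _ hs => ht.trans hs)
    have h1 := ((hV y).sub hγ hγ' hW (hmV y) (hmV x) (hV x)).const_mul κ
    have h2 := eLpNorm_sq_eq_spectralNorm (σ := σ) hα hγ hγ' hθ hW hS h1
      (energy_const_mul_lt_top κ (energy_sub_lt_top hγ hγ' (hmV y) (hmV x) (hEV y) (hEV x)))
      Finset.univ ![1, -1] ![m, m] ![y, x] (fun s z => by
        simp only [Fin.sum_univ_two, Matrix.cons_val_zero, Matrix.cons_val_one,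
          heatField_union hdisj]
        field_simp
        ring)
    rw [spectralNorm_sub_eq hθ hH ht, ENNReal.ofReal_mul (by positivity)] at h2
    have h3 : ∀ f : Ω → ℝ, eLpNorm (fun ω => κ * f ω) 2 P ^ 2 =
        ENNReal.ofReal (κ ^ 2) * eLpNorm f 2 P ^ 2 := by
      intro f
      have := eLpNorm_const_smul κ f 2 P
      simp only [Pi.smul_def, smul_eq_mul] at this
      rw [this, mul_pow, Real.enorm_eq_ofReal hκ0.le, ENNReal.ofReal_pow hκ0.le]
    rw [h3] at h2
    exact (ENNReal.mul_right_inj (ENNReal.ofReal_pos.2 (by positivity)).ne'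
      ENNReal.ofReal_ne_top).1 h2

/-- Reversing time does not change the law of the field of the `m`-th derivatives, since the
spectral measures agree. -/
theorem identDistrib_of_isWienerIntegral {U V : ℝ → Ω → ℝ}
    (hV : ∀ x, IsWienerIntegral P γ W (heatField α θ σ (Set.Ioo 0 t) (fun s => t - s) m x) (V x))
    (hVc : ∀ᵐ ω ∂P, Continuous fun x => V x ω)
    (hU : ∀ x, IsWienerIntegral P γ W (heatField α θ σ (Set.Ioo 0 t) (fun s => s) m x) (U x))
    (hUc : ∀ᵐ ω ∂P, Continuous fun x => U x ω) :
    IdentDistrib (fun ω x => V x ω) (fun ω x => U x ω) P P := by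
  have := hW.gaussian.isProbabilityMeasure
  have hE := fun x => energy_heatField_Ioo_lt_top (σ := σ) hα hγ hγ' hθ hH ht le_rfl x
  have hres : ∀ {Y : ℝ → Ω → ℝ} (I : Finset ℝ), AEMeasurable (fun ω x => Y x ω) P →
      AEMeasurable (fun ω => I.restrict (Y · ω)) P := fun I h =>
    (Finset.measurable_restrict _).comp_aemeasurable h
  have hV2 := aemeasurable_path (fun x => (hV x).1.1.aemeasurable) hVc
  have hU2 := aemeasurable_path (fun x => (hU x).1.1.aemeasurable) hUc
  refine (identDistrib_iff_forall_finset_identDistrib hV2 hU2).2 fun I =>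
    ⟨hres I hV2, hres I hU2, ?_⟩
  have h1 := isClock_Ioo_sub t
  have h2 := isClock_Ioo t
  refine map_restrict_eq_of_isWienerIntegral hγ hγ' hW
    (fun x => h1.measurable_heatField hα hθ σ m x) (fun x => h2.measurable_heatField hα hθ σ m x)
    (fun x => (hE x).2) (fun x => (hE x).1) hV hU I fun a => ?_
  refine (ENNReal.pow_right_strictMono two_ne_zero).injective ?_
  rw [eLpNorm_sq_sum_heatField Finset.univ a (fun _ => m) (fun i : I => (i : ℝ)) hα hγ hθ
      h1.measurableSet h1.subset h1.continuous.measurable h1.pos,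
    eLpNorm_sq_sum_heatField Finset.univ a (fun _ => m) (fun i : I => (i : ℝ)) hα hγ hθ
      h2.measurableSet h2.subset h2.continuous.measurable h2.pos, spectralNorm_Ioo_comp_sub]

/-- The fractional Brownian motion is built from the time reversed field `U` and the normalised
remainder `T`, and `R` is what is left of `U`. Neither depends on the version `V`. -/
theorem exists_fbm_add_smooth (hσ : 0 < σ) :
    ∃ B R : ℝ → Ω → ℝ, IsFractionalBrownianMotion P (optReg α γ - m) B ∧
      (∀ᵐ ω ∂P, ContDiff ℝ (⊤ : ℕ∞) fun x => R x ω) ∧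
      (∀ x, IsWienerIntegral P γ W (remainderKernel α θ σ m t x) fun ω => R x ω - R 0 ω) ∧
      ∀ V : ℝ → Ω → ℝ, (∀ᵐ ω ∂P, Continuous fun x => V x ω) →
        (∀ x, IsWienerIntegral P γ W
          (heatField α θ σ (Set.Ioo 0 t) (fun s => t - s) m x) (V x)) →
        IdentDistrib (fun ω x => V x ω)
          (fun ω x => fbmConst α γ m * (σ / √θ) * B x ω + R x ω) P P := by
  have hκ0 : 0 < fbmConst α γ m * (σ / √θ) := mul_pos (fbmConst_pos hH) (by positivity)
  have hE := fun x => (energy_heatField_Ioo_lt_top (σ := σ) hα hγ hγ' hθ hH ht le_rfl x).1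
  choose Y hY using fun x =>
    exists_wienerIntegral_Ioo hα hγ hγ' hθ hW ht (isClock_Ioo t) m x (hE x)
  obtain ⟨U, hUc, hUY⟩ := exists_continuous_version_heatField hα hγ hγ' hθ hH hW ht (isClock_Ioo t)
    (fun _ => rfl) hE hY
  have hU := fun x => (hY x).congr (hUY x).symm
  obtain ⟨T, hTc, hTs, hT⟩ := exists_smooth_remainder (σ := σ) hα hγ hγ' hθ hH hW ht
  have hT0 : T 0 =ᵐ[P] fun _ => 0 := by
    have h0 := hT 0
    simp only [sub_self] at h0
    exact h0.ae_eq hγ hγ' hW measurable_const (by simp [energy]) IsWienerIntegral.zero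
  refine ⟨fun x ω => (fbmConst α γ m * (σ / √θ))⁻¹ * (U x ω - U 0 ω + T x ω),
    fun x ω => U 0 ω - T x ω,
    isFractionalBrownianMotion_of_isWienerIntegral hα hγ hγ' hθ hH hW ht hσ hU hUc hT hTc,
    ?_, fun x => ?_, fun V hVc hV => ?_⟩
  · filter_upwards [hTs] with ω hω
    exact contDiff_const.sub hω
  · have h1 : remainderKernel α θ σ m t x = fun s z =>
        (-1) * (heatField α θ σ (Set.Ioi t) (fun s => s) m x s z -
          heatField α θ σ (Set.Ioi t) (fun s => s) m 0 s z) :=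
      funext fun s => funext fun z => remainderKernel_eq_heatField α θ σ m t x s z
    rw [h1]
    refine ((hT x).const_mul (-1)).congr ?_
    filter_upwards [hT0] with ω hω
    rw [hω]
    ring
  · refine (identDistrib_of_isWienerIntegral hα hγ hγ' hθ hH hW ht hV hVc hU
      (ae_of_all _ hUc)).trans (IdentDistrib.of_ae_eq ?_ (ae_of_all _ fun ω => ?_))
    · exact aemeasurable_path (fun x => (hU x).1.1.aemeasurable) (ae_of_all _ hUc)
    · ext x
      dsimp only
      rw [mul_inv_cancel_left₀ hκ0.ne']
      ring

/-- The `m`-th derivative of every version with `m` times continuously differentiable paths is the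
Wiener integral of the differentiated kernel, with continuous paths. -/
theorem isWienerIntegral_iteratedDeriv {X : ℝ → Ω → ℝ}
    (hX : ∀ x, IsWienerIntegral P γ W (mildKernel α θ σ t x) (X x))
    (hXc : ∀ᵐ ω ∂P, ContDiff ℝ m fun x => X x ω) :
    (∀ᵐ ω ∂P, Continuous fun x => iteratedDeriv m (fun y => X y ω) x) ∧
    ∀ x, IsWienerIntegral P γ W (heatField α θ σ (Set.Ioo 0 t) (fun s => t - s) m x)
      fun ω => iteratedDeriv m (fun y => X y ω) x := by
  obtain ⟨Z, hZc, hZ, hZm⟩ := exists_contDiff_mildSolution (σ := σ) hα hγ hγ' hθ hH hW ht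
  refine ⟨?_, fun x => (hZm x).congr ?_⟩
  · filter_upwards [hXc] with ω hω
    exact hω.continuous_iteratedDeriv m le_rfl
  have hXZ : ∀ x, X x =ᵐ[P] Z x := by
    intro x
    have hx := hX x
    have hz := hZ x
    rw [mildKernel_eq_heatField] at hx hz
    exact hx.ae_eq hγ hγ' hW ((isClock_Ioo_sub t).measurable_heatField hα hθ σ 0 x)
      (energy_heatField_Ioo_lt_top hα hγ hγ' hθ hH ht (Nat.zero_le m) x).2 hz
  filter_upwards [ae_forall_eq_of_continuous (hXc.mono fun ω h => h.continuous)
    (ae_of_all _ fun ω => (hZc ω).continuous) hXZ] with ω hω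
  have h1 : (fun y => X y ω) = fun y => Z y ω := funext hω
  rw [h1]

omit ht in
/-- There is a mild solution whose paths at each positive time are `m` times continuously
differentiable. -/
theorem exists_isMildSolution_contDiff : ∃ X : ℝ → ℝ → Ω → ℝ, IsMildSolution P α γ θ σ W X ∧
    ∀ t : ℝ, 0 < t → ∀ᵐ ω ∂P, ContDiff ℝ m fun x => X t x ω := by
  have hex : ∀ t : ℝ, ∃ Z : ℝ → Ω → ℝ, (0 < t → ∀ ω, ContDiff ℝ m fun x => Z x ω) ∧
      ∀ x, IsWienerIntegral P γ W (mildKernel α θ σ t x) (Z x) := by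
    intro t
    rcases lt_or_ge 0 t with ht | ht
    · obtain ⟨Z, h1, h2, -⟩ := exists_contDiff_mildSolution (σ := σ) hα hγ hγ' hθ hH hW ht
      exact ⟨Z, fun _ => h1, h2⟩
    · refine ⟨fun _ _ => 0, fun h => absurd h ht.not_gt, fun x => ?_⟩
      have h1 : mildKernel α θ σ t x = fun _ _ => 0 := by
        ext s z
        simp [mildKernel, Set.Ioo_eq_empty ht.not_gt]
      rw [h1]
      exact IsWienerIntegral.zero
  choose X hX1 hX2 using hex
  exact ⟨X, fun t _ x => hX2 t x, fun t ht => ae_of_all _ (hX1 t ht)⟩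

end

end

end RieszSPDE

end

theorem proposition6p2 {Ω : Type*} [MeasurableSpace Ω] (P : Measure Ω) [IsProbabilityMeasure P]
    (α γ θ σ : ℝ) (hα : 0 < α) (hγ : 0 < γ) (hγ' : γ < 1 / 4) (hθ : 0 < θ) (hσ : 0 < σ)
    (m : ℕ) (hH : RieszSPDE.optReg α γ - m ∈ Set.Ioo (0 : ℝ) 1)
    (W : ℝ≥0 × RieszSPDE.BddBorel → Ω → ℝ) (hW : RieszSPDE.IsRieszNoise P γ W) :
    Integrable (RieszSPDE.constIntegrand α γ m) volume ∧
    (∃ X : ℝ → ℝ → Ω → ℝ, RieszSPDE.IsMildSolution P α γ θ σ W X ∧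
      ∀ t : ℝ, 0 < t → ∀ᵐ ω ∂P, ContDiff ℝ m (fun x => X t x ω)) ∧
    ∀ X : ℝ → ℝ → Ω → ℝ, RieszSPDE.IsMildSolution P α γ θ σ W X →
      ∀ t : ℝ, 0 < t → (∀ᵐ ω ∂P, ContDiff ℝ m (fun x => X t x ω)) →
      ∃ B R : ℝ → Ω → ℝ,
        RieszSPDE.IsFractionalBrownianMotion P (RieszSPDE.optReg α γ - m) B ∧
        (∀ᵐ ω ∂P, ContDiff ℝ (⊤ : ℕ∞) (fun x => R x ω)) ∧
        (∀ x : ℝ, RieszSPDE.IsWienerIntegral P γ W (RieszSPDE.remainderKernel α θ σ m t x)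
          (fun ω => R x ω - R 0 ω)) ∧
        IdentDistrib (fun ω (x : ℝ) => iteratedDeriv m (fun y => X t y ω) x)
          (fun ω (x : ℝ) => RieszSPDE.fbmConst α γ m * (σ / √θ) * B x ω + R x ω) P P := by
  refine ⟨RieszSPDE.integrable_constIntegrand hH,
    RieszSPDE.exists_isMildSolution_contDiff hα hγ hγ' hθ hH hW, fun X hX t ht hXc => ?_⟩
  obtain ⟨B, R, hB, hR, hRW, hid⟩ := RieszSPDE.exists_fbm_add_smooth hα hγ hγ' hθ hH hW ht hσ
  obtain ⟨hVc, hV⟩ := RieszSPDE.isWienerIntegral_iteratedDeriv hα hγ hγ' hθ hH hW ht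
    (fun x => hX t ht.le x) hXc
  exact ⟨B, R, hB, hR, hRW, hid _ hVc hV⟩
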